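/- Let $r\ge 1$ and $\rho\ge 0$. Consider a $(1+1)$-dimensional evolution equation $\mathcal E$: $u_t=H(t,x,u_0,\dots,u_r)$, where $u_0=u$, $u_k=\partial^k u/\partial x^k$ and $H$ is a real-valued $C^\infty$ function on an open set, and a generalized vector field $Q=\eta\,\partial_u$ of order $\rho$ in reduced form, i.e. $\eta=\eta(t,x,u_0,\dots,u_\rho)$ is a $C^\infty$ function on an open set, with $\partial\eta/\partial u_\rho\neq0$ wherever $\eta=0$. (It is not necessary to assume $H_{u_r}\ne0$.) In the infinite jet space with coordinates $t,x$ and $u_\alpha=u_{\alpha_0,\alpha_1}=\partial^{\alpha_0+\alpha_1}u/\partial t^{\alpha_0}\partial x^{\alpha_1}$ (with the product topology) let $D_t$, $D_x$ be the total derivatives, put $E=u_t-H$, and let $\mathcal M$ be the set of all jets, over which $H$ and $\eta$ are defined, that satisfy $D_t^{\alpha_0}D_x^{\alpha_1}E=0$ for all $\alpha_0,\alpha_1\ge0$ and $D_x^k\eta=0$ for all $k\ge0$. For a set $W$ of jets, $\mathcal E$ is called *conditionally invariant with respect to $Q$ over $W$* if $Q_{(r)}E=0$ on $\mathcal M\cap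 W$, where $Q_{(r)}=\sum_{\alpha_0+\alpha_1\le r}(D_t^{\alpha_0}D_x^{\alpha_1}\eta)\,\partial_{u_\alpha}$. A *$\rho$-parametric family of $Q$-invariant solutions over $W$* is a $C^\infty$ function $f(t,x,\bar\varkappa)$, $\bar\varkappa=(\varkappa_1,\dots,\varkappa_\rho)$, on a nonempty open set $U\subset\mathbb R^2\times\mathbb R^\rho$ such that for every fixed $\bar\varkappa$ the function $u=f(\cdot,\cdot,\bar\varkappa)$ satisfies both $u_t=H$ and $\eta=0$ on its domain, the jets of all these functions lie in $W$, and the parameters are essential: over no nonempty open $U'\subset U$ can one write $f(t,x,\bar\varkappa)=g(t,x,\zeta^1(\bar\varkappa),\dots,\zeta^{\sigma}(\bar\varkappa))$ with smooth $g,\zeta^1,\dots,\zeta^\sigma$ and $\sigma<\rho$. The family *passes through* a jet $j$ if $j$ is the jet of $f(\cdot,\cdot,\bar\varkappa)$ at $(t,x)$ for some $(t,x,\bar\varkappa)\in U$. Then $\mathcal E$ is (locally) conditionally invariant with respect to $Q$ if and only if it possesses a $\rho$-parametric family of $Q$-invariant solutions, in the following precise senses. 1. For every open set $W$ of jets, $\mathcal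 E$ is conditionally invariant with respect to $Q$ over $W$ if and only if through every jet of $\mathcal M\cap W$ there passes a $\rho$-parametric family of $Q$-invariant solutions over $W$. 2. For every open set $W$ of jets, there is an open $W'\subset W$ with $\mathcal M\cap W'\neq\emptyset$ over which $\mathcal E$ is conditionally invariant with respect to $Q$ if and only if there is a $\rho$-parametric family of $Q$-invariant solutions of $\mathcal E$ over $W$. 3. For every jet $j\in\mathcal M$, $\mathcal E$ is conditionally invariant with respect to $Q$ over some open neighbourhood of $j$ if and only if there is a $\rho$-parametric family $f$ of $Q$-invariant solutions of $\mathcal E$ that passes through $j$ at some $(t,x,\bar\varkappa)$ where $\det\bigl(\partial^{a}f/\partial x^{a-1}\partial\varkappa_b\bigr)_{a,b=1}^{\rho}\ne0$. -/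

import Mathlib

open Filter Topology
open scoped ContDiff

noncomputable section

namespace EvolCondSym

/-- The infinite jet space over the plane of `(t, x)` for one unknown function `u`, with the
product topology: a point is `((t, x), (u_α)_α)`, where `α = (α₀, α₁)` and `u_α` stands for
`∂^{α₀+α₁} u / ∂t^{α₀} ∂x^{α₁}`. A function that depends on finitely many of the coordinates
is a function on a jet space of finite order. -/
abbrev Jet : Type := (ℝ × ℝ) × (ℕ × ℕ → ℝ)

/-- The coordinates `((t, x), (u_0, …, u_n))`, where `u_k` stands for `∂^k u / ∂x^k`. -/
abbrev XJet (n : ℕ) : Type := (ℝ × ℝ) × (Fin (n + 1) → ℝ)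

/-- The projection of a jet to `((t, x), (u_0, …, u_n))`. -/
def toXJet (n : ℕ) (j : Jet) : XJet n := (j.1, fun k => j.2 (0, (k : ℕ)))

/-- `∂F/∂t`. -/
def partialT (F : Jet → ℝ) (j : Jet) : ℝ :=
  deriv (fun s => F ((s, j.1.2), j.2)) j.1.1

/-- `∂F/∂x`. -/
def partialX (F : Jet → ℝ) (j : Jet) : ℝ :=
  deriv (fun s => F ((j.1.1, s), j.2)) j.1.2

/-- `∂F/∂u_α`. -/
def partialU (α : ℕ × ℕ) (F : Jet → ℝ) (j : Jet) : ℝ :=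
  deriv (fun s => F (j.1, Function.update j.2 α s)) (j.2 α)

/-- The total derivative `D_t = ∂_t + ∑_α u_{α₀+1,α₁} ∂_{u_α}`. It is applied only to functions
of finitely many jet coordinates, for which the sum is finite. -/
def totalT (F : Jet → ℝ) (j : Jet) : ℝ :=
  partialT F j + ∑ᶠ α : ℕ × ℕ, j.2 (α.1 + 1, α.2) * partialU α F j

/-- The total derivative `D_x = ∂_x + ∑_α u_{α₀,α₁+1} ∂_{u_α}`. -/
def totalX (F : Jet → ℝ) (j : Jet) : ℝ :=
  partialX F j + ∑ᶠ α : ℕ × ℕ, j.2 (α.1, α.2 + 1) * partialU α F j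

/-- `D_t^{α₀} D_x^{α₁} F`. -/
def totalD (α : ℕ × ℕ) (F : Jet → ℝ) : Jet → ℝ := totalT^[α.1] (totalX^[α.2] F)

/-- An evolution equation `u_t = H(t, x, u_0, …, u_r)`, `r ≥ 1`, with `H` smooth on an open set.
(The condition `H_{u_r} ≠ 0` is not imposed.) -/
structure EvolutionEquation where
  r : ℕ
  one_le_r : 1 ≤ r
  dom : Set (XJet r)
  isOpen_dom : IsOpen dom
  H : XJet r → ℝ
  smooth : ContDiffOn ℝ ∞ H dom

/-- A generalized vector field `Q = η ∂_u` of order `ρ` in reduced form: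
`η = η(t, x, u_0, …, u_ρ)` is smooth on an open set, and it is of maximal rank with respect to
`u_ρ`, that is, `∂η/∂u_ρ ≠ 0` wherever `η = 0`. -/
structure ReducedOperator (ρ : ℕ) where
  dom : Set (XJet ρ)
  isOpen_dom : IsOpen dom
  η : XJet ρ → ℝ
  smooth : ContDiffOn ℝ ∞ η dom
  maximal_rank : ∀ z ∈ dom, η z = 0 →
    deriv (fun s => η (z.1, Function.update z.2 (Fin.last ρ) s)) (z.2 (Fin.last ρ)) ≠ 0

/-- The differential function `E = u_t - H`. -/
def EvolutionEquation.E (𝓔 : EvolutionEquation) (j : Jet) : ℝ :=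
  j.2 (1, 0) - 𝓔.H (toXJet 𝓔.r j)

/-- The characteristic `η` as a function on the jet space. -/
def ReducedOperator.char {ρ : ℕ} (Q : ReducedOperator ρ) (j : Jet) : ℝ :=
  Q.η (toXJet ρ j)

/-- The prolongation `Q_{(n)} F = ∑_{|α| ≤ n} (D_t^{α₀} D_x^{α₁} η) ∂F/∂u_α` of `Q = η ∂_u`. -/
def ReducedOperator.prolong {ρ : ℕ} (Q : ReducedOperator ρ) (n : ℕ) (F : Jet → ℝ) (j : Jet) : ℝ :=
  ∑ m ∈ Finset.range (n + 1), ∑ α ∈ Finset.HasAntidiagonal.antidiagonal m,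
    totalD α Q.char j * partialU α F j

/-- The set of jets over which both `H` and `η` are defined. -/
def jetDom {ρ : ℕ} (𝓔 : EvolutionEquation) (Q : ReducedOperator ρ) : Set Jet :=
  {j | toXJet 𝓔.r j ∈ 𝓔.dom ∧ toXJet ρ j ∈ Q.dom}

/-- The set `𝓜` determined in the jet space by all differential consequences of the evolution
equation and the differential consequences of `η = 0` with respect to `x`. -/
def consequences {ρ : ℕ} (𝓔 : EvolutionEquation) (Q : ReducedOperator ρ) : Set Jet :=
  {j | j ∈ jetDom 𝓔 Q ∧ (∀ α : ℕ × ℕ, totalD α 𝓔.E j = 0) ∧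
    ∀ k : ℕ, totalX^[k] Q.char j = 0}

/-- Conditional invariance of the evolution equation with respect to `Q`, over a set `W` of jets:
`Q_{(r)} E = 0` on `𝓜 ∩ W`. -/
def CondInvariantOn {ρ : ℕ} (𝓔 : EvolutionEquation) (Q : ReducedOperator ρ) (W : Set Jet) : Prop :=
  ∀ j ∈ consequences 𝓔 Q ∩ W, Q.prolong 𝓔.r 𝓔.E j = 0

/-- `∂u/∂t` for a function `u` of `(t, x)`. -/
def dT (u : ℝ × ℝ → ℝ) (p : ℝ × ℝ) : ℝ := deriv (fun s => u (s, p.2)) p.1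

/-- `∂u/∂x` for a function `u` of `(t, x)`. -/
def dX (u : ℝ × ℝ → ℝ) (p : ℝ × ℝ) : ℝ := deriv (fun s => u (p.1, s)) p.2

/-- The infinite jet of `u` at `p = (t, x)`. -/
def jetOf (u : ℝ × ℝ → ℝ) (p : ℝ × ℝ) : Jet := (p, fun α => (dT^[α.1] (dX^[α.2] u)) p)

/-- `u` is a `Q`-invariant solution of the evolution equation on the set `D`: at every point of `D`
it satisfies `u_t = H` and `η = 0`. -/
def IsInvariantSolutionOn {ρ : ℕ} (𝓔 : EvolutionEquation) (Q : ReducedOperator ρ)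
    (u : ℝ × ℝ → ℝ) (D : Set (ℝ × ℝ)) : Prop :=
  ∀ p ∈ D, jetOf u p ∈ jetDom 𝓔 Q ∧ 𝓔.E (jetOf u p) = 0 ∧ Q.char (jetOf u p) = 0

/-- On the set `U` of `((t, x), ϰ)`, the family `f` can be written with `σ` parameters:
`f(t, x, ϰ) = g(t, x, ζ(ϰ))` with smooth `g` and `ζ = (ζ¹, …, ζ^σ)`. -/
def ReducesTo {ρ : ℕ} (σ : ℕ) (f : (ℝ × ℝ) → (Fin ρ → ℝ) → ℝ)
    (U : Set ((ℝ × ℝ) × (Fin ρ → ℝ))) : Prop :=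
  ∃ (ζ : (Fin ρ → ℝ) → (Fin σ → ℝ)) (V : Set ((ℝ × ℝ) × (Fin σ → ℝ)))
    (g : (ℝ × ℝ) × (Fin σ → ℝ) → ℝ),
    ContDiffOn ℝ ∞ ζ (Prod.snd '' U) ∧ IsOpen V ∧ ContDiffOn ℝ ∞ g V ∧
    ∀ q ∈ U, (q.1, ζ q.2) ∈ V ∧ f q.1 q.2 = g (q.1, ζ q.2)

/-- The parameters `ϰ₁, …, ϰ_ρ` are (locally) essential in the family `f`: over no nonempty open
part of `U` can the family be written with fewer than `ρ` parameters. -/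
def EssentialOn {ρ : ℕ} (f : (ℝ × ℝ) → (Fin ρ → ℝ) → ℝ)
    (U : Set ((ℝ × ℝ) × (Fin ρ → ℝ))) : Prop :=
  ∀ U' ⊆ U, IsOpen U' → U'.Nonempty → ∀ σ < ρ, ¬ ReducesTo σ f U'

/-- `f`, defined on the nonempty open set `U`, is a `ρ`-parametric family of `Q`-invariant solutions
of the evolution equation (the parameters being essential), all of whose jets lie in `W`. -/
structure IsSolutionFamily {ρ : ℕ} (𝓔 : EvolutionEquation) (Q : ReducedOperator ρ) (W : Set Jet)
    (f : (ℝ × ℝ) → (Fin ρ → ℝ) → ℝ) (U : Set ((ℝ × ℝ) × (Fin ρ → ℝ))) : Prop where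
  isOpen : IsOpen U
  nonempty : U.Nonempty
  smooth : ContDiffOn ℝ ∞ (fun q : (ℝ × ℝ) × (Fin ρ → ℝ) => f q.1 q.2) U
  solution : ∀ ϰ, IsInvariantSolutionOn 𝓔 Q (fun p => f p ϰ) {p | (p, ϰ) ∈ U}
  jets : ∀ q ∈ U, jetOf (fun p => f p q.2) q.1 ∈ W
  essential : EssentialOn f U

/-- The determinant of `∂(f_0, …, f_{ρ-1}) / ∂(ϰ₁, …, ϰ_ρ)`, where `f_a = ∂^a f / ∂x^a`. -/
def paramDet {ρ : ℕ} (f : (ℝ × ℝ) → (Fin ρ → ℝ) → ℝ) (p : ℝ × ℝ) (ϰ : Fin ρ → ℝ) : ℝ :=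
  Matrix.det (Matrix.of fun a b : Fin ρ =>
    deriv (fun s => (dX^[(a : ℕ)] (fun p' => f p' (Function.update ϰ b s))) p) (ϰ b))

end EvolCondSym

end

/-! On `consequences 𝓔 Q` every D_x^k η vanishes, and among the derivatives involving t the function
E = u_t − H contains only u_t. Hence Q_(r)E collapses there to D_t η (`prolong_E_eq`), and
conditional invariance says that D_t η = 0 on 𝓜.

By the maximal rank condition, η = 0 is locally u_ρ = θ(t, x, u_0, …, u_{ρ-1}). Its x-consequences
then determine all further u_k, and the evolution equation determines all derivatives involving t.
So 𝓜 is locally a graph over (t, x, u_0, …, u_{ρ-1}) (`exists_isChart`, `eq_of_mem_consequences`).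
In these coordinates D_x becomes the vector field `xField`, and the evolution equation prescribes a
second field `tField`. Invariant solutions correspond to integral surfaces of these two fields, that
is, to solutions of a total differential equation dv = C(p, v) with C = `connectionForm`.

Sufficiency of conditional invariance: D_t η = 0 makes `tField` act on θ as D_t acts on u_ρ
(`IsChart.fderiv_graphCoord_tField`), which yields the Frobenius condition (`IsChart.compatible`).
`exists_solution_of_compatible` then gives solutions depending smoothly on their ρ initial values at
a point. These values are the parameters, and the parameter determinant is nonzero there, so near
that point the parameters are essential.

Necessity: along an invariant solution η vanishes identically in (t, x), so D_t η vanishes on its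
jets. A family that is nondegenerate at one point covers, by the inverse function theorem, a
neighbourhood in the coordinates above, hence all of 𝓜 near its jet
(`IsSolutionFamily.exists_condInvariantOn`).

It remains to see that essential parameters force nondegeneracy somewhere
(`IsSolutionFamily.exists_paramDet_ne_zero`). Otherwise the initial data at a fixed point p₁ form a
map of rank below ρ throughout, which on an open set factors through fewer parameters
(`exists_factorization_of_not_injective`). Uniqueness for the total differential equation
(`eqOn_of_hasFDerivAt_of_lipschitzOnWith`) propagates the factorization from p₁ to nearby p,
contradicting essentiality.

Smooth dependence on parameters is obtained by applying the inverse function theorem in the Banach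
space C([0,1], F), where composition with a smooth function is a smooth operator. -/

noncomputable section

namespace EvolCondSym

/-! ### Smooth local inverses, cut-offs, composition operators -/

section Analysis

variable {E F G : Type} [NormedAddCommGroup E] [NormedSpace ℝ E]
  [NormedAddCommGroup F] [NormedSpace ℝ F] [NormedAddCommGroup G] [NormedSpace ℝ G]

/-- A function that is smooth on an open set has, near a point where its derivative is invertible,
an inverse that is smooth on an open set. -/
theorem exists_smooth_openPartialHomeomorph [CompleteSpace E] {f : E → F} {O : Set E} {a : E}
    (hO : IsOpen O) (ha : a ∈ O) (hf : ContDiffOn ℝ ∞ f O) (f' : E ≃L[ℝ] F)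
    (hf' : HasFDerivAt f (f' : E →L[ℝ] F) a) :
    ∃ e : OpenPartialHomeomorph E F, a ∈ e.source ∧ e.source ⊆ O ∧ (∀ x, e x = f x) ∧
      ContDiffOn ℝ ∞ e.symm e.target := by
  have hfa : ContDiffAt ℝ ∞ f a := hf.contDiffAt (hO.mem_nhds ha)
  set e₀ := hfa.toOpenPartialHomeomorph f hf' (by simp)
  have hcont : ContinuousOn (fderiv ℝ f) O :=
    (hf.fderiv_of_isOpen (m := ∞) hO (by simp)).continuousOn
  set R : Set (E →L[ℝ] F) := Set.range ((↑) : (E ≃L[ℝ] F) → E →L[ℝ] F)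
  have hR : IsOpen R := ContinuousLinearEquiv.isOpen
  -- Smoothness of the inverse at an image point needs an invertible derivative at the preimage.
  -- Invertibility is an open condition, so the domain is cut down to where it holds.
  set O' := O ∩ fderiv ℝ f ⁻¹' R
  have hO' : IsOpen O' := hcont.isOpen_inter_preimage hO hR
  have haO' : a ∈ O' := ⟨ha, f', hf'.fderiv.symm⟩
  refine ⟨e₀.restrOpen O' hO', ?_, ?_, fun x => rfl, ?_⟩
  · rw [OpenPartialHomeomorph.restrOpen_source]
    exact ⟨hfa.mem_toOpenPartialHomeomorph_source hf' _, haO'⟩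
  · rw [OpenPartialHomeomorph.restrOpen_source]
    exact fun x hx => hx.2.1
  · intro y hy
    have hx := (e₀.restrOpen O' hO').map_target hy
    rw [OpenPartialHomeomorph.restrOpen_source] at hx
    obtain ⟨g, hg⟩ := hx.2.2
    have hd := hf.contDiffAt (hO.mem_nhds hx.2.1)
    refine ((e₀.restrOpen O' hO').contDiffAt_symm (f₀' := g) hy ?_ hd).contDiffWithinAt
    rw [hg]
    exact (hd.differentiableAt (by simp)).hasFDerivAt

/-- A function that is smooth near a point agrees near it with a globally smooth one. -/
theorem exists_contDiff_eventuallyEq [FiniteDimensional ℝ E] {f : E → F} {O : Set E} {a : E}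
    (hO : IsOpen O) (ha : a ∈ O) (hf : ContDiffOn ℝ ∞ f O) :
    ∃ g : E → F, ContDiff ℝ ∞ g ∧ g =ᶠ[𝓝 a] f := by
  obtain ⟨ε, hε, hball⟩ := Metric.isOpen_iff.1 hO a ha
  let χ : ContDiffBump a := ⟨ε / 4, ε / 2, by positivity, by linarith⟩
  refine ⟨fun x => χ x • f x, ?_, ?_⟩
  · rw [contDiff_iff_contDiffAt]
    intro x
    by_cases hx : x ∈ O
    · exact χ.contDiffAt.smul (hf.contDiffAt (hO.mem_nhds hx))
    · have hx' : x ∉ tsupport χ := by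
        rw [χ.tsupport_eq]
        exact fun h => hx (hball (Metric.closedBall_subset_ball (by simp [χ]; linarith) h))
      have : (fun x => χ x • f x) =ᶠ[𝓝 x] fun _ => 0 := by
        filter_upwards [notMem_tsupport_iff_eventuallyEq.1 hx'] with y hy
        simp [hy]
      exact contDiffAt_const.congr_of_eventuallyEq this
  · filter_upwards [χ.eventuallyEq_one] with x hx
    simp [hx]

variable {K : Type} [TopologicalSpace K] [CompactSpace K]

/-- Pointwise application `C(K, E →L F) → C(K, E) →L C(K, F)` of a continuous family of operators. -/
def applyFamily : C(K, E →L[ℝ] F) →L[ℝ] C(K, E) →L[ℝ] C(K, F) :=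
  LinearMap.mkContinuous₂
    (LinearMap.mk₂ ℝ (fun (A : C(K, E →L[ℝ] F)) (γ : C(K, E)) =>
        (⟨fun k => A k (γ k), by fun_prop⟩ : C(K, F)))
      (fun _ _ _ => by ext; simp) (fun _ _ _ => by ext; simp)
      (fun _ _ _ => by ext; simp) (fun _ _ _ => by ext; simp)) 1 (by
    intro A γ
    rw [one_mul, ContinuousMap.norm_le _ (by positivity)]
    intro k
    exact (A k).le_of_opNorm_le_of_le (A.norm_coe_le_norm k) (γ.norm_coe_le_norm k))

@[simp] theorem applyFamily_apply (A : C(K, E →L[ℝ] F)) (γ : C(K, E)) (k : K) :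
    applyFamily A γ k = A k (γ k) := rfl

/-- The pointwise derivative serves as the derivative in the sup norm because the remainder is small
uniformly in k: by compactness of K, f' ∘ γ depends continuously on γ in the sup norm. -/
theorem hasFDerivAt_comp_continuousMap {f : E → F} {f' : E → E →L[ℝ] F} (hf : Continuous f)
    (hf' : Continuous f') (h : ∀ x, HasFDerivAt f (f' x) x) (γ : C(K, E)) :
    HasFDerivAt (fun γ : C(K, E) => (⟨f, hf⟩ : C(E, F)).comp γ)
      (applyFamily ((⟨f', hf'⟩ : C(E, E →L[ℝ] F)).comp γ)) γ := by
  rw [hasFDerivAt_iff_isLittleO_nhds_zero, Asymptotics.isLittleO_iff]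
  intro c hc
  have hcont : ContDiff ℝ 0 (fun γ : C(K, E) => (⟨f', hf'⟩ : C(E, E →L[ℝ] F)).comp γ) :=
    contDiff_zero.2 (ContinuousMap.continuous_postcomp _)
  obtain ⟨δ, hδ, hball⟩ := Metric.continuousAt_iff.1 (hcont.continuous.continuousAt (x := γ)) c hc
  filter_upwards [Metric.ball_mem_nhds (0 : C(K, E)) hδ] with η hη
  rw [ContinuousMap.norm_le _ (by positivity)]
  intro k
  -- Mean value inequality relative to the fixed operator f'(γ k). Each point of the segment is the
  -- value at k of a curve γ + θη within δ of γ, so f' is c-close to f'(γ k) there.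
  have key := (convex_segment (γ k) (γ k + η k)).norm_image_sub_le_of_norm_hasFDerivWithin_le'
    (f := f) (f' := f') (φ := f' (γ k)) (C := c) (fun x _ => (h x).hasFDerivWithinAt) (by
      intro x hx
      rw [segment_eq_image'] at hx
      obtain ⟨θ, hθ, rfl⟩ := hx
      have hd : dist (γ + θ • η) γ < δ := by
        rw [dist_eq_norm, add_sub_cancel_left, norm_smul, Real.norm_of_nonneg hθ.1]
        have : ‖η‖ < δ := by simpa using hη
        nlinarith [norm_nonneg η, hθ.2]
      have := (ContinuousMap.dist_le hc.le).1 (hball hd).le k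
      simpa [dist_eq_norm] using this)
    (left_mem_segment ℝ _ _) (right_mem_segment ℝ _ _)
  simp only [add_sub_cancel_left] at key
  calc _ ≤ c * ‖η k‖ := by simpa using key
    _ ≤ c * ‖η‖ := by gcongr; exact η.norm_coe_le_norm k

/-- The derivative of composition with f is `applyFamily` after composition with f', which has one
order of smoothness less. The target space is quantified inside the induction because f' takes
values in E →L F. -/
theorem contDiff_nat_comp_continuousMap (n : ℕ) :
    ∀ {F : Type} [NormedAddCommGroup F] [NormedSpace ℝ F] {f : E → F} (hf : Continuous f),
      ContDiff ℝ n f → ContDiff ℝ n (fun γ : C(K, E) => (⟨f, hf⟩ : C(E, F)).comp γ) := by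
  induction n with
  | zero =>
    intro F _ _ f hf _
    exact contDiff_zero.2 (ContinuousMap.continuous_postcomp _)
  | succ n ih =>
    intro F _ _ f hf h
    obtain ⟨f', hf', hd⟩ := contDiff_succ_iff_hasFDerivAt.1 h
    refine contDiff_succ_iff_hasFDerivAt.2 ⟨_, ?_,
      fun γ => hasFDerivAt_comp_continuousMap hf hf'.continuous hd γ⟩
    exact applyFamily.contDiff.comp (ih hf'.continuous hf')

/-- The composition operator `γ ↦ f ∘ γ` on `C(K, E)` is smooth for smooth `f`. -/
theorem contDiff_comp_continuousMap {f : E → F} (hf : ContDiff ℝ ∞ f) :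
    ContDiff ℝ ∞ (fun γ : C(K, E) => (⟨f, hf.continuous⟩ : C(E, F)).comp γ) :=
  contDiff_infty.2 fun n =>
    contDiff_nat_comp_continuousMap n hf.continuous (contDiff_infty.1 hf n)

end Analysis

end EvolCondSym

end

noncomputable section

namespace EvolCondSym

/-! ### Parametric ordinary differential equations and total differential equations -/

section ODE

variable {W F : Type} [NormedAddCommGroup W] [NormedSpace ℝ W]
  [NormedAddCommGroup F] [NormedSpace ℝ F]

/-- Constant curves, as a continuous linear map. -/
def constCurve : F →L[ℝ] C(unitInterval, F) :=
  LinearMap.mkContinuous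
    { toFun := fun y => ContinuousMap.const _ y
      map_add' := fun _ _ => rfl
      map_smul' := fun _ _ => rfl } 1 (by
    intro y
    rw [one_mul, ContinuousMap.norm_le _ (norm_nonneg _)]
    exact fun _ => le_rfl)

@[simp] theorem constCurve_apply (y : F) (s : unitInterval) : constCurve y s = y := rfl

/-- Integration of curves from `0`, as a continuous linear map. -/
def integralCurve : C(unitInterval, F) →L[ℝ] C(unitInterval, F) :=
  LinearMap.mkContinuous
    { toFun := fun g => ⟨fun s => ∫ σ in (0 : ℝ)..s, g (Set.projIcc 0 1 zero_le_one σ), by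
        have : Continuous fun s : ℝ => ∫ σ in (0 : ℝ)..s, g (Set.projIcc 0 1 zero_le_one σ) :=
          intervalIntegral.continuous_primitive
            (fun a b => (g.continuous.comp continuous_projIcc).intervalIntegrable a b) 0
        exact this.comp continuous_subtype_val⟩
      map_add' := fun g h => by
        ext s
        exact intervalIntegral.integral_add
          ((g.continuous.comp continuous_projIcc).intervalIntegrable _ _)
          ((h.continuous.comp continuous_projIcc).intervalIntegrable _ _)
      map_smul' := fun c g => by
        ext s
        exact intervalIntegral.integral_smul c _ } 1 (by
    intro g
    rw [one_mul, ContinuousMap.norm_le _ (norm_nonneg _)]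
    intro s
    have := intervalIntegral.norm_integral_le_of_norm_le_const (a := 0) (b := (s : ℝ))
      (f := fun σ => g (Set.projIcc 0 1 zero_le_one σ)) (C := ‖g‖)
      (fun x _ => g.norm_coe_le_norm _)
    refine this.trans ?_
    rw [sub_zero, abs_of_nonneg s.2.1]
    exact mul_le_of_le_one_right (norm_nonneg _) s.2.2)

/-- An indefinite integral on the unit interval extends to a curve differentiable at all points
of the unit interval. -/
theorem exists_hasDerivAt_integralCurve [CompleteSpace F] (g : C(unitInterval, F)) (y : F) :
    ∃ c : ℝ → F, c 0 = y ∧ ∀ s (hs : s ∈ unitInterval),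
      c s = (constCurve y + integralCurve g) ⟨s, hs⟩ ∧ HasDerivAt c (g ⟨s, hs⟩) s := by
  have hc : Continuous fun σ : ℝ => g (Set.projIcc 0 1 zero_le_one σ) :=
    g.continuous.comp continuous_projIcc
  -- The integrand is continued by constants beyond the unit interval, so the derivative is
  -- two-sided at the endpoints too.
  refine ⟨fun s => y + ∫ σ in (0 : ℝ)..s, g (Set.projIcc 0 1 zero_le_one σ), by simp,
    fun s hs => ⟨rfl, ?_⟩⟩
  have := (hc.integral_hasStrictDerivAt 0 s).hasDerivAt.const_add y
  rwa [Set.projIcc_of_mem zero_le_one hs] at this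

/-- The linear map `γ ↦ (s ↦ (0, 0, γ s))`. -/
def liftCurve : C(unitInterval, F) →L[ℝ] C(unitInterval, W × ℝ × F) :=
  LinearMap.mkContinuous
    { toFun := fun γ => ⟨fun s => (0, 0, γ s), by fun_prop⟩
      map_add' := fun _ _ => by ext <;> simp
      map_smul' := fun _ _ => by ext <;> simp } 1 (by
    intro γ
    rw [one_mul, ContinuousMap.norm_le _ (norm_nonneg _)]
    intro s
    simpa [Prod.norm_def] using γ.norm_coe_le_norm s)

/-- The curve `s ↦ (w, s, γ s)`. -/
def graphCurve (a : W × C(unitInterval, F)) : C(unitInterval, W × ℝ × F) :=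
  constCurve (a.1, 0, 0) + liftCurve a.2 + ⟨fun s => (0, (s : ℝ), 0), by fun_prop⟩

@[simp] theorem liftCurve_apply (γ : C(unitInterval, F)) (s : unitInterval) :
    liftCurve (W := W) γ s = (0, 0, γ s) := rfl

@[simp] theorem graphCurve_apply (a : W × C(unitInterval, F)) (s : unitInterval) :
    graphCurve a s = (a.1, (s : ℝ), a.2 s) := by
  simp [graphCurve]

theorem contDiff_graphCurve : ContDiff ℝ ∞ (graphCurve (W := W) (F := F)) := by
  refine ContDiff.add (ContDiff.add ?_ ?_) contDiff_const
  · have h : ContDiff ℝ ∞ (fun a : W × C(unitInterval, F) => (a.1, ((0 : ℝ), (0 : F)))) := by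
      fun_prop
    exact (constCurve (F := W × ℝ × F)).contDiff.comp h
  · exact (liftCurve (W := W) (F := F)).contDiff.comp contDiff_snd

theorem hasFDerivAt_graphCurve_comp {E : Type} [NormedAddCommGroup E] [NormedSpace ℝ E]
    {w : E → W} {γ : E → C(unitInterval, F)} {w' : E →L[ℝ] W} {γ' : E →L[ℝ] C(unitInterval, F)}
    {x : E} (hw : HasFDerivAt w w' x) (hγ : HasFDerivAt γ γ' x) :
    HasFDerivAt (fun x => graphCurve (w x, γ x))
      ((constCurve (F := W × ℝ × F)) ∘L ContinuousLinearMap.inl ℝ W (ℝ × F) ∘L w' +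
        (liftCurve (W := W) (F := F)) ∘L γ') x := by
  refine HasFDerivAt.add_const _ (HasFDerivAt.add ?_ ?_)
  · exact ((constCurve (F := W × ℝ × F)) ∘L ContinuousLinearMap.inl ℝ W (ℝ × F)).hasFDerivAt.comp x hw
  · exact (liftCurve (W := W) (F := F)).hasFDerivAt.comp x hγ

/-- Smooth solutions of the fixed point equation `x = c y + Ψ (w, x)`, where `Ψ` is smooth and
vanishes for `w = 0`. -/
theorem exists_smooth_fixedPoint {X : Type} [NormedAddCommGroup X] [NormedSpace ℝ X]
    [CompleteSpace X] [CompleteSpace W] [CompleteSpace F] (c : F →L[ℝ] X) {Ψ : W × X → X}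
    (hΨ : ContDiff ℝ ∞ Ψ) (hΨ0 : ∀ x, Ψ (0, x) = 0) (y₀ : F) :
    ∃ (N : Set (W × F)) (Γ : W × F → X), IsOpen N ∧ (0, y₀) ∈ N ∧
      ContDiffOn ℝ ∞ Γ N ∧ Γ (0, y₀) = c y₀ ∧ ∀ a ∈ N, Γ a = c a.2 + Ψ (a.1, Γ a) := by
  let q₀ : (W × F) × X := ((0, y₀), c y₀)
  let L := fderiv ℝ Ψ (0, c y₀)
  have hL : HasFDerivAt Ψ L (0, c y₀) := (hΨ.differentiable (by simp) _).hasFDerivAt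
  -- Since Ψ(0, ·) vanishes, its linearization at w = 0 ignores x. The linearization of (w, y, x) ↦
  -- (w, y, x − c y − Ψ(w, x)) is therefore triangular, with the explicit inverse T'.
  have hL0 : ∀ x, L (0, x) = 0 := by
    intro x
    have h1 : HasFDerivAt (fun x : X => Ψ ((0 : W), x)) (L ∘L ContinuousLinearMap.inr ℝ W X)
        (c y₀) := hL.comp (c y₀) (hasFDerivAt_prodMk_right (0 : W) (c y₀))
    simp only [hΨ0] at h1
    exact DFunLike.congr_fun (h1.unique (hasFDerivAt_const (0 : X) (c y₀))) x
  have hLadd : ∀ w x, L (w, x) = L (w, 0) := by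
    intro w x
    have : ((w, x) : W × X) = (w, 0) + (0, x) := by simp
    rw [this, map_add, hL0, add_zero]
  let π : (W × F) × X →L[ℝ] W × X := ContinuousLinearMap.prodMap (.fst ℝ W F) (.id ℝ X)
  let T : (W × F) × X →L[ℝ] (W × F) × X :=
    (ContinuousLinearMap.fst ℝ _ _).prod (ContinuousLinearMap.snd ℝ _ _ -
      c ∘L ContinuousLinearMap.snd ℝ W F ∘L ContinuousLinearMap.fst ℝ _ _ - L ∘L π)
  let T' : (W × F) × X →L[ℝ] (W × F) × X :=
    (ContinuousLinearMap.fst ℝ _ _).prod (ContinuousLinearMap.snd ℝ _ _ +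
      c ∘L ContinuousLinearMap.snd ℝ W F ∘L ContinuousLinearMap.fst ℝ _ _ + L ∘L π)
  have hT : ∀ a x, T (a, x) = (a, x - c a.2 - L (a.1, 0)) := by
    intro a x
    rw [← hLadd a.1 x]
    rfl
  have hT' : ∀ a x, T' (a, x) = (a, x + c a.2 + L (a.1, 0)) := by
    intro a x
    rw [← hLadd a.1 x]
    rfl
  let e' : ((W × F) × X) ≃L[ℝ] ((W × F) × X) :=
    ContinuousLinearEquiv.equivOfInverse T T'
      (by rintro ⟨a, x⟩; rw [hT, hT']; simp only [Prod.mk.injEq, true_and]; abel)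
      (by rintro ⟨a, x⟩; rw [hT', hT]; simp only [Prod.mk.injEq, true_and]; abel)
  let Φ : (W × F) × X → (W × F) × X := fun q => (q.1, q.2 - c q.1.2 - Ψ (π q))
  have hΦ : ContDiff ℝ ∞ Φ := by
    refine contDiff_fst.prodMk (ContDiff.sub (ContDiff.sub contDiff_snd ?_) (hΨ.comp π.contDiff))
    exact c.contDiff.comp (contDiff_snd.comp contDiff_fst)
  have hΦ' : HasFDerivAt Φ (e' : _ →L[ℝ] _) q₀ :=
    hasFDerivAt_fst.prodMk ((hasFDerivAt_snd.sub
      (c.hasFDerivAt.comp q₀ (hasFDerivAt_snd.comp q₀ hasFDerivAt_fst))).sub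
      (HasFDerivAt.comp q₀ hL π.hasFDerivAt))
  obtain ⟨e, hq₀, -, he, hsymm⟩ :=
    exists_smooth_openPartialHomeomorph isOpen_univ (Set.mem_univ q₀) hΦ.contDiffOn e' hΦ'
  have hι : ContDiff ℝ ∞ (fun a : W × F => (a, (0 : X))) := by fun_prop
  have hΦq₀ : Φ q₀ = ((0, y₀), 0) := by
    simp only [Φ, q₀, sub_self, zero_sub, Prod.mk.injEq, true_and, neg_eq_zero]
    exact hΨ0 _
  -- The fixed point equation is Φ(a, x) = (a, 0), so Γ is the x-component of the local inverse of Φ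
  -- on the slice (a, 0).
  refine ⟨(fun a : W × F => (a, (0 : X))) ⁻¹' e.target,
    fun a => (e.symm (a, 0)).2, e.open_target.preimage hι.continuous, ?_, ?_, ?_, ?_⟩
  · have := e.map_source hq₀
    rwa [he, hΦq₀] at this
  · exact contDiff_snd.comp_contDiffOn (hsymm.comp hι.contDiffOn (fun a ha => ha))
  · have : e.symm ((0, y₀), 0) = q₀ := by
      rw [← hΦq₀, ← he, e.left_inv hq₀]
    simp only [this, q₀]
  · intro a ha
    have h := e.right_inv ha
    rw [he] at h
    have h1 : (e.symm (a, 0)).1 = a := congrArg Prod.fst h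
    have h2 : (e.symm (a, 0)).2 - c (e.symm (a, 0)).1.2 -
      Ψ ((e.symm (a, 0)).1.1, (e.symm (a, 0)).2) = 0 := congrArg Prod.snd h
    rw [h1, sub_eq_zero, sub_eq_iff_eq_add] at h2
    rwa [add_comm]

/-- Smooth dependence on parameters and initial values for an ordinary differential equation
`y' = g(w, s, y)` whose right-hand side vanishes for `w = 0`, in integral form. -/
theorem exists_smooth_parametric_solution [CompleteSpace W] [CompleteSpace F] {g : W × ℝ × F → F}
    (hg : ContDiff ℝ ∞ g) (hg0 : ∀ s y, g (0, s, y) = 0) (y₀ : F) :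
    ∃ (N : Set (W × F)) (Γ : W × F → C(unitInterval, F)), IsOpen N ∧ (0, y₀) ∈ N ∧
      ContDiffOn ℝ ∞ Γ N ∧ Γ (0, y₀) = constCurve y₀ ∧
      ∀ a ∈ N, Γ a = constCurve a.2 +
        integralCurve ((⟨g, hg.continuous⟩ : C(W × ℝ × F, F)).comp (graphCurve (a.1, Γ a))) := by
  -- The whole curve is the unknown. Smallness of w replaces shortness of the time interval, so
  -- solutions live on all of [0, 1].
  refine exists_smooth_fixedPoint constCurve (Ψ := fun q =>
    integralCurve ((⟨g, hg.continuous⟩ : C(W × ℝ × F, F)).comp (graphCurve q))) ?_ ?_ y₀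
  · exact (ContinuousLinearMap.contDiff integralCurve).comp
      ((contDiff_comp_continuousMap hg).comp contDiff_graphCurve)
  · intro γ
    have : (⟨g, hg.continuous⟩ : C(W × ℝ × F, F)).comp (graphCurve ((0 : W), γ)) = 0 := by
      ext s
      simp [hg0]
    rw [this, map_zero]

end ODE

end EvolCondSym

end

noncomputable section

namespace EvolCondSym

/-! ### Total differential equations: existence by integration along rays, and uniqueness. -/

section Frobenius

variable {P F : Type} [NormedAddCommGroup P] [NormedSpace ℝ P]
  [NormedAddCommGroup F] [NormedSpace ℝ F]

/-- The right-hand side of the equation for a solution of `Dv = C(p, v)` along rays from `0`. -/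
def rayField (C : P × F → P →L[ℝ] F) (a : P × ℝ × F) : F := C (a.2.1 • a.1, a.2.2) a.1

theorem contDiff_rayField {C : P × F → P →L[ℝ] F} (hC : ContDiff ℝ ∞ C) :
    ContDiff ℝ ∞ (rayField C) := by
  refine ContDiff.clm_apply (hC.comp ?_) contDiff_fst
  fun_prop

/-- Right-hand side of the variational equation along a ray: the direction w varies by w₁ and the
solution value by η at fixed time s. The first term comes from the argument of C, the second from
the vector to which C is applied. -/
theorem fderiv_rayField {C : P × F → P →L[ℝ] F} (hC : ContDiff ℝ ∞ C) (w w₁ : P) (s : ℝ) (y η : F) :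
    fderiv ℝ (rayField C) (w, s, y) (w₁, 0, η) =
      fderiv ℝ C (s • w, y) (s • w₁, η) w + C (s • w, y) w₁ := by
  have hin : HasFDerivAt (fun a : P × ℝ × F => (a.2.1 • a.1, a.2.2))
      (((s • ContinuousLinearMap.fst ℝ P (ℝ × F) +
        ((ContinuousLinearMap.fst ℝ ℝ F) ∘L (ContinuousLinearMap.snd ℝ P (ℝ × F))).smulRight w).prod
        ((ContinuousLinearMap.snd ℝ ℝ F) ∘L (ContinuousLinearMap.snd ℝ P (ℝ × F))))) (w, s, y) := by
    refine HasFDerivAt.prodMk ?_ ?_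
    · have h := HasFDerivAt.smul (x := (w, s, y)) ((ContinuousLinearMap.fst ℝ ℝ F) ∘L
        (ContinuousLinearMap.snd ℝ P (ℝ × F))).hasFDerivAt (hasFDerivAt_fst (𝕜 := ℝ))
      exact h
    · exact ((ContinuousLinearMap.snd ℝ ℝ F) ∘L
        (ContinuousLinearMap.snd ℝ P (ℝ × F))).hasFDerivAt
  have hCd : HasFDerivAt C (fderiv ℝ C (s • w, y)) (s • w, y) :=
    (hC.differentiable (by simp) _).hasFDerivAt
  have h := (HasFDerivAt.comp (w, s, y) hCd hin).clm_apply
    (hasFDerivAt_fst (𝕜 := ℝ) (p := (w, s, y)))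
  have h' : HasFDerivAt (rayField C) _ (w, s, y) := h
  rw [h'.fderiv]
  simp [add_comm]

/-- **Frobenius theorem** for a total differential equation `Dv = C(p, v)` with smooth right-hand
side: if the compatibility condition holds near `(0, y₀)`, there is a solution depending smoothly
on its value at `p = 0`. -/
theorem exists_solution_of_compatible [CompleteSpace P] [CompleteSpace F] {C : P × F → P →L[ℝ] F}
    (hC : ContDiff ℝ ∞ C) {O : Set (P × F)} (hO : IsOpen O) {y₀ : F} (hy₀ : (0, y₀) ∈ O)
    (hcomp : ∀ z ∈ O, ∀ w₁ w₂, fderiv ℝ C z (w₁, C z w₁) w₂ = fderiv ℝ C z (w₂, C z w₂) w₁) :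
    ∃ (N : Set (P × F)) (v : P × F → F), IsOpen N ∧ (0, y₀) ∈ N ∧ ContDiffOn ℝ ∞ v N ∧
      (∀ y, (0, y) ∈ N → v (0, y) = y) ∧
      ∀ a ∈ N, (a.1, v a) ∈ O ∧ HasFDerivAt (fun p => v (p, a.2)) (C (a.1, v a)) a.1 := by
  have hg := contDiff_rayField hC
  have hg0 : ∀ s y, rayField C (0, s, y) = 0 := fun s y => by simp [rayField]
  obtain ⟨N, Γ, hN, hN0, hΓ, hΓ0, hΓeq⟩ := exists_smooth_parametric_solution hg hg0 y₀
  set gc : C(P × ℝ × F, F) := ⟨rayField C, hg.continuous⟩ with hgc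
  -- restrict to parameters for which the whole curve stays in `O`
  have hev : ∀ᶠ a in 𝓝 ((0 : P), y₀), ∀ s ∈ (Set.univ : Set unitInterval),
      ((s : ℝ) • a.1, Γ a s) ∈ O := by
    refine isCompact_univ.eventually_forall_of_forall_eventually (x₀ := ((0 : P), y₀))
      (P := fun a (s : unitInterval) => ((s : ℝ) • a.1, Γ a s) ∈ O) ?_
    intro s _
    have hΓc : ContinuousAt Γ (0, y₀) := hΓ.continuousOn.continuousAt (hN.mem_nhds hN0)
    have hc1 : ContinuousAt (fun q : (P × F) × unitInterval => Γ q.1) ((0, y₀), s) :=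
      ContinuousAt.comp (f := Prod.fst) hΓc continuousAt_fst
    have hc2 : ContinuousAt (fun q : (P × F) × unitInterval => Γ q.1 q.2) ((0, y₀), s) :=
      Filter.Tendsto.eval hc1 continuousAt_snd
    have hc3 : ContinuousAt (fun q : (P × F) × unitInterval => ((q.2 : ℝ) • q.1.1, Γ q.1 q.2))
        ((0, y₀), s) := by
      refine ContinuousAt.prodMk ?_ hc2
      fun_prop
    refine hc3.eventually (hO.mem_nhds ?_)
    simpa [hΓ0] using hy₀
  obtain ⟨N', hN'sub, hN', hN'0⟩ := eventually_nhds_iff.1 hev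
  -- The solution at w with value y at 0 is the time-one value of the curve solving the equation
  -- along the ray s ↦ s w.
  let one : unitInterval := ⟨1, by simp⟩
  refine ⟨N ∩ N', fun a => Γ a one, hN.inter hN', ⟨hN0, hN'0⟩, ?_, ?_, ?_⟩
  · exact ((ContinuousMap.evalCLM ℝ one : C(unitInterval, F) →L[ℝ] F).contDiff.comp_contDiffOn hΓ).mono
      Set.inter_subset_left
  · intro y hy
    have h := congrArg (fun γ => γ one) (hΓeq _ hy.1)
    have h0 : gc.comp (graphCurve ((0 : P), Γ (0, y))) = 0 := by
      ext s
      simp [hgc, hg0]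
    simpa [h0] using h
  · rintro ⟨w, y⟩ ⟨ha, ha'⟩
    have hmem : ∀ s (hs : s ∈ unitInterval), (s • w, Γ (w, y) ⟨s, hs⟩) ∈ O :=
      fun s hs => hN'sub _ ha' ⟨s, hs⟩ (Set.mem_univ _)
    refine ⟨by simpa [one] using hmem 1 (by simp), ?_⟩
    have hΓd : HasFDerivAt Γ (fderiv ℝ Γ (w, y)) (w, y) :=
      ((hΓ.contDiffAt (hN.mem_nhds ha)).differentiableAt (by simp)).hasFDerivAt
    -- differentiate the integral equation
    have hrhs : HasFDerivAt (fun a : P × F => constCurve a.2 +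
        integralCurve (gc.comp (graphCurve (a.1, Γ a))))
        (constCurve ∘L ContinuousLinearMap.snd ℝ P F + integralCurve ∘L
          (applyFamily ((⟨fderiv ℝ (rayField C), hg.continuous_fderiv (by simp)⟩ :
            C(P × ℝ × F, P × ℝ × F →L[ℝ] F)).comp (graphCurve (w, Γ (w, y)))) ∘L
          ((constCurve (F := P × ℝ × F)) ∘L ContinuousLinearMap.inl ℝ P (ℝ × F) ∘L
            (ContinuousLinearMap.fst ℝ P F) + (liftCurve (W := P) (F := F)) ∘L fderiv ℝ Γ (w, y))))
        (w, y) := by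
      refine HasFDerivAt.add ?_ ?_
      · exact ((constCurve (F := F)) ∘L ContinuousLinearMap.snd ℝ P F).hasFDerivAt
      · refine (integralCurve (F := F)).hasFDerivAt.comp (w, y) ?_
        exact (hasFDerivAt_comp_continuousMap hg.continuous (hg.continuous_fderiv (by simp))
          (fun x => (hg.differentiable (by simp) x).hasFDerivAt) (graphCurve (w, Γ (w, y)))).comp (w, y)
          (hasFDerivAt_graphCurve_comp hasFDerivAt_fst hΓd)
    have hfd := hΓd.unique (hrhs.congr_of_eventuallyEq
      (by filter_upwards [hN.mem_nhds ha] with a ha using hΓeq a ha))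
    obtain ⟨γ, -, hγ⟩ := exists_hasDerivAt_integralCurve (gc.comp (graphCurve (w, Γ (w, y)))) y
    have hγΓ : ∀ s (hs : s ∈ unitInterval), γ s = Γ (w, y) ⟨s, hs⟩ := fun s hs => by
      rw [(hγ s hs).1]
      exact (congrArg (fun γ => γ ⟨s, hs⟩) (hΓeq _ ha)).symm
    have hγd : ∀ s ∈ unitInterval, HasDerivAt γ (C (s • w, γ s) w) s := fun s hs => by
      rw [hγΓ s hs]
      have h := (hγ s hs).2
      rw [ContinuousMap.comp_apply, graphCurve_apply] at h
      exact h
    have hγO : ∀ s ∈ unitInterval, (s • w, γ s) ∈ O := fun s hs => by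
      rw [hγΓ s hs]
      exact hmem s hs
    -- By construction the equation holds only along the ray; the claim is that the derivative of
    -- the time-one value in an arbitrary direction w₁ is also C w₁.
    have key : ∀ w₁ : P, fderiv ℝ Γ (w, y) (w₁, 0) one = C (w, Γ (w, y) one) w₁ := by
      intro w₁
      have hη := DFunLike.congr_fun hfd (w₁, 0)
      set η := fderiv ℝ Γ (w, y) (w₁, 0) with hηdef
      set g₁ : C(unitInterval, F) :=
        applyFamily ((⟨fderiv ℝ (rayField C), hg.continuous_fderiv (by simp)⟩ :
            C(P × ℝ × F, P × ℝ × F →L[ℝ] F)).comp (graphCurve (w, Γ (w, y))))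
          ((constCurve (F := P × ℝ × F)) (w₁, 0) + liftCurve (W := P) η) with hg₁
      have hη' : η = constCurve 0 + integralCurve g₁ := hη
      obtain ⟨c, hc0, hc⟩ := exists_hasDerivAt_integralCurve g₁ 0
      have hcη : ∀ s (hs : s ∈ unitInterval), c s = η ⟨s, hs⟩ := fun s hs => by
        rw [(hc s hs).1, ← hη']
      have hcd : ∀ s ∈ unitInterval, HasDerivAt c
          (fderiv ℝ C (s • w, γ s) (s • w₁, c s) w + C (s • w, γ s) w₁) s := fun s hs => by
        rw [← fderiv_rayField hC, hcη s hs, hγΓ s hs]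
        convert (hc s hs).2 using 1
        rw [hg₁, applyFamily_apply]
        simp only [ContinuousMap.comp_apply, graphCurve_apply, ContinuousMap.add_apply,
          constCurve_apply, liftCurve_apply]
        simp only [Prod.mk_add_mk, add_zero, zero_add]
        rfl
      have hCd : ∀ s ∈ unitInterval, HasDerivAt (fun s => C (s • w, γ s))
          (fderiv ℝ C (s • w, γ s) (w, C (s • w, γ s) w)) s := fun s hs => by
        have h1 : HasDerivAt (fun s : ℝ => (s • w, γ s)) (w, C (s • w, γ s) w) s := by
          simpa using ((hasDerivAt_id s).smul_const w).prodMk (hγd s hs)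
        exact HasFDerivAt.comp_hasDerivAt (f := fun s : ℝ => (s • w, γ s)) s
          (hC.differentiable (by simp) _).hasFDerivAt h1
      -- Here c(s) is the variation of the ray solution in the direction w₁; a true solution would
      -- give s C(s w, γ s) w₁. By compatibility the defect δ satisfies the homogeneous linear
      -- equation δ' = DC(0, δ) w, and δ(0) = 0, so a Grönwall estimate kills it.
      let δ : ℝ → F := fun s => c s - s • C (s • w, γ s) w₁
      have hδ : ∀ s ∈ unitInterval, HasDerivAt δ (fderiv ℝ C (s • w, γ s) (0, δ s) w) s := by
        intro s hs
        have h1 : HasDerivAt (fun s => C (s • w, γ s) w₁)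
            (fderiv ℝ C (s • w, γ s) (w, C (s • w, γ s) w) w₁) s := by
          simpa using (hCd s hs).clm_apply (hasDerivAt_const s w₁)
        have h2 : HasDerivAt δ _ s := (hcd s hs).sub ((hasDerivAt_id s).smul h1)
        refine h2.congr_deriv (Eq.symm ?_)
        rw [hcomp _ (hγO s hs) w w₁]
        have h3 : ((0 : P), δ s) = (s • w₁, c s) - s • (w₁, C (s • w, γ s) w₁) := by
          simp [δ]
        rw [h3, map_sub, map_smul]
        simp
      have hγcont : ContinuousOn γ (Set.Icc 0 1) := fun s hs =>
        (hγd s hs).continuousAt.continuousWithinAt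
      have hKc : ContinuousOn (fun s : ℝ => fderiv ℝ C (s • w, γ s)) (Set.Icc 0 1) := by
        refine (hC.continuous_fderiv (by simp)).comp_continuousOn ?_
        exact ContinuousOn.prodMk (by fun_prop) hγcont
      obtain ⟨K, hK⟩ := isCompact_Icc.exists_bound_of_continuousOn
        (f := fun s : ℝ => fderiv ℝ C (s • w, γ s)) hKc
      have hzero := eq_zero_of_abs_deriv_le_mul_abs_self_of_eq_zero_right (f := δ) (K := K * ‖w‖)
        (a := 0) (b := 1) (fun s hs => (hδ s hs).continuousAt.continuousWithinAt)
        (fun s hs => (hδ s (Set.Ico_subset_Icc_self hs)).hasDerivWithinAt)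
        (by simp [δ, hc0]) (by
          intro s hs
          have hs' := Set.Ico_subset_Icc_self hs
          calc _ ≤ ‖fderiv ℝ C (s • w, γ s)‖ * ‖((0 : P), δ s)‖ * ‖w‖ :=
                ContinuousLinearMap.le_of_opNorm_le _ (ContinuousLinearMap.le_opNorm _ _) _
            _ ≤ K * ‖δ s‖ * ‖w‖ := by
                have : ‖((0 : P), δ s)‖ = ‖δ s‖ := by simp [Prod.norm_def]
                rw [this]
                gcongr
                exact hK s hs'
            _ = K * ‖w‖ * ‖δ s‖ := by ring) 1 (by simp)
      have h1 := sub_eq_zero.1 hzero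
      rw [one_smul, one_smul, hcη 1 (by simp), hγΓ 1 (by simp)] at h1
      exact h1
    have h1 : HasFDerivAt (fun p => Γ (p, y)) (fderiv ℝ Γ (w, y) ∘L ContinuousLinearMap.inl ℝ P F) w :=
      HasFDerivAt.comp w hΓd (hasFDerivAt_prodMk_left w y)
    have h2 := (ContinuousMap.evalCLM ℝ one : C(unitInterval, F) →L[ℝ] F).hasFDerivAt.comp w h1
    refine HasFDerivAt.congr_fderiv h2 ?_
    ext w₁
    exact key w₁

/-- Two solutions of a total differential equation with Lipschitz right-hand side on a set that is
star-shaped about `p₀` agree if they agree at `p₀`. -/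
theorem eqOn_of_hasFDerivAt_of_lipschitzOnWith {C : P × F → P →L[ℝ] F} {K : NNReal}
    {S : Set (P × F)} (hC : LipschitzOnWith K C S) {D : Set P} {p₀ : P} (hD : StarConvex ℝ p₀ D)
    {v v' : P → F} (hv : ∀ p ∈ D, (p, v p) ∈ S ∧ HasFDerivAt v (C (p, v p)) p)
    (hv' : ∀ p ∈ D, (p, v' p) ∈ S ∧ HasFDerivAt v' (C (p, v' p)) p) (h₀ : v p₀ = v' p₀) :
    Set.EqOn v v' D := by
  intro p hp
  have hseg : ∀ s ∈ Set.Icc (0 : ℝ) 1, p₀ + s • (p - p₀) ∈ D := fun s hs => by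
    have := hD hp (a := 1 - s) (b := s) (by linarith [hs.2]) hs.1 (by ring)
    convert this using 1
    module
  have hline : ∀ s : ℝ, HasDerivAt (fun s : ℝ => p₀ + s • (p - p₀)) (p - p₀) s := fun s => by
    simpa using ((hasDerivAt_id s).smul_const (p - p₀)).const_add p₀
  have hd : ∀ u : P → F, (∀ p ∈ D, (p, u p) ∈ S ∧ HasFDerivAt u (C (p, u p)) p) →
      ∀ s ∈ Set.Icc (0 : ℝ) 1, HasDerivAt (fun s : ℝ => u (p₀ + s • (p - p₀)))
        (C (p₀ + s • (p - p₀), u (p₀ + s • (p - p₀))) (p - p₀)) s := fun u hu s hs =>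
    HasFDerivAt.comp_hasDerivAt (f := fun s : ℝ => p₀ + s • (p - p₀)) s (hu _ (hseg s hs)).2 (hline s)
  -- On the segment from p₀ to p both functions solve the same ordinary differential equation, whose
  -- Lipschitz constant picks up the factor ‖p − p₀‖ from the speed of the segment.
  have h := ODE_solution_unique_of_mem_Icc_right
    (v := fun s y => C (p₀ + s • (p - p₀), y) (p - p₀)) (K := K * ‖p - p₀‖₊)
    (s := fun s => {y | (p₀ + s • (p - p₀), y) ∈ S}) (a := 0) (b := 1)
    (f := fun s => v (p₀ + s • (p - p₀))) (g := fun s => v' (p₀ + s • (p - p₀)))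
    (by
      intro s _
      refine LipschitzOnWith.of_dist_le_mul fun y hy y' hy' => ?_
      rw [dist_eq_norm, ← sub_apply]
      refine (ContinuousLinearMap.le_opNorm _ _).trans ?_
      have := hC.dist_le_mul _ hy _ hy'
      rw [dist_eq_norm, Prod.dist_eq, dist_self, max_eq_right dist_nonneg] at this
      calc _ ≤ (K * dist y y') * ‖p - p₀‖ := by gcongr
        _ = _ := by push_cast; ring)
    (fun s hs => (hd v hv s hs).continuousAt.continuousWithinAt)
    (fun s hs => (hd v hv s (Set.Ico_subset_Icc_self hs)).hasDerivWithinAt)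
    (fun s hs => (hv _ (hseg s (Set.Ico_subset_Icc_self hs))).1)
    (fun s hs => (hd v' hv' s hs).continuousAt.continuousWithinAt)
    (fun s hs => (hd v' hv' s (Set.Ico_subset_Icc_self hs)).hasDerivWithinAt)
    (fun s hs => (hv' _ (hseg s (Set.Ico_subset_Icc_self hs))).1)
    (by simpa using h₀)
  simpa using h (Set.right_mem_Icc.2 zero_le_one)

end Frobenius

end EvolCondSym

end

noncomputable section

namespace EvolCondSym

/-! ### Maps of everywhere degenerate derivative -/

section ConstantRank

variable {F : Type} [NormedAddCommGroup F] [NormedSpace ℝ F] [FiniteDimensional ℝ F]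

/-- Surjectivity of π ∘ A together with the rank bound makes π an isomorphism from the range of A
onto G. -/
theorem apply_eq_zero_of_finrank_range_le {G : Type} [AddCommGroup G] [Module ℝ G]
    [FiniteDimensional ℝ G] (A : F →ₗ[ℝ] F) (π : F →ₗ[ℝ] G)
    (hsurj : Function.Surjective (π ∘ₗ A))
    (hrank : Module.finrank ℝ A.range ≤ Module.finrank ℝ G) {x : F}
    (hx : π (A x) = 0) : A x = 0 := by
  let π' : A.range →ₗ[ℝ] G := π.domRestrict A.range
  have hs : Function.Surjective π' := fun g => by
    obtain ⟨y, hy⟩ := hsurj g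
    exact ⟨⟨A y, y, rfl⟩, hy⟩
  have hge : Module.finrank ℝ G ≤ Module.finrank ℝ A.range :=
    LinearMap.finrank_le_finrank_of_surjective hs
  have hinj : Function.Injective π' :=
    (LinearMap.injective_iff_surjective_of_finrank_eq_finrank (le_antisymm hrank hge)).2 hs
  have : (⟨A x, x, rfl⟩ : A.range) = 0 := hinj (by simpa [π'] using hx)
  simpa using congrArg Subtype.val this

/-- A smooth map between spaces of the same dimension whose derivative is nowhere injective
factors, on some open set, through a space of smaller dimension, as the composition of itself with
a smooth map `s ∘ ζ`. -/
theorem exists_factorization_of_not_injective {w : F → F} {O : Set F} (hO : IsOpen O)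
    (hne : O.Nonempty) (hw : ContDiffOn ℝ ∞ w O)
    (hsing : ∀ y ∈ O, ¬ Function.Injective (fderiv ℝ w y)) :
    ∃ σ < Module.finrank ℝ F, ∃ (ζ : F → Fin σ → ℝ) (s : (Fin σ → ℝ) → F) (O' : Set F)
      (T : Set (Fin σ → ℝ)), IsOpen O' ∧ O'.Nonempty ∧ O' ⊆ O ∧ IsOpen T ∧
      ContDiffOn ℝ ∞ ζ O' ∧ ContDiffOn ℝ ∞ s T ∧ Set.MapsTo ζ O' T ∧ Set.MapsTo s T O ∧
      ∀ y ∈ O', w (s (ζ y)) = w y := by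
  let rk : F → ℕ := fun y => Module.finrank ℝ (fderiv ℝ w y : F →ₗ[ℝ] F).range
  have hrk : ∀ y ∈ O, rk y < Module.finrank ℝ F := fun y hy => by
    refine lt_of_le_of_ne (Submodule.finrank_le _) fun h => hsing y hy ?_
    exact LinearMap.injective_iff_surjective.2
      (LinearMap.range_eq_top.1 (Submodule.eq_top_of_finrank_eq h))
  -- At a point of maximal rank the rank cannot increase nearby, and by semicontinuity it cannot
  -- drop: this supplies the hypothesis of a constant rank argument.
  obtain ⟨y₁, hy₁, hmax⟩ : ∃ y₁ ∈ O, ∀ y ∈ O, rk y ≤ rk y₁ := by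
    have hbdd : BddAbove (rk '' O) := ⟨Module.finrank ℝ F, by
      rintro _ ⟨y, hy, rfl⟩
      exact (hrk y hy).le⟩
    obtain ⟨y₁, hy₁, h⟩ := Nat.sSup_mem (hne.image rk) hbdd
    exact ⟨y₁, hy₁, fun y hy => h ▸ le_csSup hbdd ⟨y, hy, rfl⟩⟩
  have hdiff : ∀ y ∈ O, HasFDerivAt w (fderiv ℝ w y) y := fun y hy =>
    ((hw.contDiffAt (hO.mem_nhds hy)).differentiableAt (by simp)).hasFDerivAt
  set A : F →L[ℝ] F := fderiv ℝ w y₁ with hA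
  let R := (A : F →ₗ[ℝ] F).range
  obtain ⟨p, hp⟩ := LinearMap.exists_leftInverse_of_injective R.subtype (Submodule.ker_subtype R)
  let eR : R ≃ₗ[ℝ] (Fin (rk y₁) → ℝ) := LinearEquiv.ofFinrankEq _ _ (Module.finrank_fin_fun ℝ).symm
  let π : F →L[ℝ] (Fin (rk y₁) → ℝ) := LinearMap.toContinuousLinearMap (eR.toLinearMap ∘ₗ p)
  have hpR : ∀ r : R, p r = r := fun r => DFunLike.congr_fun hp r
  have hπA : ∀ x, π (A x) = 0 → A x = 0 := by
    intro x hx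
    have h1 : p (A x) = 0 := eR.map_eq_zero_iff.1 hx
    have h2 := hpR ⟨A x, x, rfl⟩
    rw [h1] at h2
    simpa using (congrArg Subtype.val h2).symm
  let K := (A : F →ₗ[ℝ] F).ker
  obtain ⟨q, hq⟩ := LinearMap.exists_leftInverse_of_injective K.subtype (Submodule.ker_subtype K)
  let κ : F →L[ℝ] K := LinearMap.toContinuousLinearMap q
  have hκ : ∀ k : K, κ k = k := fun k => DFunLike.congr_fun hq k
  -- Straightening coordinates: the projection of w to the range of its derivative at y₁, completed
  -- by a projection of y to the kernel.
  let Ξ : F → (Fin (rk y₁) → ℝ) × K := fun y => (π (w y), κ (y - y₁))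
  have hΞ : ContDiffOn ℝ ∞ Ξ O :=
    (π.contDiff.comp_contDiffOn hw).prodMk
      (κ.contDiff.comp (contDiff_id.sub contDiff_const)).contDiffOn
  let Ξ' : F →L[ℝ] (Fin (rk y₁) → ℝ) × K := (π ∘L A).prod κ
  have hΞ' : HasFDerivAt Ξ Ξ' y₁ :=
    (π.hasFDerivAt.comp y₁ (hdiff y₁ hy₁)).prodMk
      (κ.hasFDerivAt.comp y₁ ((hasFDerivAt_id y₁).sub_const y₁))
  have hinj : Function.Injective (Ξ' : F →ₗ[ℝ] (Fin (rk y₁) → ℝ) × K) := by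
    rw [← LinearMap.ker_eq_bot, LinearMap.ker_eq_bot']
    intro x hx
    have h1 : A x = 0 := hπA x (congrArg Prod.fst hx)
    have h2 : κ x = 0 := congrArg Prod.snd hx
    have h3 := hκ ⟨x, h1⟩
    rw [show ((⟨x, h1⟩ : K) : F) = x from rfl, h2] at h3
    simpa using (congrArg Subtype.val h3).symm
  have hdim : Module.finrank ℝ F = Module.finrank ℝ ((Fin (rk y₁) → ℝ) × K) := by
    rw [Module.finrank_prod, Module.finrank_fin_fun]
    exact (LinearMap.finrank_range_add_finrank_ker (A : F →ₗ[ℝ] F)).symm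
  let eΞ : F ≃L[ℝ] (Fin (rk y₁) → ℝ) × K :=
    (LinearEquiv.ofBijective (Ξ' : F →ₗ[ℝ] (Fin (rk y₁) → ℝ) × K)
      ⟨hinj, (LinearMap.injective_iff_surjective_of_finrank_eq_finrank hdim).1 hinj⟩
      ).toContinuousLinearEquiv
  obtain ⟨e, hy₁e, heO, he, hsymm⟩ := exists_smooth_openPartialHomeomorph hO hy₁ hΞ eΞ hΞ'
  have htgt : (π (w y₁), (0 : K)) ∈ e.target := by
    have := e.map_source hy₁e
    rw [he] at this
    simpa [Ξ] using this
  obtain ⟨ε, hε, hball⟩ := Metric.isOpen_iff.1 e.open_target _ htgt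
  rw [← ball_prod_same] at hball
  -- the composition with the local inverse does not depend on the second variable
  have hconst : ∀ z ∈ Metric.ball (π (w y₁)) ε, ∀ k ∈ Metric.ball (0 : K) ε,
      w (e.symm (z, k)) = w (e.symm (z, 0)) := by
    intro z hz k hk
    have hin : ∀ k ∈ Metric.ball (0 : K) ε, (z, k) ∈ e.target := fun k hk => hball ⟨hz, hk⟩
    have hder : ∀ k ∈ Metric.ball (0 : K) ε,
        HasFDerivAt (fun k : K => w (e.symm (z, k))) (0 : K →L[ℝ] F) k := by
      intro k hk
      have hs : HasFDerivAt e.symm (fderiv ℝ e.symm (z, k)) (z, k) :=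
        ((hsymm.contDiffAt (e.open_target.mem_nhds (hin k hk))).differentiableAt
          (by simp)).hasFDerivAt
      have hyO : e.symm (z, k) ∈ O := heO (e.map_target (hin k hk))
      have hws := (hdiff _ hyO).comp (z, k) hs
      -- In the new coordinates π ∘ w is the first projection, so the derivative of w has rank at
      -- least `rk y₁`, hence exactly that by maximality. Then π is injective on its range, and
      -- directions along K, killed by π ∘ Dw, are killed by Dw.
      have hπ : HasFDerivAt (fun a => π (w (e.symm a)))
          (ContinuousLinearMap.fst ℝ (Fin (rk y₁) → ℝ) K) (z, k) := by
        refine hasFDerivAt_fst.congr_of_eventuallyEq ?_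
        filter_upwards [e.open_target.mem_nhds (hin k hk)] with a ha
        have := e.right_inv ha
        rw [he] at this
        exact congrArg Prod.fst this
      have heq : π ∘L (fderiv ℝ w (e.symm (z, k)) ∘L fderiv ℝ e.symm (z, k)) = _ :=
        (π.hasFDerivAt.comp (z, k) hws).unique hπ
      have hsurj : Function.Surjective ((π : F →ₗ[ℝ] Fin (rk y₁) → ℝ) ∘ₗ
          (fderiv ℝ w (e.symm (z, k)) : F →ₗ[ℝ] F)) := fun g =>
        ⟨fderiv ℝ e.symm (z, k) (g, 0), DFunLike.congr_fun heq (g, 0)⟩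
      refine (hws.comp k (hasFDerivAt_prodMk_right z k)).congr_fderiv ?_
      refine ContinuousLinearMap.ext fun k' => ?_
      refine apply_eq_zero_of_finrank_range_le (fderiv ℝ w (e.symm (z, k)) : F →ₗ[ℝ] F)
        (π : F →ₗ[ℝ] Fin (rk y₁) → ℝ) hsurj ?_ (DFunLike.congr_fun heq (0, k'))
      rw [Module.finrank_fin_fun]
      exact hmax _ hyO
    exact Metric.isOpen_ball.is_const_of_fderiv_eq_zero (convex_ball _ _).isPreconnected
      (fun k hk => (hder k hk).differentiableAt.differentiableWithinAt)
      (fun k hk => (hder k hk).fderiv) hk (Metric.mem_ball_self hε)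
  -- The reduced parameters are π ∘ w, and the section picks the point with vanishing kernel
  -- coordinate.
  refine ⟨rk y₁, hrk y₁ hy₁, fun y => π (w y), fun z => e.symm (z, 0),
    e.source ∩ e ⁻¹' (Metric.ball (π (w y₁)) ε ×ˢ Metric.ball (0 : K) ε),
    Metric.ball (π (w y₁)) ε, ?_, ⟨y₁, hy₁e, ?_⟩, fun y hy => heO hy.1, Metric.isOpen_ball, ?_, ?_,
    ?_, ?_, ?_⟩
  · exact e.isOpen_inter_preimage (Metric.isOpen_ball.prod Metric.isOpen_ball)
  · rw [Set.mem_preimage, he]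
    simpa [Ξ] using hε
  · exact (π.contDiff.comp_contDiffOn hw).mono fun y hy => heO hy.1
  · refine hsymm.comp (contDiff_prodMk_left (0 : K)).contDiffOn fun z hz => ?_
    exact hball ⟨hz, Metric.mem_ball_self hε⟩
  · intro y hy
    have := hy.2.1
    rw [he] at this
    exact this
  · intro z hz
    exact heO (e.map_target (hball ⟨hz, Metric.mem_ball_self hε⟩))
  · intro y hy
    have h2 := hy.2
    rw [Set.mem_preimage, he] at h2
    have h3 : e.symm (π (w y), κ (y - y₁)) = y := by
      rw [← show e y = (π (w y), κ (y - y₁)) from he y, e.left_inv hy.1]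
    rw [← hconst _ h2.1 _ h2.2, h3]

end ConstantRank

end EvolCondSym

end

noncomputable section

namespace EvolCondSym

/-! ### Smooth functions of finitely many jet coordinates -/

section JetFunctions

/-- The base point of a jet together with the jet coordinates listed by `σ`. -/
def jetCoords {ι : Type} (σ : ι → ℕ × ℕ) (j : Jet) : (ℝ × ℝ) × (ι → ℝ) := (j.1, fun i => j.2 (σ i))

/-- `G`, smooth on the open set `O`, represents `F` over the set `D` of jets in terms of the
coordinates listed by `σ`. -/
structure Represents {ι : Type} (D : Set Jet) (F : Jet → ℝ) (σ : ι → ℕ × ℕ)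
    (G : (ℝ × ℝ) × (ι → ℝ) → ℝ) (O : Set ((ℝ × ℝ) × (ι → ℝ))) : Prop where
  isOpen : IsOpen O
  smooth : ∀ [Fintype ι], ContDiffOn ℝ ∞ G O
  mem : ∀ j ∈ D, jetCoords σ j ∈ O
  eq : ∀ j ∈ D, F j = G (jetCoords σ j)

/-- Over the set `D`, `F` is a smooth function of `t`, `x` and finitely many of the jet coordinates
with indices in `S`. -/
def SmoothJetFun (D : Set Jet) (S : Set (ℕ × ℕ)) (F : Jet → ℝ) : Prop :=
  ∃ (ι : Type) (_ : Fintype ι) (σ : ι → ℕ × ℕ) (G : (ℝ × ℝ) × (ι → ℝ) → ℝ)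
    (O : Set ((ℝ × ℝ) × (ι → ℝ))), (∀ i, σ i ∈ S) ∧ Represents D F σ G O

variable {ι : Type} [Fintype ι] {D : Set Jet} {S S' : Set (ℕ × ℕ)} {F F' : Jet → ℝ} {σ : ι → ℕ × ℕ}
  {G : (ℝ × ℝ) × (ι → ℝ) → ℝ} {O : Set ((ℝ × ℝ) × (ι → ℝ))}

omit [Fintype ι] in
theorem continuous_jetCoords : Continuous (jetCoords σ) := by
  unfold jetCoords
  fun_prop

/-- The jet space carries no norm, so differentiation passes through finitely many coordinates. The
representation is valid only on D; openness of D and continuity of Φ make it valid near z. -/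
theorem Represents.hasFDerivAt_comp (h : Represents D F σ G O) (hD : IsOpen D)
    {V : Type} [NormedAddCommGroup V] [NormedSpace ℝ V] {Φ : V → Jet} {z : V} (hz : Φ z ∈ D)
    (hc : ContinuousAt Φ z) {L : V →L[ℝ] (ℝ × ℝ) × (ι → ℝ)}
    (hL : HasFDerivAt (fun z => jetCoords σ (Φ z)) L z) :
    HasFDerivAt (fun z => F (Φ z)) (fderiv ℝ G (jetCoords σ (Φ z)) ∘L L) z := by
  have hG : HasFDerivAt G (fderiv ℝ G (jetCoords σ (Φ z))) (jetCoords σ (Φ z)) :=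
    ((h.smooth.contDiffAt (h.isOpen.mem_nhds (h.mem _ hz))).differentiableAt (by simp)).hasFDerivAt
  refine (hG.comp z hL).congr_of_eventuallyEq ?_
  filter_upwards [hc.eventually (hD.mem_nhds hz)] with z' hz' using h.eq _ hz'

theorem Represents.hasDerivAt_comp (h : Represents D F σ G O) (hD : IsOpen D)
    {c : ℝ → Jet} {s : ℝ} {j : Jet} (hj : j ∈ D) (hs : c s = j) (hc : ContinuousAt c s)
    {e : (ℝ × ℝ) × (ι → ℝ)} (he : HasDerivAt (fun s => jetCoords σ (c s)) e s) :
    HasDerivAt (fun s => F (c s)) (fderiv ℝ G (jetCoords σ j) e) s := by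
  subst hs
  simpa using (h.hasFDerivAt_comp hD hj hc he.hasFDerivAt).hasDerivAt

theorem Represents.partialT_eq (h : Represents D F σ G O) (hD : IsOpen D) {j : Jet} (hj : j ∈ D) :
    partialT F j = fderiv ℝ G (jetCoords σ j) ((1, 0), 0) := by
  refine (h.hasDerivAt_comp hD (c := fun s => ((s, j.1.2), j.2)) hj rfl (by fun_prop) ?_).deriv
  exact ((hasDerivAt_id _).prodMk (hasDerivAt_const _ _)).prodMk (hasDerivAt_const _ (fun i => j.2 (σ i)))

theorem Represents.partialX_eq (h : Represents D F σ G O) (hD : IsOpen D) {j : Jet} (hj : j ∈ D) :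
    partialX F j = fderiv ℝ G (jetCoords σ j) ((0, 1), 0) := by
  refine (h.hasDerivAt_comp hD (c := fun s => ((j.1.1, s), j.2)) hj rfl (by fun_prop) ?_).deriv
  exact ((hasDerivAt_const _ _).prodMk (hasDerivAt_id _)).prodMk (hasDerivAt_const _ (fun i => j.2 (σ i)))

theorem Represents.partialU_eq (h : Represents D F σ G O) (hD : IsOpen D) {j : Jet} (hj : j ∈ D)
    (α : ℕ × ℕ) :
    partialU α F j = fderiv ℝ G (jetCoords σ j) (0, fun i => if σ i = α then 1 else 0) := by
  refine (h.hasDerivAt_comp hD (c := fun s => (j.1, Function.update j.2 α s)) hj (by simp)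
    (by fun_prop) ?_).deriv
  refine (hasDerivAt_const _ _).prodMk (hasDerivAt_pi.2 fun i => ?_)
  by_cases hi : σ i = α
  · subst hi
    simpa using hasDerivAt_id' _
  · simpa [hi] using hasDerivAt_const _ _

/-- Only indices in the image of σ contribute, and by linearity the sum is one directional
derivative of G. The list σ need not be injective: ∂/∂u_α corresponds to the indicator of the fibre
over α. -/
theorem Represents.finsum_eq (h : Represents D F σ G O) (hD : IsOpen D) {j : Jet} (hj : j ∈ D)
    (c : ℕ × ℕ → ℝ) :
    ∑ᶠ α, c α * partialU α F j = fderiv ℝ G (jetCoords σ j) (0, fun i => c (σ i)) := by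
  classical
  have hsupp : (Function.support fun α => c α * partialU α F j) ⊆
      ((Finset.univ.image σ : Finset (ℕ × ℕ)) : Set (ℕ × ℕ)) := by
    intro α hα
    by_contra hn
    refine hα ?_
    have : (fun i => if σ i = α then (1 : ℝ) else 0) = 0 := by
      funext i
      have : σ i ≠ α := fun hi => hn (by simp [← hi])
      simp [this]
    simp only [h.partialU_eq hD hj, this, ← Prod.zero_eq_mk, map_zero, mul_zero]
  rw [finsum_eq_sum_of_support_subset _ hsupp]
  simp only [h.partialU_eq hD hj, ← smul_eq_mul, ← map_smul, ← map_sum]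
  congr 1
  ext i
  · simp [Prod.fst_sum]
  · simp [Prod.fst_sum]
  · simp [Prod.snd_sum]

theorem Represents.totalT_eq (h : Represents D F σ G O) (hD : IsOpen D) {j : Jet} (hj : j ∈ D) :
    totalT F j =
      fderiv ℝ G (jetCoords σ j) ((1, 0), fun i => j.2 ((σ i).1 + 1, (σ i).2)) := by
  rw [totalT, h.partialT_eq hD hj, h.finsum_eq hD hj (fun α => j.2 (α.1 + 1, α.2)), ← map_add]
  simp

theorem Represents.totalX_eq (h : Represents D F σ G O) (hD : IsOpen D) {j : Jet} (hj : j ∈ D) :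
    totalX F j =
      fderiv ℝ G (jetCoords σ j) ((0, 1), fun i => j.2 ((σ i).1, (σ i).2 + 1)) := by
  rw [totalX, h.partialX_eq hD hj, h.finsum_eq hD hj (fun α => j.2 (α.1, α.2 + 1)), ← map_add]
  simp

/-- A total derivative involves the old coordinates, where DG is evaluated, and the shifted ones, to
which it is applied; hence the doubled list. -/
theorem Represents.of_fderiv (h : Represents D F σ G O) {τ : ℕ × ℕ → ℕ × ℕ} {w : ℝ × ℝ}
    (hF' : ∀ j ∈ D, F' j = fderiv ℝ G (jetCoords σ j) (w, fun i => j.2 (τ (σ i)))) :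
    Represents D F' (Sum.elim σ (τ ∘ σ))
      (fun z => fderiv ℝ G (z.1, fun i => z.2 (Sum.inl i)) (w, fun i => z.2 (Sum.inr i)))
      ((fun z => (z.1, fun i => z.2 (Sum.inl i))) ⁻¹' O) where
  isOpen := h.isOpen.preimage (by fun_prop)
  smooth := by
    intro _
    refine ContDiffOn.clm_apply ?_ (by fun_prop)
    refine (h.smooth.fderiv_of_isOpen (m := ∞) h.isOpen (by simp)).comp
      (t := O) (f := fun z : (ℝ × ℝ) × (ι ⊕ ι → ℝ) => (z.1, fun i => z.2 (Sum.inl i)))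
      (ContDiff.contDiffOn (by fun_prop)) fun z hz => hz
  mem := h.mem
  eq := hF'

theorem SmoothJetFun.totalT (h : SmoothJetFun D S F) (hD : IsOpen D)
    (hS : ∀ α ∈ S, α ∈ S' ∧ (α.1 + 1, α.2) ∈ S') : SmoothJetFun D S' (totalT F) := by
  obtain ⟨ι, _, σ, G, O, hσ, h⟩ := h
  refine ⟨ι ⊕ ι, inferInstance, _, _, _, ?_,
    h.of_fderiv (τ := fun α => (α.1 + 1, α.2)) (fun j hj => h.totalT_eq hD hj)⟩
  rintro (i | i)
  exacts [(hS _ (hσ i)).1, (hS _ (hσ i)).2]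

theorem SmoothJetFun.totalX (h : SmoothJetFun D S F) (hD : IsOpen D)
    (hS : ∀ α ∈ S, α ∈ S' ∧ (α.1, α.2 + 1) ∈ S') : SmoothJetFun D S' (totalX F) := by
  obtain ⟨ι, _, σ, G, O, hσ, h⟩ := h
  refine ⟨ι ⊕ ι, inferInstance, _, _, _, ?_,
    h.of_fderiv (τ := fun α => (α.1, α.2 + 1)) (fun j hj => h.totalX_eq hD hj)⟩
  rintro (i | i)
  exacts [(hS _ (hσ i)).1, (hS _ (hσ i)).2]

theorem SmoothJetFun.continuousOn (h : SmoothJetFun D S F) : ContinuousOn F D := by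
  obtain ⟨ι, _, σ, G, O, -, h⟩ := h
  exact (h.smooth.continuousOn.comp continuous_jetCoords.continuousOn h.mem).congr h.eq

theorem SmoothJetFun.eq_of_agree (h : SmoothJetFun D S F) {j j' : Jet} (hj : j ∈ D) (hj' : j' ∈ D)
    (hbase : j.1 = j'.1) (hS : ∀ α ∈ S, j.2 α = j'.2 α) : F j = F j' := by
  obtain ⟨ι, _, σ, G, O, hσ, h⟩ := h
  rw [h.eq j hj, h.eq j' hj']
  congr 1
  exact Prod.ext hbase (funext fun i => hS _ (hσ i))

theorem SmoothJetFun.mono (h : SmoothJetFun D S F) (hS : S ⊆ S') : SmoothJetFun D S' F := by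
  obtain ⟨ι, _, σ, G, O, hσ, h⟩ := h
  exact ⟨ι, inferInstance, σ, G, O, fun i => hS (hσ i), h⟩

/-- One and the same G represents both functions over the open set D and fixes their total
derivatives. This is what allows iteration when identities hold only on D. -/
theorem SmoothJetFun.totalT_congr (h : SmoothJetFun D S F) (hD : IsOpen D)
    (hF' : Set.EqOn F' F D) : Set.EqOn (EvolCondSym.totalT F') (EvolCondSym.totalT F) D := by
  obtain ⟨ι, _, σ, G, O, -, h⟩ := h
  have h' : Represents D F' σ G O :=
    ⟨h.isOpen, h.smooth, h.mem, fun j hj => (hF' hj).trans (h.eq j hj)⟩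
  exact fun j hj => (h'.totalT_eq hD hj).trans (h.totalT_eq hD hj).symm

theorem SmoothJetFun.totalX_congr (h : SmoothJetFun D S F) (hD : IsOpen D)
    (hF' : Set.EqOn F' F D) : Set.EqOn (EvolCondSym.totalX F') (EvolCondSym.totalX F) D := by
  obtain ⟨ι, _, σ, G, O, -, h⟩ := h
  have h' : Represents D F' σ G O :=
    ⟨h.isOpen, h.smooth, h.mem, fun j hj => (hF' hj).trans (h.eq j hj)⟩
  exact fun j hj => (h'.totalX_eq hD hj).trans (h.totalX_eq hD hj).symm

omit [Fintype ι] in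
theorem Represents.coord_sub (h : Represents D F σ G O) (β : ℕ × ℕ) :
    Represents D (fun j => j.2 β - F j) (fun i : Option ι => i.elim β σ)
      (fun z => z.2 none - G (z.1, fun i => z.2 (some i)))
      ((fun z => (z.1, fun i => z.2 (some i))) ⁻¹' O) where
  isOpen := h.isOpen.preimage (by fun_prop)
  smooth := by
    intro _
    -- The goal supplies finiteness of `Option ι` only; that of ι is recovered from it.
    let _ : Fintype ι := Fintype.ofInjective (some : ι → Option ι) (Option.some_injective ι)
    refine ContDiffOn.sub (by fun_prop) ?_
    exact h.smooth.comp
      (t := O) (f := fun z : (ℝ × ℝ) × (Option ι → ℝ) => (z.1, fun i => z.2 (some i)))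
      (ContDiff.contDiffOn (by fun_prop)) fun z hz => hz
  mem := h.mem
  eq := fun j hj => by rw [h.eq j hj]; rfl

theorem fderiv_coord_sub {z e : (ℝ × ℝ) × (Option ι → ℝ)}
    (hG : DifferentiableAt ℝ G (z.1, fun i => z.2 (some i))) :
    fderiv ℝ (fun z : (ℝ × ℝ) × (Option ι → ℝ) => z.2 none - G (z.1, fun i => z.2 (some i))) z e =
      e.2 none - fderiv ℝ G (z.1, fun i => z.2 (some i)) (e.1, fun i => e.2 (some i)) := by
  let q : (ℝ × ℝ) × (Option ι → ℝ) →L[ℝ] (ℝ × ℝ) × (ι → ℝ) :=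
    (ContinuousLinearMap.fst ℝ _ _).prod (ContinuousLinearMap.pi fun i =>
      ContinuousLinearMap.proj (some i) ∘L ContinuousLinearMap.snd ℝ (ℝ × ℝ) (Option ι → ℝ))
  let q' : (ℝ × ℝ) × (Option ι → ℝ) →L[ℝ] ℝ :=
    ContinuousLinearMap.proj none ∘L ContinuousLinearMap.snd ℝ (ℝ × ℝ) (Option ι → ℝ)
  have h1 : HasFDerivAt (fun z : (ℝ × ℝ) × (Option ι → ℝ) => G (z.1, fun i => z.2 (some i)))
      (fderiv ℝ G (z.1, fun i => z.2 (some i)) ∘L q) z :=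
    HasFDerivAt.comp (f := q) z hG.hasFDerivAt q.hasFDerivAt
  have h2 : HasFDerivAt (fun z : (ℝ × ℝ) × (Option ι → ℝ) => z.2 none) q' z := q'.hasFDerivAt
  rw [(h2.fun_sub h1).fderiv]
  rfl

theorem SmoothJetFun.coord_sub (h : SmoothJetFun D S F) (β : ℕ × ℕ) :
    SmoothJetFun D Set.univ (fun j => j.2 β - F j) := by
  obtain ⟨ι, _, σ, G, O, -, h⟩ := h
  exact ⟨Option ι, inferInstance, _, _, _, fun _ => Set.mem_univ _, h.coord_sub β⟩

theorem SmoothJetFun.totalT_coord_sub (h : SmoothJetFun D S F) (hD : IsOpen D) (β : ℕ × ℕ) {j : Jet}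
    (hj : j ∈ D) : EvolCondSym.totalT (fun j => j.2 β - F j) j =
      j.2 (β.1 + 1, β.2) - EvolCondSym.totalT F j := by
  obtain ⟨ι, _, σ, G, O, -, h⟩ := h
  rw [(h.coord_sub β).totalT_eq hD hj, h.totalT_eq hD hj, fderiv_coord_sub]
  · rfl
  · exact (h.smooth.contDiffAt (h.isOpen.mem_nhds (h.mem _ hj))).differentiableAt (by simp)

theorem SmoothJetFun.totalX_coord_sub (h : SmoothJetFun D S F) (hD : IsOpen D) (β : ℕ × ℕ) {j : Jet}
    (hj : j ∈ D) : EvolCondSym.totalX (fun j => j.2 β - F j) j =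
      j.2 (β.1, β.2 + 1) - EvolCondSym.totalX F j := by
  obtain ⟨ι, _, σ, G, O, -, h⟩ := h
  rw [(h.coord_sub β).totalX_eq hD hj, h.totalX_eq hD hj, fderiv_coord_sub]
  · rfl
  · exact (h.smooth.contDiffAt (h.isOpen.mem_nhds (h.mem _ hj))).differentiableAt (by simp)

/-! ### Chain rules along maps into the jet space. -/

variable {V : Type} [NormedAddCommGroup V] [NormedSpace ℝ V] {Φ : V → Jet} {z : V}

theorem continuousAt_jet {L₀ : V →L[ℝ] ℝ × ℝ} (h₀ : HasFDerivAt (fun z => (Φ z).1) L₀ z)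
    {L : ℕ × ℕ → V →L[ℝ] ℝ} (h : ∀ α, HasFDerivAt (fun z => (Φ z).2 α) (L α) z) :
    ContinuousAt Φ z :=
  ContinuousAt.prodMk h₀.continuousAt (continuousAt_pi.2 fun α => (h α).continuousAt)

/-- Chain rule: the derivative of `F ∘ Φ` along a vector along which `Φ` moves like a prolonged curve
`t ↦ j^∞u(t, x)`. -/
theorem SmoothJetFun.fderiv_comp_totalT (hF : SmoothJetFun D S F) (hD : IsOpen D) (hz : Φ z ∈ D)
    {L₀ : V →L[ℝ] ℝ × ℝ} (h₀ : HasFDerivAt (fun z => (Φ z).1) L₀ z)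
    {L : ℕ × ℕ → V →L[ℝ] ℝ} (h : ∀ α, HasFDerivAt (fun z => (Φ z).2 α) (L α) z) {w : V}
    (hw₀ : L₀ w = (1, 0)) (hw : ∀ α ∈ S, L α w = (Φ z).2 (α.1 + 1, α.2)) :
    fderiv ℝ (fun z => F (Φ z)) z w = EvolCondSym.totalT F (Φ z) := by
  obtain ⟨ι, _, σ, G, O, hσ, hr⟩ := hF
  rw [(hr.hasFDerivAt_comp hD hz (continuousAt_jet h₀ h)
    (h₀.prodMk (hasFDerivAt_pi.2 fun i => h (σ i)))).fderiv, hr.totalT_eq hD hz]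
  simp only [ContinuousLinearMap.comp_apply, ContinuousLinearMap.prod_apply, hw₀]
  congr 2
  funext i
  exact hw _ (hσ i)

/-- Chain rule: the derivative of `F ∘ Φ` along a vector along which `Φ` moves like a prolonged curve
`x ↦ j^∞u(t, x)`. -/
theorem SmoothJetFun.fderiv_comp_totalX (hF : SmoothJetFun D S F) (hD : IsOpen D) (hz : Φ z ∈ D)
    {L₀ : V →L[ℝ] ℝ × ℝ} (h₀ : HasFDerivAt (fun z => (Φ z).1) L₀ z)
    {L : ℕ × ℕ → V →L[ℝ] ℝ} (h : ∀ α, HasFDerivAt (fun z => (Φ z).2 α) (L α) z) {w : V}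
    (hw₀ : L₀ w = (0, 1)) (hw : ∀ α ∈ S, L α w = (Φ z).2 (α.1, α.2 + 1)) :
    fderiv ℝ (fun z => F (Φ z)) z w = EvolCondSym.totalX F (Φ z) := by
  obtain ⟨ι, _, σ, G, O, hσ, hr⟩ := hF
  rw [(hr.hasFDerivAt_comp hD hz (continuousAt_jet h₀ h)
    (h₀.prodMk (hasFDerivAt_pi.2 fun i => h (σ i)))).fderiv, hr.totalX_eq hD hz]
  simp only [ContinuousLinearMap.comp_apply, ContinuousLinearMap.prod_apply, hw₀]
  congr 2
  funext i
  exact hw _ (hσ i)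

theorem SmoothJetFun.differentiableAt_comp (hF : SmoothJetFun D S F) (hD : IsOpen D) (hz : Φ z ∈ D)
    (h₀ : DifferentiableAt ℝ (fun z => (Φ z).1) z)
    (h : ∀ α, DifferentiableAt ℝ (fun z => (Φ z).2 α) z) :
    DifferentiableAt ℝ (fun z => F (Φ z)) z := by
  obtain ⟨ι, _, σ, G, O, hσ, hr⟩ := hF
  exact (hr.hasFDerivAt_comp hD hz (continuousAt_jet h₀.hasFDerivAt fun α => (h α).hasFDerivAt)
    (h₀.hasFDerivAt.prodMk (hasFDerivAt_pi.2 fun i => (h (σ i)).hasFDerivAt))).differentiableAt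

end JetFunctions

/-! ### Functions of `t`, `x` and the derivatives with respect to `x` -/

section XOrder

variable {D : Set Jet} {F : Jet → ℝ} {n : ℕ}

/-- The indices of `u_0, …, u_n`. -/
def xIndices (n : ℕ) : Set (ℕ × ℕ) := {α | α.1 = 0 ∧ α.2 ≤ n}

theorem SmoothJetFun.totalX_xIndices (hF : SmoothJetFun D (xIndices n) F) (hD : IsOpen D) :
    SmoothJetFun D (xIndices (n + 1)) (EvolCondSym.totalX F) :=
  hF.totalX hD fun _ hα => ⟨⟨hα.1, hα.2.trans n.le_succ⟩, hα.1, Nat.succ_le_succ hα.2⟩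

/-- The total derivative of a function of order `n` is affine in `u_{n+1}`. -/
theorem SmoothJetFun.totalX_affine (hF : SmoothJetFun D (xIndices n) F) (hD : IsOpen D) {j j' : Jet}
    (hj : j ∈ D) (hj' : j' ∈ D) (hbase : j'.1 = j.1) (hS : ∀ k ≤ n, j'.2 (0, k) = j.2 (0, k)) :
    EvolCondSym.totalX F j' = EvolCondSym.totalX F j +
      (j'.2 (0, n + 1) - j.2 (0, n + 1)) * partialU (0, n) F j := by
  obtain ⟨ι, _, σ, G, O, hσ, h⟩ := hF
  have hco : jetCoords σ j' = jetCoords σ j := by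
    refine Prod.ext hbase (funext fun i => ?_)
    have := hS _ (hσ i).2
    rwa [← (hσ i).1] at this
  rw [h.totalX_eq hD hj, h.totalX_eq hD hj', h.partialU_eq hD hj, hco, ← smul_eq_mul, ← map_smul,
    ← map_add]
  congr 1
  refine Prod.ext (by simp) (funext fun i => ?_)
  obtain ⟨h0, hle⟩ := hσ i
  by_cases hi : (σ i).2 = n
  · have : σ i = (0, n) := Prod.ext h0 hi
    simp [this]
  · have h1 : σ i ≠ (0, n) := fun h => hi (congrArg Prod.snd h)
    have h2 := hS ((σ i).2 + 1) (by omega)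
    simp [h1, h0, h2]

/-- D_x F is affine in u_{n+1} with slope ∂F/∂u_n, so the leading derivative, and with it maximal
rank, survives every D_x. -/
theorem SmoothJetFun.partialU_totalX (hF : SmoothJetFun D (xIndices n) F) (hD : IsOpen D) {j : Jet}
    (hj : j ∈ D) :
    partialU (0, n + 1) (EvolCondSym.totalX F) j = partialU (0, n) F j := by
  have hc : ContinuousAt (fun s : ℝ => (j.1, Function.update j.2 (0, n + 1) s)) (j.2 (0, n + 1)) := by
    fun_prop
  have hev : (fun s => EvolCondSym.totalX F (j.1, Function.update j.2 (0, n + 1) s)) =ᶠ[𝓝 (j.2 (0, n + 1))]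
      fun s => EvolCondSym.totalX F j + (s - j.2 (0, n + 1)) * partialU (0, n) F j := by
    have hmem : ∀ᶠ s in 𝓝 (j.2 (0, n + 1)), (j.1, Function.update j.2 (0, n + 1) s) ∈ D :=
      hc.eventually (by simpa using hD.mem_nhds hj)
    filter_upwards [hmem] with s hs
    rw [hF.totalX_affine hD hj hs rfl]
    · simp
    · intro k hk
      refine Function.update_of_ne ?_ _ _
      intro h
      have := congrArg Prod.snd h
      simp at this
      omega
  rw [partialU, hev.deriv_eq]
  simp

theorem SmoothJetFun.iterate_totalX (hF : SmoothJetFun D (xIndices n) F) (hD : IsOpen D) (k : ℕ) :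
    SmoothJetFun D (xIndices (n + k)) (EvolCondSym.totalX^[k] F) := by
  induction k with
  | zero => exact hF
  | succ k ih =>
    rw [Function.iterate_succ_apply']
    exact ih.totalX_xIndices hD

theorem SmoothJetFun.partialU_iterate_totalX (hF : SmoothJetFun D (xIndices n) F) (hD : IsOpen D)
    {j : Jet} (hj : j ∈ D) (k : ℕ) :
    partialU (0, n + k) (EvolCondSym.totalX^[k] F) j = partialU (0, n) F j := by
  induction k with
  | zero => rfl
  | succ k ih =>
    rw [Function.iterate_succ_apply', ← add_assoc, (hF.iterate_totalX hD k).partialU_totalX hD hj, ih]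

/-- If all total derivatives of `F` vanish at two jets, and `∂F/∂u_n ≠ 0`, then the two jets have the
same derivatives with respect to `x` as soon as they have those of order up to `n`. -/
theorem SmoothJetFun.x_coords_unique (hF : SmoothJetFun D (xIndices n) F) (hD : IsOpen D)
    {j j' : Jet} (hj : j ∈ D) (hj' : j' ∈ D) (hFj : ∀ k, EvolCondSym.totalX^[k] F j = 0)
    (hFj' : ∀ k, EvolCondSym.totalX^[k] F j' = 0) (hne : partialU (0, n) F j ≠ 0)
    (hbase : j'.1 = j.1) (hS : ∀ k ≤ n, j'.2 (0, k) = j.2 (0, k)) (k : ℕ) :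
    j'.2 (0, k) = j.2 (0, k) := by
  have key : ∀ m, ∀ k ≤ n + m, j'.2 (0, k) = j.2 (0, k) := by
    intro m
    induction m with
    | zero => exact hS
    | succ m ih =>
      intro k hk
      rcases hk.lt_or_eq with hlt | rfl
      · exact ih k (by omega)
      -- Both values of D_x^{m+1} F vanish, so the difference of the u_{n+m+1} times the nonzero
      -- slope is zero.
      · have h := (hF.iterate_totalX hD m).totalX_affine hD hj hj' hbase ih
        rw [← Function.iterate_succ_apply' EvolCondSym.totalX, hFj, hFj',
          hF.partialU_iterate_totalX hD hj, zero_add, zero_eq_mul] at h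
        rw [← add_assoc]
        exact sub_eq_zero.1 (h.resolve_right hne)
  exact key k k (by omega)

end XOrder

end EvolCondSym

end

noncomputable section

namespace EvolCondSym

/-! ### Jets satisfying the differential consequences of an evolution equation -/

section Consequences

theorem continuous_toXJet (n : ℕ) : Continuous (toXJet n) := by
  unfold toXJet
  fun_prop

theorem smoothJetFun_comp_toXJet {n : ℕ} {A : Set (XJet n)} (hA : IsOpen A) {h : XJet n → ℝ}
    (hh : ContDiffOn ℝ ∞ h A) :
    SmoothJetFun (toXJet n ⁻¹' A) (xIndices n) (fun j => h (toXJet n j)) :=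
  ⟨Fin (n + 1), inferInstance, fun k => (0, (k : ℕ)), h, A,
    fun k => ⟨rfl, Nat.lt_succ_iff.1 k.2⟩, hA, by
      -- Smoothness is required for any `Fintype` instance norming the coordinate space; all such
      -- instances coincide.
      intro inst
      rwa [Subsingleton.elim inst (Fin.fintype (n + 1))], fun _ hj => hj, fun _ _ => rfl⟩

theorem partialU_comp_toXJet {n : ℕ} (h : XJet n → ℝ) (j : Jet) :
    partialU (0, n) (fun j => h (toXJet n j)) j =
      deriv (fun s => h ((toXJet n j).1, Function.update (toXJet n j).2 (Fin.last n) s))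
        ((toXJet n j).2 (Fin.last n)) := by
  have : ∀ s, toXJet n (j.1, Function.update j.2 (0, n) s) =
      ((toXJet n j).1, Function.update (toXJet n j).2 (Fin.last n) s) := by
    intro s
    refine Prod.ext rfl (funext fun k => ?_)
    by_cases hk : k = Fin.last n
    · subst hk
      simp [toXJet]
    · have : (k : ℕ) ≠ n := fun h => hk (Fin.ext h)
      simp [toXJet, hk, this]
  simp only [partialU, this]
  rfl

variable (𝓔 : EvolutionEquation) {ρ : ℕ} (Q : ReducedOperator ρ)

/-- The right-hand side of the evolution equation as a function on the jet space. -/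
def EvolutionEquation.rhs (j : Jet) : ℝ := 𝓔.H (toXJet 𝓔.r j)

/-- The jets over which the right-hand side of the evolution equation is defined. -/
def EvolutionEquation.jets : Set Jet := toXJet 𝓔.r ⁻¹' 𝓔.dom

/-- The jets over which the characteristic is defined. -/
def ReducedOperator.jets : Set Jet := toXJet ρ ⁻¹' Q.dom

theorem EvolutionEquation.isOpen_jets : IsOpen 𝓔.jets :=
  𝓔.isOpen_dom.preimage (continuous_toXJet _)

theorem ReducedOperator.isOpen_jets : IsOpen Q.jets :=
  Q.isOpen_dom.preimage (continuous_toXJet _)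

theorem EvolutionEquation.smoothJetFun_rhs : SmoothJetFun 𝓔.jets (xIndices 𝓔.r) 𝓔.rhs :=
  smoothJetFun_comp_toXJet 𝓔.isOpen_dom 𝓔.smooth

theorem ReducedOperator.smoothJetFun_char : SmoothJetFun Q.jets (xIndices ρ) Q.char :=
  smoothJetFun_comp_toXJet Q.isOpen_dom Q.smooth

theorem ReducedOperator.partialU_char_ne_zero {j : Jet} (hj : j ∈ Q.jets) (h0 : Q.char j = 0) :
    partialU (0, ρ) Q.char j ≠ 0 := by
  have := partialU_comp_toXJet Q.η j
  rw [show Q.char = fun j => Q.η (toXJet ρ j) from rfl, this]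
  exact Q.maximal_rank _ hj h0

/-- Indices of at most `a` differentiations with respect to `t`. -/
def tIndices (a : ℕ) : Set (ℕ × ℕ) := {α | α.1 ≤ a}

variable {D : Set Jet} {F : Jet → ℝ}

/-- D_x does not raise the number of t-differentiations and D_t raises it by one. Hence D_t^a D_x^b
H uses at most a of them, which justifies the recursion behind `EvolutionEquation.lift`. -/
theorem SmoothJetFun.totalD (hF : SmoothJetFun D (tIndices 0) F) (hD : IsOpen D) (a b : ℕ) :
    SmoothJetFun D (tIndices a) (EvolCondSym.totalD (a, b) F) := by
  have hX : ∀ b, SmoothJetFun D (tIndices 0) (EvolCondSym.totalX^[b] F) := by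
    intro b
    induction b with
    | zero => exact hF
    | succ b ih =>
      rw [Function.iterate_succ_apply']
      exact ih.totalX hD fun α hα => ⟨hα, hα⟩
  induction a with
  | zero => exact hX b
  | succ a ih =>
    simp only [EvolCondSym.totalD, Function.iterate_succ_apply'] at ih ⊢
    refine ih.totalT hD fun α hα => ?_
    simp only [tIndices, Set.mem_ofPred_eq] at hα ⊢
    omega

theorem SmoothJetFun.totalD_coord_sub (hF : SmoothJetFun D (tIndices 0) F) (hD : IsOpen D)
    (β : ℕ × ℕ) (a b : ℕ) : Set.EqOn (EvolCondSym.totalD (a, b) fun j => j.2 β - F j)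
      (fun j => j.2 (β.1 + a, β.2 + b) - EvolCondSym.totalD (a, b) F j) D := by
  have hX : ∀ b, Set.EqOn (EvolCondSym.totalX^[b] fun j => j.2 β - F j)
      (fun j => j.2 (β.1, β.2 + b) - EvolCondSym.totalX^[b] F j) D := by
    intro b
    induction b with
    | zero => exact fun _ _ => rfl
    | succ b ih =>
      intro j hj
      have hs := hF.totalD hD 0 b
      rw [Function.iterate_succ_apply', (hs.coord_sub _).totalX_congr hD ih hj,
        Function.iterate_succ_apply']
      exact hs.totalX_coord_sub hD _ hj
  induction a with
  | zero => exact hX b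
  | succ a ih =>
    intro j hj
    have hs := hF.totalD hD a b
    simp only [EvolCondSym.totalD, Function.iterate_succ_apply'] at ih hs ⊢
    rw [(hs.coord_sub _).totalT_congr hD ih hj]
    exact hs.totalT_coord_sub hD _ hj

theorem xIndices_subset_tIndices (n a : ℕ) : xIndices n ⊆ tIndices a := fun α hα => by
  simp only [tIndices, xIndices, Set.mem_ofPred_eq] at hα ⊢
  omega

theorem EvolutionEquation.smoothJetFun_totalD_rhs (a b : ℕ) :
    SmoothJetFun 𝓔.jets (tIndices a) (totalD (a, b) 𝓔.rhs) :=
  (𝓔.smoothJetFun_rhs.mono (xIndices_subset_tIndices _ 0)).totalD 𝓔.isOpen_jets a b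

theorem EvolutionEquation.totalD_E {j : Jet} (hj : j ∈ 𝓔.jets) (a b : ℕ) :
    totalD (a, b) 𝓔.E j = j.2 (a + 1, b) - totalD (a, b) 𝓔.rhs j := by
  have := (𝓔.smoothJetFun_rhs.mono (xIndices_subset_tIndices _ 0)).totalD_coord_sub 𝓔.isOpen_jets
    (1, 0) a b hj
  simp only [add_comm 1 a, zero_add] at this
  exact this

/-- The jet with given derivatives with respect to `x` whose derivatives with up to `a`
differentiations with respect to `t` are those prescribed by the evolution equation. -/
def EvolutionEquation.liftAux : ℕ → (ℝ × ℝ) × (ℕ → ℝ) → Jet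
  | 0, y => (y.1, fun α => if α.1 = 0 then y.2 α.2 else 0)
  | a + 1, y => (y.1, fun α =>
      if α.1 = a + 1 then totalD (a, α.2) 𝓔.rhs (EvolutionEquation.liftAux a y)
      else (EvolutionEquation.liftAux a y).2 α)

/-- The jet with given derivatives with respect to `x` that satisfies the differential consequences
of the evolution equation. -/
def EvolutionEquation.lift (y : (ℝ × ℝ) × (ℕ → ℝ)) : Jet :=
  (y.1, fun α => (𝓔.liftAux α.1 y).2 α)

theorem EvolutionEquation.liftAux_fst (a : ℕ) (y : (ℝ × ℝ) × (ℕ → ℝ)) :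
    (𝓔.liftAux a y).1 = y.1 := by
  cases a <;> rfl

theorem EvolutionEquation.liftAux_of_le {a : ℕ} {α : ℕ × ℕ} (h : α.1 ≤ a)
    (y : (ℝ × ℝ) × (ℕ → ℝ)) : (𝓔.liftAux a y).2 α = (𝓔.lift y).2 α := by
  induction a with
  | zero =>
    have : α.1 = 0 := by omega
    simp [EvolutionEquation.lift, this]
  | succ a ih =>
    by_cases hα : α.1 = a + 1
    · simp only [EvolutionEquation.lift, hα]
    · rw [← ih (by omega)]
      simp [EvolutionEquation.liftAux, hα]

@[simp] theorem EvolutionEquation.lift_x (y : (ℝ × ℝ) × (ℕ → ℝ)) (k : ℕ) :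
    (𝓔.lift y).2 (0, k) = y.2 k := by
  simp [EvolutionEquation.lift, EvolutionEquation.liftAux]

@[simp] theorem EvolutionEquation.liftAux_x (a : ℕ) (y : (ℝ × ℝ) × (ℕ → ℝ)) (k : ℕ) :
    (𝓔.liftAux a y).2 (0, k) = y.2 k := by
  rw [𝓔.liftAux_of_le (by simp), 𝓔.lift_x]

theorem EvolutionEquation.toXJet_liftAux (n a : ℕ) (y : (ℝ × ℝ) × (ℕ → ℝ)) :
    toXJet n (𝓔.liftAux a y) = (y.1, fun k : Fin (n + 1) => y.2 k) := by
  simp [toXJet, 𝓔.liftAux_fst]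

theorem EvolutionEquation.toXJet_lift (n : ℕ) (y : (ℝ × ℝ) × (ℕ → ℝ)) :
    toXJet n (𝓔.lift y) = (y.1, fun k : Fin (n + 1) => y.2 k) := by
  simp [toXJet, EvolutionEquation.lift, EvolutionEquation.liftAux]

theorem EvolutionEquation.liftAux_mem_jets {y : (ℝ × ℝ) × (ℕ → ℝ)} (hy : 𝓔.lift y ∈ 𝓔.jets)
    (a : ℕ) : 𝓔.liftAux a y ∈ 𝓔.jets := by
  rw [EvolutionEquation.jets, Set.mem_preimage, 𝓔.toXJet_lift] at hy
  rwa [EvolutionEquation.jets, Set.mem_preimage, 𝓔.toXJet_liftAux]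

/-- The coordinate is defined through stage a of the recursion, which agrees with the full lift on
all indices that D_t^a D_x^b H can see. -/
theorem EvolutionEquation.lift_succ {y : (ℝ × ℝ) × (ℕ → ℝ)} (hy : 𝓔.lift y ∈ 𝓔.jets) (a b : ℕ) :
    (𝓔.lift y).2 (a + 1, b) = totalD (a, b) 𝓔.rhs (𝓔.lift y) := by
  have h1 : (𝓔.lift y).2 (a + 1, b) = totalD (a, b) 𝓔.rhs (𝓔.liftAux a y) := by
    simp [EvolutionEquation.lift, EvolutionEquation.liftAux]
  rw [h1]
  exact (𝓔.smoothJetFun_totalD_rhs a b).eq_of_agree (𝓔.liftAux_mem_jets hy a) hy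
    (𝓔.liftAux_fst a y) fun α hα => 𝓔.liftAux_of_le hα y

theorem EvolutionEquation.totalD_E_lift {y : (ℝ × ℝ) × (ℕ → ℝ)} (hy : 𝓔.lift y ∈ 𝓔.jets)
    (α : ℕ × ℕ) : totalD α 𝓔.E (𝓔.lift y) = 0 := by
  rw [show α = (α.1, α.2) from rfl, 𝓔.totalD_E hy, 𝓔.lift_succ hy, sub_self]

/-- A jet satisfying the differential consequences of the evolution equation is determined by its
derivatives with respect to `x`. -/
theorem EvolutionEquation.eq_lift {j : Jet} (hj : j ∈ 𝓔.jets) (hE : ∀ α, totalD α 𝓔.E j = 0) :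
    j = 𝓔.lift (j.1, fun k => j.2 (0, k)) := by
  set y : (ℝ × ℝ) × (ℕ → ℝ) := (j.1, fun k => j.2 (0, k))
  have hy : 𝓔.lift y ∈ 𝓔.jets := by
    rw [EvolutionEquation.jets, Set.mem_preimage, 𝓔.toXJet_lift]
    exact hj
  have key : ∀ a, ∀ α : ℕ × ℕ, α.1 ≤ a → j.2 α = (𝓔.lift y).2 α := by
    intro a
    induction a with
    | zero =>
      rintro ⟨a, b⟩ h
      obtain rfl : a = 0 := by simpa using h
      simp [y]
    | succ a ih =>
      rintro ⟨a', b⟩ h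
      rcases Nat.lt_or_ge a a' with hlt | hge
      · obtain rfl : a' = a + 1 := le_antisymm h hlt
        rw [𝓔.lift_succ hy, ← (𝓔.smoothJetFun_totalD_rhs a b).eq_of_agree hj hy rfl ih]
        have := hE (a, b)
        rw [𝓔.totalD_E hj] at this
        exact sub_eq_zero.1 this
      · exact ih _ hge
  exact Prod.ext rfl (funext fun α => key α.1 α le_rfl)

/-- In the product topology continuity is checked coordinatewise, by induction on the t-order. It
serves to pull open sets of jets back to charts. -/
theorem EvolutionEquation.continuousOn_lift : ContinuousOn 𝓔.lift (𝓔.lift ⁻¹' 𝓔.jets) := by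
  have haux : ∀ a, ContinuousOn (𝓔.liftAux a) (𝓔.lift ⁻¹' 𝓔.jets) := by
    intro a
    induction a with
    | zero =>
      refine Continuous.continuousOn ?_
      refine continuous_fst.prodMk (continuous_pi fun α => ?_)
      by_cases h : α.1 = 0
      · simp only [h, if_true]
        fun_prop
      · simp only [h, if_false]
        fun_prop
    | succ a ih =>
      refine continuousOn_fst.prodMk (continuousOn_pi.2 fun α => ?_)
      by_cases h : α.1 = a + 1
      · simp only [h, if_true]
        exact (𝓔.smoothJetFun_totalD_rhs a α.2).continuousOn.comp ih
          fun y hy => 𝓔.liftAux_mem_jets hy a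
      · simp only [h, if_false]
        exact (continuous_apply α).comp_continuousOn (continuous_snd.comp_continuousOn ih)
  exact continuousOn_fst.prodMk (continuousOn_pi.2 fun α =>
    (continuous_apply α).comp_continuousOn (continuous_snd.comp_continuousOn (haux α.1)))

variable {𝓔 Q}

theorem mem_jets_of_mem_consequences {j : Jet} (hj : j ∈ consequences 𝓔 Q) :
    j ∈ 𝓔.jets ∧ j ∈ Q.jets := hj.1

/-- A jet in `𝓜` is determined by `t`, `x`, `u_0`, …, `u_ρ`. -/
theorem eq_of_mem_consequences {j j' : Jet} (hj : j ∈ consequences 𝓔 Q)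
    (hj' : j' ∈ consequences 𝓔 Q) (hbase : j'.1 = j.1)
    (h : ∀ k ≤ ρ, j'.2 (0, k) = j.2 (0, k)) : j' = j := by
  have hx := Q.smoothJetFun_char.x_coords_unique Q.isOpen_jets hj.1.2 hj'.1.2 hj.2.2 hj'.2.2
    (Q.partialU_char_ne_zero hj.1.2 (hj.2.2 0)) hbase h
  rw [𝓔.eq_lift hj.1.1 hj.2.1, 𝓔.eq_lift hj'.1.1 hj'.2.1, hbase]
  simp only [hx]

theorem EvolutionEquation.partialU_E {α : ℕ × ℕ} (hα : α.1 ≠ 0) (j : Jet) :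
    partialU α 𝓔.E j = if α = (1, 0) then 1 else 0 := by
  have h1 : ∀ s, toXJet 𝓔.r (j.1, Function.update j.2 α s) = toXJet 𝓔.r j := fun s =>
    Prod.ext rfl (funext fun k => Function.update_of_ne (fun h => hα (by simp [← h])) _ _)
  simp only [partialU, EvolutionEquation.E, h1]
  split_ifs with h
  · subst h
    simp
  · simp [Function.update_of_ne (Ne.symm h)]

/-- Where the total derivatives of the characteristic with respect to `x` vanish, the action of the
prolonged vector field on `u_t - H` reduces to `D_t η`. -/
theorem prolong_E_eq {j : Jet} (hη : ∀ k : ℕ, totalX^[k] Q.char j = 0) :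
    Q.prolong 𝓔.r 𝓔.E j = totalT Q.char j := by
  -- Pure x-indices are killed by D_x^k η = 0; the others, except u_t, by ∂E/∂u_α = 0.
  have hterm : ∀ α : ℕ × ℕ, α ≠ (1, 0) → totalD α Q.char j * partialU α 𝓔.E j = 0 := by
    intro α hα
    by_cases h0 : α.1 = 0
    · rw [show totalD α Q.char j = totalX^[α.2] Q.char j by simp [totalD, h0], hη, zero_mul]
    · rw [EvolutionEquation.partialU_E h0, if_neg hα, mul_zero]
  rw [ReducedOperator.prolong, Finset.sum_eq_single 1, Finset.sum_eq_single ((1, 0) : ℕ × ℕ)]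
  · rw [EvolutionEquation.partialU_E one_ne_zero, if_pos rfl, mul_one]
    rfl
  · exact fun α _ hα => hterm α hα
  · simp
  · intro m _ hm
    refine Finset.sum_eq_zero fun α hα => hterm α ?_
    rintro rfl
    exact hm (by simpa using (Finset.HasAntidiagonal.mem_antidiagonal.1 hα).symm)
  -- The order-one terms do occur in the sum because r ≥ 1.
  · intro h
    have := 𝓔.one_le_r
    simp at h
    omega

end Consequences

end EvolCondSym

end

noncomputable section

namespace EvolCondSym

/-! ### Jets of smooth functions -/

section JetOf

theorem dT_eq_fderiv {u : ℝ × ℝ → ℝ} {p : ℝ × ℝ} (hu : DifferentiableAt ℝ u p) :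
    dT u p = fderiv ℝ u p (1, 0) := by
  have h : HasDerivAt (fun s : ℝ => (s, p.2)) ((1 : ℝ), (0 : ℝ)) p.1 :=
    (hasDerivAt_id _).prodMk (hasDerivAt_const _ _)
  exact (HasFDerivAt.comp_hasDerivAt (f := fun s : ℝ => (s, p.2)) p.1 hu.hasFDerivAt h).deriv

theorem dX_eq_fderiv {u : ℝ × ℝ → ℝ} {p : ℝ × ℝ} (hu : DifferentiableAt ℝ u p) :
    dX u p = fderiv ℝ u p (0, 1) := by
  have h : HasDerivAt (fun s : ℝ => (p.1, s)) ((0 : ℝ), (1 : ℝ)) p.2 :=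
    (hasDerivAt_const _ _).prodMk (hasDerivAt_id _)
  exact (HasFDerivAt.comp_hasDerivAt (f := fun s : ℝ => (p.1, s)) p.2 hu.hasFDerivAt h).deriv

variable {A : Set (ℝ × ℝ)} {u u' : ℝ × ℝ → ℝ}

theorem dT_congr (hA : IsOpen A) (h : Set.EqOn u u' A) : Set.EqOn (dT u) (dT u') A := by
  intro p hp
  have hc : Continuous fun s : ℝ => (s, p.2) := by fun_prop
  refine Filter.EventuallyEq.deriv_eq ?_
  filter_upwards [hc.continuousAt.eventually (hA.mem_nhds hp)] with s hs using h hs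

theorem dX_congr (hA : IsOpen A) (h : Set.EqOn u u' A) : Set.EqOn (dX u) (dX u') A := by
  intro p hp
  have hc : Continuous fun s : ℝ => (p.1, s) := by fun_prop
  refine Filter.EventuallyEq.deriv_eq ?_
  filter_upwards [hc.continuousAt.eventually (hA.mem_nhds hp)] with s hs using h hs

theorem dX_iterate_congr (hA : IsOpen A) (h : Set.EqOn u u' A) (b : ℕ) :
    Set.EqOn (dX^[b] u) (dX^[b] u') A := by
  induction b with
  | zero => exact h
  | succ b ih =>
    simp only [Function.iterate_succ_apply']
    exact dX_congr hA ih

theorem differentiableAt_of_contDiffOn {E G : Type} [NormedAddCommGroup E] [NormedSpace ℝ E]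
    [NormedAddCommGroup G] [NormedSpace ℝ G] {A : Set E} {u : E → G} (hA : IsOpen A)
    (hu : ContDiffOn ℝ ∞ u A) {p : E} (hp : p ∈ A) : DifferentiableAt ℝ u p :=
  (hu.contDiffAt (hA.mem_nhds hp)).differentiableAt (by simp)

theorem contDiffOn_fderiv_apply {E G : Type} [NormedAddCommGroup E] [NormedSpace ℝ E]
    [NormedAddCommGroup G] [NormedSpace ℝ G] {A : Set E} {u : E → G} (hA : IsOpen A)
    (hu : ContDiffOn ℝ ∞ u A) {ξ : E → E} (hξ : ContDiffOn ℝ ∞ ξ A) :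
    ContDiffOn ℝ ∞ (fun p => fderiv ℝ u p (ξ p)) A :=
  (hu.fderiv_of_isOpen (m := ∞) hA (by simp)).clm_apply hξ

theorem contDiffOn_dT (hA : IsOpen A) (hu : ContDiffOn ℝ ∞ u A) : ContDiffOn ℝ ∞ (dT u) A :=
  (contDiffOn_fderiv_apply hA hu contDiffOn_const).congr
    fun _ hp => dT_eq_fderiv (differentiableAt_of_contDiffOn hA hu hp)

theorem contDiffOn_dX (hA : IsOpen A) (hu : ContDiffOn ℝ ∞ u A) : ContDiffOn ℝ ∞ (dX u) A :=
  (contDiffOn_fderiv_apply hA hu contDiffOn_const).congr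
    fun _ hp => dX_eq_fderiv (differentiableAt_of_contDiffOn hA hu hp)

theorem contDiffOn_dT_iterate (hA : IsOpen A) (hu : ContDiffOn ℝ ∞ u A) (a : ℕ) :
    ContDiffOn ℝ ∞ (dT^[a] u) A := by
  induction a with
  | zero => exact hu
  | succ a ih =>
    rw [Function.iterate_succ_apply']
    exact contDiffOn_dT hA ih

theorem contDiffOn_dX_iterate (hA : IsOpen A) (hu : ContDiffOn ℝ ∞ u A) (b : ℕ) :
    ContDiffOn ℝ ∞ (dX^[b] u) A := by
  induction b with
  | zero => exact hu
  | succ b ih =>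
    rw [Function.iterate_succ_apply']
    exact contDiffOn_dX hA ih

theorem contDiffOn_jetOf (hA : IsOpen A) (hu : ContDiffOn ℝ ∞ u A) (α : ℕ × ℕ) :
    ContDiffOn ℝ ∞ (fun p => (jetOf u p).2 α) A :=
  contDiffOn_dT_iterate hA (contDiffOn_dX_iterate hA hu _) _

/-- Since `jetOf` applies `dX` before `dT`, a further t-derivative shifts the index by definition,
whereas a further x-derivative needs symmetry of second derivatives. -/
theorem dX_dT (hA : IsOpen A) (hu : ContDiffOn ℝ ∞ u A) :
    Set.EqOn (dX (dT u)) (dT (dX u)) A := by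
  intro p hp
  have hd : DifferentiableAt ℝ (fderiv ℝ u) p :=
    differentiableAt_of_contDiffOn hA (hu.fderiv_of_isOpen (m := ∞) hA (by simp)) hp
  have h1 : Set.EqOn (dT u) (fun p => fderiv ℝ u p (1, 0)) A := fun p hp =>
    dT_eq_fderiv (differentiableAt_of_contDiffOn hA hu hp)
  have h2 : Set.EqOn (dX u) (fun p => fderiv ℝ u p (0, 1)) A := fun p hp =>
    dX_eq_fderiv (differentiableAt_of_contDiffOn hA hu hp)
  have hsymm : IsSymmSndFDerivAt ℝ u p :=
    (hu.contDiffAt (hA.mem_nhds hp)).isSymmSndFDerivAt (by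
      simpa using WithTop.coe_le_coe.2 (le_top : (2 : ℕ∞) ≤ ⊤))
  rw [dX_congr hA h1 hp, dT_congr hA h2 hp, dX_eq_fderiv (hd.clm_apply (by fun_prop)),
    dT_eq_fderiv (hd.clm_apply (by fun_prop))]
  simp only [fderiv_clm_apply hd (differentiableAt_const _)]
  simpa using hsymm.eq (0, 1) (1, 0)

theorem dX_dT_iterate (hA : IsOpen A) (hu : ContDiffOn ℝ ∞ u A) (a : ℕ) :
    Set.EqOn (dX (dT^[a] u)) (dT^[a] (dX u)) A := by
  induction a with
  | zero => exact fun _ _ => rfl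
  | succ a ih =>
    intro p hp
    rw [Function.iterate_succ_apply', Function.iterate_succ_apply',
      dX_dT hA (contDiffOn_dT_iterate hA hu a) hp]
    exact dT_congr hA ih hp

theorem dT_jetOf (α : ℕ × ℕ) (p : ℝ × ℝ) :
    dT (fun p => (jetOf u p).2 α) p = (jetOf u p).2 (α.1 + 1, α.2) := by
  simp only [jetOf, Function.iterate_succ_apply']

theorem dX_jetOf (hA : IsOpen A) (hu : ContDiffOn ℝ ∞ u A) (α : ℕ × ℕ) {p : ℝ × ℝ} (hp : p ∈ A) :
    dX (fun p => (jetOf u p).2 α) p = (jetOf u p).2 (α.1, α.2 + 1) := by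
  simp only [jetOf, Function.iterate_succ_apply']
  exact dX_dT_iterate hA (contDiffOn_dX_iterate hA hu _) _ hp

variable {D : Set Jet} {S : Set (ℕ × ℕ)} {F : Jet → ℝ}

theorem hasFDerivAt_jetOf (hA : IsOpen A) (hu : ContDiffOn ℝ ∞ u A) {p : ℝ × ℝ} (hp : p ∈ A)
    (α : ℕ × ℕ) : HasFDerivAt (fun p => (jetOf u p).2 α)
      (fderiv ℝ (fun p => (jetOf u p).2 α) p) p :=
  (differentiableAt_of_contDiffOn hA (contDiffOn_jetOf hA hu α) hp).hasFDerivAt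

theorem SmoothJetFun.dT_comp_jetOf (hF : SmoothJetFun D S F) (hD : IsOpen D) (hA : IsOpen A)
    (hu : ContDiffOn ℝ ∞ u A) {p : ℝ × ℝ} (hp : p ∈ A) (hpD : jetOf u p ∈ D) :
    dT (fun p => F (jetOf u p)) p = EvolCondSym.totalT F (jetOf u p) := by
  have h0 : HasFDerivAt (fun p => (jetOf u p).1) (ContinuousLinearMap.id ℝ (ℝ × ℝ)) p :=
    hasFDerivAt_id p
  have hL := hasFDerivAt_jetOf hA hu hp
  rw [dT_eq_fderiv (hF.differentiableAt_comp hD hpD h0.differentiableAt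
    fun α => (hL α).differentiableAt)]
  refine hF.fderiv_comp_totalT hD hpD h0 hL rfl fun α _ => ?_
  rw [← dT_eq_fderiv (hL α).differentiableAt, dT_jetOf]

theorem SmoothJetFun.dX_comp_jetOf (hF : SmoothJetFun D S F) (hD : IsOpen D) (hA : IsOpen A)
    (hu : ContDiffOn ℝ ∞ u A) {p : ℝ × ℝ} (hp : p ∈ A) (hpD : jetOf u p ∈ D) :
    dX (fun p => F (jetOf u p)) p = EvolCondSym.totalX F (jetOf u p) := by
  have h0 : HasFDerivAt (fun p => (jetOf u p).1) (ContinuousLinearMap.id ℝ (ℝ × ℝ)) p :=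
    hasFDerivAt_id p
  have hL := hasFDerivAt_jetOf hA hu hp
  rw [dX_eq_fderiv (hF.differentiableAt_comp hD hpD h0.differentiableAt
    fun α => (hL α).differentiableAt)]
  refine hF.fderiv_comp_totalX hD hpD h0 hL rfl fun α _ => ?_
  rw [← dX_eq_fderiv (hL α).differentiableAt, dX_jetOf hA hu α hp]

theorem dX_zero : dX (fun _ => (0 : ℝ)) = fun _ => 0 := by
  funext p
  simp [dX]

theorem dT_zero : dT (fun _ => (0 : ℝ)) = fun _ => 0 := by
  funext p
  simp [dT]

/-- If a function on the jet space vanishes along the prolongation of `u`, so do all its total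
derivatives. -/
theorem SmoothJetFun.totalD_jetOf_eq_zero (hF : SmoothJetFun D S F) (hD : IsOpen D) (hA : IsOpen A)
    (hu : ContDiffOn ℝ ∞ u A) (hmem : ∀ p ∈ A, jetOf u p ∈ D) (h0 : ∀ p ∈ A, F (jetOf u p) = 0)
    (α : ℕ × ℕ) : ∀ p ∈ A, EvolCondSym.totalD α F (jetOf u p) = 0 := by
  have hX : ∀ b, SmoothJetFun D Set.univ (EvolCondSym.totalX^[b] F) ∧
      ∀ p ∈ A, EvolCondSym.totalX^[b] F (jetOf u p) = 0 := by
    intro b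
    induction b with
    | zero => exact ⟨hF.mono (Set.subset_univ _), h0⟩
    | succ b ih =>
      rw [Function.iterate_succ_apply']
      refine ⟨ih.1.totalX hD fun _ _ => ⟨trivial, trivial⟩, fun p hp => ?_⟩
      rw [← ih.1.dX_comp_jetOf hD hA hu hp (hmem p hp), dX_congr hA ih.2 hp, dX_zero]
  have hT : ∀ a, SmoothJetFun D Set.univ (EvolCondSym.totalT^[a] (EvolCondSym.totalX^[α.2] F)) ∧
      ∀ p ∈ A, EvolCondSym.totalT^[a] (EvolCondSym.totalX^[α.2] F) (jetOf u p) = 0 := by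
    intro a
    induction a with
    | zero => exact hX α.2
    | succ a ih =>
      rw [Function.iterate_succ_apply']
      refine ⟨ih.1.totalT hD fun _ _ => ⟨trivial, trivial⟩, fun p hp => ?_⟩
      rw [← ih.1.dT_comp_jetOf hD hA hu hp (hmem p hp), dT_congr hA ih.2 hp, dT_zero]
  exact (hT α.1).2

variable {ρ : ℕ} {𝓔 : EvolutionEquation} {Q : ReducedOperator ρ}

theorem EvolutionEquation.smoothJetFun_E (𝓔 : EvolutionEquation) :
    SmoothJetFun 𝓔.jets Set.univ 𝓔.E :=
  𝓔.smoothJetFun_rhs.coord_sub (1, 0)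

theorem IsInvariantSolutionOn.mem_consequences (hA : IsOpen A) (hu : ContDiffOn ℝ ∞ u A)
    (h : IsInvariantSolutionOn 𝓔 Q u A) {p : ℝ × ℝ} (hp : p ∈ A) :
    jetOf u p ∈ consequences 𝓔 Q :=
  ⟨(h p hp).1, fun α => 𝓔.smoothJetFun_E.totalD_jetOf_eq_zero 𝓔.isOpen_jets hA hu
    (fun p hp => (h p hp).1.1) (fun p hp => (h p hp).2.1) α p hp,
    fun k => Q.smoothJetFun_char.totalD_jetOf_eq_zero Q.isOpen_jets hA hu
    (fun p hp => (h p hp).1.2) (fun p hp => (h p hp).2.2) (0, k) p hp⟩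

/-- Since η vanishes along the solution on an open set, all D_t^a D_x^b η vanish on its jets, not
only those with a = 0. -/
theorem IsInvariantSolutionOn.prolong_eq_zero (hA : IsOpen A) (hu : ContDiffOn ℝ ∞ u A)
    (h : IsInvariantSolutionOn 𝓔 Q u A) {p : ℝ × ℝ} (hp : p ∈ A) :
    Q.prolong 𝓔.r 𝓔.E (jetOf u p) = 0 :=
  Finset.sum_eq_zero fun _ _ => Finset.sum_eq_zero fun α _ => by
    rw [Q.smoothJetFun_char.totalD_jetOf_eq_zero Q.isOpen_jets hA hu
      (fun p hp => (h p hp).1.2) (fun p hp => (h p hp).2.2) α p hp, zero_mul]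

end JetOf

/-! ### Jets of families of functions -/

section Families

variable {K : Type} [NormedAddCommGroup K] [NormedSpace ℝ K] {U : Set ((ℝ × ℝ) × K)}
  {f f' : ℝ × ℝ → K → ℝ}

omit [NormedSpace ℝ K] in
theorem isOpen_slice (hU : IsOpen U) (y : K) : IsOpen {p | (p, y) ∈ U} :=
  hU.preimage (by fun_prop)

theorem contDiffOn_slice (hf : ContDiffOn ℝ ∞ (fun q : (ℝ × ℝ) × K => f q.1 q.2) U) (y : K) :
    ContDiffOn ℝ ∞ (fun p => f p y) {p | (p, y) ∈ U} :=
  ContDiffOn.comp (f := fun p : ℝ × ℝ => (p, y)) hf (ContDiff.contDiffOn (by fun_prop)) fun _ h => h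

theorem fderiv_slice (hU : IsOpen U) (hf : ContDiffOn ℝ ∞ (fun q : (ℝ × ℝ) × K => f q.1 q.2) U)
    {q : (ℝ × ℝ) × K} (hq : q ∈ U) (w : ℝ × ℝ) :
    fderiv ℝ (fun p => f p q.2) q.1 w =
      fderiv ℝ (fun q : (ℝ × ℝ) × K => f q.1 q.2) q (w, 0) := by
  have h := (differentiableAt_of_contDiffOn hU hf hq).hasFDerivAt
  have h1 : HasFDerivAt (fun p => f p q.2) _ q.1 :=
    HasFDerivAt.comp (f := fun p : ℝ × ℝ => (p, q.2)) q.1 h (hasFDerivAt_prodMk_left q.1 q.2)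
  rw [h1.fderiv]
  rfl

theorem contDiffOn_dT_family (hU : IsOpen U)
    (hf : ContDiffOn ℝ ∞ (fun q : (ℝ × ℝ) × K => f q.1 q.2) U) :
    ContDiffOn ℝ ∞ (fun q : (ℝ × ℝ) × K => dT (fun p => f p q.2) q.1) U :=
  (contDiffOn_fderiv_apply hU hf (contDiffOn_const (c := ((1, 0), 0)))).congr fun q hq => by
    rw [dT_eq_fderiv, fderiv_slice hU hf hq]
    exact differentiableAt_of_contDiffOn (isOpen_slice hU q.2) (contDiffOn_slice hf q.2) hq

theorem contDiffOn_dX_family (hU : IsOpen U)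
    (hf : ContDiffOn ℝ ∞ (fun q : (ℝ × ℝ) × K => f q.1 q.2) U) :
    ContDiffOn ℝ ∞ (fun q : (ℝ × ℝ) × K => dX (fun p => f p q.2) q.1) U :=
  (contDiffOn_fderiv_apply hU hf (contDiffOn_const (c := ((0, 1), 0)))).congr fun q hq => by
    rw [dX_eq_fderiv, fderiv_slice hU hf hq]
    exact differentiableAt_of_contDiffOn (isOpen_slice hU q.2) (contDiffOn_slice hf q.2) hq

theorem contDiffOn_dX_iterate_family (hU : IsOpen U)
    (hf : ContDiffOn ℝ ∞ (fun q : (ℝ × ℝ) × K => f q.1 q.2) U) (b : ℕ) :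
    ContDiffOn ℝ ∞ (fun q : (ℝ × ℝ) × K => (dX^[b] fun p => f p q.2) q.1) U := by
  induction b with
  | zero => exact hf
  | succ b ih =>
    simp only [Function.iterate_succ_apply']
    exact contDiffOn_dX_family (f := fun p y => (dX^[b] fun p => f p y) p) hU ih

theorem contDiffOn_jetOf_family (hU : IsOpen U)
    (hf : ContDiffOn ℝ ∞ (fun q : (ℝ × ℝ) × K => f q.1 q.2) U) (α : ℕ × ℕ) :
    ContDiffOn ℝ ∞ (fun q : (ℝ × ℝ) × K => (jetOf (fun p => f p q.2) q.1).2 α) U := by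
  simp only [jetOf]
  generalize α.1 = a
  induction a with
  | zero => exact contDiffOn_dX_iterate_family hU hf α.2
  | succ a ih =>
    simp only [Function.iterate_succ_apply']
    exact contDiffOn_dT_family (f := fun p y => (dT^[a] (dX^[α.2] fun p => f p y)) p) hU ih

theorem continuousOn_jetOf_family (hU : IsOpen U)
    (hf : ContDiffOn ℝ ∞ (fun q : (ℝ × ℝ) × K => f q.1 q.2) U) :
    ContinuousOn (fun q : (ℝ × ℝ) × K => jetOf (fun p => f p q.2) q.1) U :=
  continuousOn_fst.prodMk
    (continuousOn_pi.2 fun α => (contDiffOn_jetOf_family hU hf α).continuousOn)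

end Families

end EvolCondSym

end

noncomputable section

namespace EvolCondSym

/-! ### Local coordinates `t, x, u_0, …, u_{ρ-1}` on `𝓜` -/

section Chart

/-- The coordinates `((t, x), (u_0, …, u_{ρ-1}))`. -/
abbrev ChartSpace (ρ : ℕ) : Type := (ℝ × ℝ) × (Fin ρ → ℝ)

variable {ρ : ℕ}

/-- The coordinates `t, x, u_0, …, u_{ρ-1}` of a jet. -/
def toChart (ρ : ℕ) (j : Jet) : ChartSpace ρ := (j.1, fun k => j.2 (0, (k : ℕ)))

/-- Completion of `t, x, u_0, …, u_{ρ-1}` by a value of `u_ρ`. -/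
def addLast (a : ChartSpace ρ × ℝ) : XJet ρ := (a.1.1, Fin.snoc (α := fun _ => ℝ) a.1.2 a.2)

theorem continuous_toChart : Continuous (toChart ρ) := by
  unfold toChart
  fun_prop

theorem contDiff_addLast : ContDiff ℝ ∞ (addLast (ρ := ρ)) := by
  refine ContDiff.prodMk (by fun_prop) (contDiff_pi.2 fun k => ?_)
  induction k using Fin.lastCases with
  | last => simpa using contDiff_snd
  | cast k =>
    simp only [Fin.snoc_castSucc]
    fun_prop

theorem addLast_toChart (j : Jet) (s : ℝ) : addLast (toChart ρ j, s) =
    ((toXJet ρ j).1, Function.update (toXJet ρ j).2 (Fin.last ρ) s) := by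
  refine Prod.ext rfl (funext fun k => ?_)
  induction k using Fin.lastCases with
  | last => simp [addLast]
  | cast k => simp [addLast, toChart, toXJet]

theorem addLast_toChart_self (j : Jet) : addLast (toChart ρ j, j.2 (0, ρ)) = toXJet ρ j := by
  rw [addLast_toChart]
  refine Prod.ext rfl ?_
  simp [toXJet]

/-- The coordinates `u_0, …, u_ρ` of the point of the hypersurface `u_ρ = θ` over `z`. -/
def graphCoord (θ : ChartSpace ρ → ℝ) (z : ChartSpace ρ) : Fin (ρ + 1) → ℝ := (addLast (z, θ z)).2

theorem graphCoord_castSucc (θ : ChartSpace ρ → ℝ) (z : ChartSpace ρ) (k : Fin ρ) :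
    graphCoord θ z k.castSucc = z.2 k := by
  simp [graphCoord, addLast]

theorem graphCoord_last (θ : ChartSpace ρ → ℝ) (z : ChartSpace ρ) :
    graphCoord θ z (Fin.last ρ) = θ z := by
  simp [graphCoord, addLast]

/-- The total derivative with respect to `x` in the coordinates `t, x, u_0, …, u_{ρ-1}` of the
hypersurface `u_ρ = θ`, as a vector field. -/
def xField (θ : ChartSpace ρ → ℝ) (z : ChartSpace ρ) : ChartSpace ρ :=
  ((0, 1), fun k => graphCoord θ z k.succ)

/-- The derivative along `xField θ`. -/
def lieX (θ : ChartSpace ρ → ℝ) (g : ChartSpace ρ → ℝ) (z : ChartSpace ρ) : ℝ :=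
  fderiv ℝ g z (xField θ z)

/-- The coordinate `u_k` on the hypersurface given by `u_ρ = θ` and its derivatives with respect
to `x`. -/
def xCoord (θ : ChartSpace ρ → ℝ) (k : ℕ) : ChartSpace ρ → ℝ :=
  (lieX θ)^[k] fun z => graphCoord θ z 0

/-- The point over `z` of the hypersurface given by `u_ρ = θ` and its derivatives with respect
to `x`. -/
def xLift (θ : ChartSpace ρ → ℝ) (z : ChartSpace ρ) : (ℝ × ℝ) × (ℕ → ℝ) :=
  (z.1, fun k => xCoord θ k z)

variable (𝓔 : EvolutionEquation)

/-- The right-hand side of the evolution equation in local coordinates. -/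
def chartRhs (θ : ChartSpace ρ → ℝ) (z : ChartSpace ρ) : ℝ :=
  𝓔.H (z.1, fun k : Fin (𝓔.r + 1) => xCoord θ k z)

/-- The value of `∂u_k/∂t` prescribed by the evolution equation, in local coordinates. -/
def tCoord (θ : ChartSpace ρ → ℝ) (k : ℕ) : ChartSpace ρ → ℝ := (lieX θ)^[k] (chartRhs 𝓔 θ)

/-- The total derivative with respect to `t` in local coordinates, as a vector field. -/
def tField (θ : ChartSpace ρ → ℝ) (z : ChartSpace ρ) : ChartSpace ρ :=
  ((1, 0), fun k => tCoord 𝓔 θ k z)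

variable {𝓔} {N : Set (ChartSpace ρ)} {θ g g' : ChartSpace ρ → ℝ}

theorem contDiffOn_graphCoord (hθ : ContDiffOn ℝ ∞ θ N) (k : Fin (ρ + 1)) :
    ContDiffOn ℝ ∞ (fun z => graphCoord θ z k) N := by
  have h : ContDiffOn ℝ ∞ (fun z => addLast (z, θ z)) N :=
    contDiff_addLast.comp_contDiffOn (contDiffOn_id.prodMk hθ)
  exact (contDiff_apply ℝ ℝ k).comp_contDiffOn (contDiff_snd.comp_contDiffOn h)

theorem contDiffOn_xField (hθ : ContDiffOn ℝ ∞ θ N) : ContDiffOn ℝ ∞ (xField θ) N :=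
  contDiffOn_const.prodMk (contDiffOn_pi.2 fun k => contDiffOn_graphCoord hθ k.succ)

theorem contDiffOn_lieX (hN : IsOpen N) (hθ : ContDiffOn ℝ ∞ θ N) (hg : ContDiffOn ℝ ∞ g N) :
    ContDiffOn ℝ ∞ (lieX θ g) N :=
  contDiffOn_fderiv_apply hN hg (contDiffOn_xField hθ)

theorem contDiffOn_lieX_iterate (hN : IsOpen N) (hθ : ContDiffOn ℝ ∞ θ N)
    (hg : ContDiffOn ℝ ∞ g N) (k : ℕ) : ContDiffOn ℝ ∞ ((lieX θ)^[k] g) N := by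
  induction k with
  | zero => exact hg
  | succ k ih =>
    rw [Function.iterate_succ_apply']
    exact contDiffOn_lieX hN hθ ih

theorem fderiv_congr_of_eqOn {E G : Type} [NormedAddCommGroup E] [NormedSpace ℝ E]
    [NormedAddCommGroup G] [NormedSpace ℝ G] {N : Set E} {g g' : E → G} (hN : IsOpen N)
    (h : Set.EqOn g g' N) {z : E} (hz : z ∈ N) : fderiv ℝ g z = fderiv ℝ g' z :=
  (h.eventuallyEq_of_mem (hN.mem_nhds hz)).fderiv_eq

theorem lieX_congr (hN : IsOpen N) (h : Set.EqOn g g' N) : Set.EqOn (lieX θ g) (lieX θ g') N :=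
  fun z hz => by rw [lieX, lieX, fderiv_congr_of_eqOn hN h hz]

theorem contDiffOn_xCoord (hN : IsOpen N) (hθ : ContDiffOn ℝ ∞ θ N) (k : ℕ) :
    ContDiffOn ℝ ∞ (xCoord θ k) N :=
  contDiffOn_lieX_iterate hN hθ (contDiffOn_graphCoord hθ 0) k

theorem xCoord_succ (k : ℕ) : xCoord θ (k + 1) = lieX θ (xCoord θ k) :=
  Function.iterate_succ_apply' _ _ _

theorem tCoord_succ (k : ℕ) : tCoord 𝓔 θ (k + 1) = lieX θ (tCoord 𝓔 θ k) :=
  Function.iterate_succ_apply' _ _ _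

theorem fderiv_coord (z w : ChartSpace ρ) (k : Fin ρ) :
    fderiv ℝ (fun z : ChartSpace ρ => z.2 k) z w = w.2 k := by
  have h := (ContinuousLinearMap.proj (R := ℝ) (φ := fun _ : Fin ρ => ℝ) k ∘L
    ContinuousLinearMap.snd ℝ (ℝ × ℝ) (Fin ρ → ℝ)).hasFDerivAt (x := z)
  have h' : HasFDerivAt (fun z : ChartSpace ρ => z.2 k) _ z := h
  rw [h'.fderiv]
  rfl

/-- The field `xField` sends each u_k with k < ρ to its successor, which is θ when k + 1 = ρ.
Indexing by `Fin (ρ + 1)` also covers ρ = 0, where u_0 = θ. -/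
theorem xCoord_eq_graphCoord (hN : IsOpen N) (k : Fin (ρ + 1)) :
    Set.EqOn (xCoord θ k) (fun z => graphCoord θ z k) N := by
  induction k using Fin.induction with
  | zero => exact fun _ _ => rfl
  | succ k ih =>
    intro z hz
    rw [Fin.val_succ, xCoord_succ]
    have ih' : Set.EqOn (xCoord θ k) (fun z => z.2 k) N := fun z hz =>
      (ih hz).trans (graphCoord_castSucc θ z k)
    rw [lieX_congr hN ih' hz, lieX, fderiv_coord]
    rfl

theorem xCoord_eq_coord (hN : IsOpen N) (k : Fin ρ) {z : ChartSpace ρ} (hz : z ∈ N) :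
    xCoord θ k z = z.2 k := by
  rw [← graphCoord_castSucc θ z k]
  exact xCoord_eq_graphCoord hN k.castSucc hz

theorem xCoord_eq_last (hN : IsOpen N) {z : ChartSpace ρ} (hz : z ∈ N) : xCoord θ ρ z = θ z := by
  rw [← graphCoord_last θ z]
  exact xCoord_eq_graphCoord hN (Fin.last ρ) hz

theorem toXJet_lift_xLift (hN : IsOpen N) {z : ChartSpace ρ} (hz : z ∈ N) :
    toXJet ρ (𝓔.lift (xLift θ z)) = addLast (z, θ z) := by
  rw [𝓔.toXJet_lift]
  exact Prod.ext rfl (funext fun k => xCoord_eq_graphCoord hN k hz)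

theorem toXJet_liftAux_xLift (hN : IsOpen N) {z : ChartSpace ρ} (hz : z ∈ N) :
    toXJet ρ (𝓔.liftAux 0 (xLift θ z)) = addLast (z, θ z) := by
  rw [𝓔.toXJet_liftAux, ← 𝓔.toXJet_lift, toXJet_lift_xLift hN hz]

variable {D : Set Jet} {F : Jet → ℝ} {n : ℕ}

/-- Functions of x-derivatives do not see the other coordinates, so `liftAux 0`, where those are
zero, can replace the full lift and makes differentiability immediate. -/
theorem SmoothJetFun.lieX_comp_xLift (hF : SmoothJetFun D (xIndices n) F) (hD : IsOpen D)
    (hN : IsOpen N) (hθ : ContDiffOn ℝ ∞ θ N) {z : ChartSpace ρ} (hz : z ∈ N)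
    (hzD : 𝓔.liftAux 0 (xLift θ z) ∈ D) :
    lieX θ (fun z => F (𝓔.liftAux 0 (xLift θ z))) z =
      EvolCondSym.totalX F (𝓔.liftAux 0 (xLift θ z)) := by
  have h0 : HasFDerivAt (fun z => (𝓔.liftAux 0 (xLift θ z)).1)
      (ContinuousLinearMap.fst ℝ (ℝ × ℝ) (Fin ρ → ℝ)) z := hasFDerivAt_fst
  have hL : ∀ α : ℕ × ℕ, HasFDerivAt (fun z => (𝓔.liftAux 0 (xLift θ z)).2 α)
      (if α.1 = 0 then fderiv ℝ (xCoord θ α.2) z else 0) z := by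
    intro α
    by_cases h : α.1 = 0
    · simp only [EvolutionEquation.liftAux, h, if_true]
      exact (differentiableAt_of_contDiffOn hN (contDiffOn_xCoord hN hθ α.2) hz).hasFDerivAt
    · simp only [EvolutionEquation.liftAux, h, if_false]
      exact hasFDerivAt_const _ _
  refine hF.fderiv_comp_totalX (Φ := fun z => 𝓔.liftAux 0 (xLift θ z)) hD hzD h0 hL
    (w := xField θ z) rfl ?_
  rintro ⟨a, b⟩ ⟨h, -⟩
  obtain rfl : a = 0 := h
  simp only [if_true, 𝓔.liftAux_x]
  exact (congrFun (xCoord_succ b) z).symm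

theorem SmoothJetFun.iterate_lieX_comp_xLift (hF : SmoothJetFun D (xIndices n) F) (hD : IsOpen D)
    (hN : IsOpen N) (hθ : ContDiffOn ℝ ∞ θ N) (hzD : ∀ z ∈ N, 𝓔.liftAux 0 (xLift θ z) ∈ D) (k : ℕ) :
    Set.EqOn ((lieX θ)^[k] (fun z => F (𝓔.liftAux 0 (xLift θ z))))
      (fun z => EvolCondSym.totalX^[k] F (𝓔.liftAux 0 (xLift θ z))) N := by
  induction k with
  | zero => exact fun _ _ => rfl
  | succ k ih =>
    intro z hz
    simp only [Function.iterate_succ_apply']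
    rw [lieX_congr hN ih hz]
    exact (hF.iterate_totalX hD k).lieX_comp_xLift hD hN hθ hz (hzD z hz)

variable {Q : ReducedOperator ρ}

/-- On the hypersurface u_ρ = θ the function η vanishes identically in the chart variables, hence so
do its repeated derivatives along `xField`, which are the values of D_x^k η. -/
theorem iterate_totalX_char_liftAux (hN : IsOpen N) (hθ : ContDiffOn ℝ ∞ θ N)
    (hQ : ∀ z ∈ N, addLast (z, θ z) ∈ Q.dom ∧ Q.η (addLast (z, θ z)) = 0) (k : ℕ) :
    ∀ z ∈ N, totalX^[k] Q.char (𝓔.liftAux 0 (xLift θ z)) = 0 := by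
  intro z hz
  have hmem : ∀ z ∈ N, 𝓔.liftAux 0 (xLift θ z) ∈ Q.jets := fun z hz => by
    rw [ReducedOperator.jets, Set.mem_preimage, toXJet_liftAux_xLift hN hz]
    exact (hQ z hz).1
  have h0 : Set.EqOn (fun z => Q.char (𝓔.liftAux 0 (xLift θ z))) (fun _ => 0) N := fun z hz => by
    simp only [ReducedOperator.char, toXJet_liftAux_xLift hN hz, (hQ z hz).2]
  have hz0 : ∀ k, Set.EqOn ((lieX θ)^[k] fun z => Q.char (𝓔.liftAux 0 (xLift θ z)))
      (fun _ => 0) N := by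
    intro k
    induction k with
    | zero => exact h0
    | succ k ih =>
      intro z hz
      rw [Function.iterate_succ_apply', lieX_congr hN ih hz]
      simp [lieX]
  exact (Q.smoothJetFun_char.iterate_lieX_comp_xLift Q.isOpen_jets hN hθ hmem k hz).symm.trans
    (hz0 k hz)

variable (𝓔 Q)

/-- `θ`, smooth on the open set `N`, describes the equation `η = 0` as `u_ρ = θ`, and the evolution
equation is defined over the corresponding jets. -/
structure IsChart (θ : ChartSpace ρ → ℝ) (N : Set (ChartSpace ρ)) : Prop where
  isOpen : IsOpen N
  smooth : ContDiffOn ℝ ∞ θ N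
  op : ∀ z ∈ N, addLast (z, θ z) ∈ Q.dom ∧ Q.η (addLast (z, θ z)) = 0
  eq : ∀ z ∈ N, 𝓔.lift (xLift θ z) ∈ 𝓔.jets

variable {𝓔 Q}

/-- The equation `η = 0` can be solved with respect to `u_ρ` near each of its solutions. -/
theorem exists_implicit_function {j : Jet} (hj : j ∈ Q.jets) (h0 : Q.char j = 0) :
    ∃ (θ : ChartSpace ρ → ℝ) (N : Set (ChartSpace ρ)) (O : Set (ChartSpace ρ × ℝ)),
      IsOpen N ∧ toChart ρ j ∈ N ∧ ContDiffOn ℝ ∞ θ N ∧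
      (∀ z ∈ N, addLast (z, θ z) ∈ Q.dom ∧ Q.η (addLast (z, θ z)) = 0) ∧
      IsOpen O ∧ (toChart ρ j, j.2 (0, ρ)) ∈ O ∧
      ∀ a ∈ O, Q.η (addLast a) = 0 → a.2 = θ a.1 := by
  set a₀ : ChartSpace ρ × ℝ := (toChart ρ j, j.2 (0, ρ)) with ha₀
  have hadd : addLast a₀ = toXJet ρ j := addLast_toChart_self j
  set A : Set (ChartSpace ρ × ℝ) := addLast ⁻¹' Q.dom
  have hA : IsOpen A := Q.isOpen_dom.preimage contDiff_addLast.continuous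
  have ha₀A : a₀ ∈ A := by
    rw [Set.mem_preimage, hadd]
    exact hj
  let g : ChartSpace ρ × ℝ → ℝ := fun a => Q.η (addLast a)
  have hg : ContDiffOn ℝ ∞ g A := Q.smooth.comp contDiff_addLast.contDiffOn fun _ h => h
  have hgd : HasFDerivAt g (fderiv ℝ g a₀) a₀ :=
    (differentiableAt_of_contDiffOn hA hg ha₀A).hasFDerivAt
  set M := fderiv ℝ g a₀
  set d : ℝ := M (0, 1) with hd_def
  have hd : d ≠ 0 := by
    have h1 : HasDerivAt (fun s : ℝ => (toChart ρ j, s)) ((0 : ChartSpace ρ), (1 : ℝ)) (j.2 (0, ρ)) :=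
      (hasDerivAt_const _ _).prodMk (hasDerivAt_id _)
    have h2 := (HasFDerivAt.comp_hasDerivAt (f := fun s : ℝ => (toChart ρ j, s)) (j.2 (0, ρ))
      hgd h1).deriv
    have h3 := Q.maximal_rank _ hj h0
    simp only [← addLast_toChart] at h3
    rw [hd_def, ← h2]
    exact h3
  have hM : ∀ z s, M (z, s) = M (z, 0) + s * d := by
    intro z s
    have : ((z, s) : ChartSpace ρ × ℝ) = (z, 0) + s • (0, 1) := by simp
    rw [this, map_add, map_smul, smul_eq_mul]
  -- Derivative of (z, s) ↦ (z, η(z, s)), triangular with the nonzero diagonal entry d = ∂η/∂u_ρ.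
  -- The local inverse at (z, 0) yields θ(z), and its injectivity yields uniqueness on O.
  let T : ChartSpace ρ × ℝ →L[ℝ] ChartSpace ρ × ℝ := (ContinuousLinearMap.fst ℝ _ _).prod M
  let T' : ChartSpace ρ × ℝ →L[ℝ] ChartSpace ρ × ℝ := (ContinuousLinearMap.fst ℝ _ _).prod
    (d⁻¹ • (ContinuousLinearMap.snd ℝ _ _ -
      M ∘L (ContinuousLinearMap.inl ℝ _ _) ∘L (ContinuousLinearMap.fst ℝ _ _)))
  have hT : ∀ z s, T (z, s) = (z, M (z, s)) := fun _ _ => rfl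
  have hT' : ∀ z s, T' (z, s) = (z, d⁻¹ * (s - M (z, 0))) := fun _ _ => rfl
  let e' : (ChartSpace ρ × ℝ) ≃L[ℝ] (ChartSpace ρ × ℝ) :=
    ContinuousLinearEquiv.equivOfInverse T T'
      (by
        rintro ⟨z, s⟩
        rw [hT, hT', hM z s]
        congr 1
        field_simp
        ring)
      (by
        rintro ⟨z, s⟩
        rw [hT', hT, hM]
        congr 1
        field_simp
        ring)
  have he' : HasFDerivAt (fun a : ChartSpace ρ × ℝ => (a.1, g a)) (e' : _ →L[ℝ] _) a₀ :=
    HasFDerivAt.prodMk (hasFDerivAt_fst (𝕜 := ℝ) (p := a₀)) hgd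
  obtain ⟨e, ha₀e, heA, he, hsymm⟩ := exists_smooth_openPartialHomeomorph hA ha₀A
    (contDiffOn_fst.prodMk hg) e' he'
  have hι : ContDiff ℝ ∞ (fun z : ChartSpace ρ => (z, (0 : ℝ))) := by fun_prop
  have hfst : ∀ z, (z, (0 : ℝ)) ∈ e.target → (e.symm (z, 0)).1 = z ∧ g (e.symm (z, 0)) = 0 := by
    intro z hz
    have := e.right_inv hz
    rw [he] at this
    exact ⟨congrArg Prod.fst this, congrArg Prod.snd this⟩
  refine ⟨fun z => (e.symm (z, 0)).2, (fun z => (z, (0 : ℝ))) ⁻¹' e.target, e.source,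
    e.open_target.preimage hι.continuous, ?_, ?_, ?_, e.open_source, ha₀e, ?_⟩
  · have := e.map_source ha₀e
    rw [he] at this
    have hga : g a₀ = 0 := by
      simp only [g, hadd]
      exact h0
    rw [hga] at this
    exact this
  · exact contDiff_snd.comp_contDiffOn (hsymm.comp hι.contDiffOn fun _ h => h)
  · intro z hz
    obtain ⟨h1, h2⟩ := hfst z hz
    have h3 : (z, (e.symm (z, 0)).2) = e.symm (z, 0) := Prod.ext h1.symm rfl
    rw [h3]
    exact ⟨heA (e.map_target hz), h2⟩
  · intro a ha hη
    have h1 : e a = (a.1, 0) := by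
      rw [he]
      exact Prod.ext rfl hη
    show a.2 = (e.symm (a.1, 0)).2
    rw [← h1, e.left_inv ha]

/-- Existence of local coordinates near each jet in `𝓜`. -/
theorem exists_isChart {j : Jet} (hj : j ∈ consequences 𝓔 Q) :
    ∃ (θ : ChartSpace ρ → ℝ) (N : Set (ChartSpace ρ)) (O : Set (ChartSpace ρ × ℝ)),
      IsChart 𝓔 Q θ N ∧ toChart ρ j ∈ N ∧ (∀ k, xCoord θ k (toChart ρ j) = j.2 (0, k)) ∧
      IsOpen O ∧ (toChart ρ j, j.2 (0, ρ)) ∈ O ∧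
      ∀ a ∈ O, Q.η (addLast a) = 0 → a.2 = θ a.1 := by
  obtain ⟨hjE, hjQ⟩ := mem_jets_of_mem_consequences hj
  obtain ⟨θ, N, O, hN, hjN, hθ, hop, hO, hjO, huniq⟩ :=
    exists_implicit_function hjQ (hj.2.2 0)
  have hx : ∀ k, xCoord θ k (toChart ρ j) = j.2 (0, k) := by
    intro k
    have hmem : 𝓔.liftAux 0 (xLift θ (toChart ρ j)) ∈ Q.jets := by
      rw [ReducedOperator.jets, Set.mem_preimage, toXJet_liftAux_xLift hN hjN]
      exact (hop _ hjN).1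
    have hlast : j.2 (0, ρ) = θ (toChart ρ j) := huniq _ hjO (by
      rw [addLast_toChart_self]
      exact hj.2.2 0)
    have h := Q.smoothJetFun_char.x_coords_unique Q.isOpen_jets hjQ hmem hj.2.2
      (fun k => iterate_totalX_char_liftAux hN hθ hop k _ hjN)
      (Q.partialU_char_ne_zero hjQ (hj.2.2 0)) rfl (fun k hk => by
        rw [𝓔.liftAux_x]
        rcases hk.lt_or_eq with hlt | rfl
        · exact xCoord_eq_coord hN ⟨k, hlt⟩ hjN
        · rw [hlast]
          exact xCoord_eq_last hN hjN) k
    rwa [𝓔.liftAux_x] at h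
  -- The order r may exceed ρ, so H is evaluated at coordinates generated from θ; N is shrunk so
  -- that they stay in the domain of H.
  let X : ChartSpace ρ → XJet 𝓔.r := fun z => (z.1, fun k : Fin (𝓔.r + 1) => xCoord θ k z)
  have hX : ContinuousOn X N := continuousOn_fst.prodMk
    (continuousOn_pi.2 fun k => (contDiffOn_xCoord hN hθ k).continuousOn)
  have hN' : IsOpen (N ∩ X ⁻¹' 𝓔.dom) := hX.isOpen_inter_preimage hN 𝓔.isOpen_dom
  refine ⟨θ, N ∩ X ⁻¹' 𝓔.dom, O, ⟨hN', hθ.mono Set.inter_subset_left, fun z hz => hop z hz.1, ?_⟩,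
    ⟨hjN, ?_⟩, hx, hO, hjO, huniq⟩
  · intro z hz
    rw [EvolutionEquation.jets, Set.mem_preimage, 𝓔.toXJet_lift]
    exact hz.2
  · have : X (toChart ρ j) = toXJet 𝓔.r j := Prod.ext rfl (funext fun k => hx k)
    rw [Set.mem_preimage, this]
    exact hjE

end Chart

end EvolCondSym

end

noncomputable section

namespace EvolCondSym

/-! ### Nondegeneracy of families -/

section Families

variable {ρ : ℕ} {f : (ℝ × ℝ) → (Fin ρ → ℝ) → ℝ} {U : Set ((ℝ × ℝ) × (Fin ρ → ℝ))}

/-- The values of `f_0, …, f_{ρ-1}`, where `f_a = ∂^a f / ∂x^a`. -/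
def familyCoord (f : (ℝ × ℝ) → (Fin ρ → ℝ) → ℝ) (q : (ℝ × ℝ) × (Fin ρ → ℝ)) : Fin ρ → ℝ :=
  fun a => (dX^[(a : ℕ)] fun p => f p q.2) q.1

theorem contDiffOn_familyCoord (hU : IsOpen U)
    (hf : ContDiffOn ℝ ∞ (fun q : (ℝ × ℝ) × (Fin ρ → ℝ) => f q.1 q.2) U) :
    ContDiffOn ℝ ∞ (familyCoord f) U :=
  contDiffOn_pi.2 fun a => contDiffOn_dX_iterate_family hU hf a

theorem hasFDerivAt_familyCoord_param (hU : IsOpen U)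
    (hf : ContDiffOn ℝ ∞ (fun q : (ℝ × ℝ) × (Fin ρ → ℝ) => f q.1 q.2) U)
    {q : (ℝ × ℝ) × (Fin ρ → ℝ)} (hq : q ∈ U) :
    HasFDerivAt (fun y => familyCoord f (q.1, y))
      (fderiv ℝ (familyCoord f) q ∘L ContinuousLinearMap.inr ℝ (ℝ × ℝ) (Fin ρ → ℝ)) q.2 :=
  HasFDerivAt.comp (f := fun y : Fin ρ → ℝ => (q.1, y)) q.2
    (differentiableAt_of_contDiffOn hU (contDiffOn_familyCoord hU hf) hq).hasFDerivAt
    (hasFDerivAt_prodMk_right q.1 q.2)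

theorem paramDet_entry (hU : IsOpen U)
    (hf : ContDiffOn ℝ ∞ (fun q : (ℝ × ℝ) × (Fin ρ → ℝ) => f q.1 q.2) U)
    {q : (ℝ × ℝ) × (Fin ρ → ℝ)} (hq : q ∈ U) (a b : Fin ρ) :
    deriv (fun s => (dX^[(a : ℕ)] (fun p' => f p' (Function.update q.2 b s))) q.1) (q.2 b) =
      fderiv ℝ (familyCoord f) q (0, Pi.single b 1) a := by
  have h : HasFDerivAt (fun y => familyCoord f (q.1, y))
      (fderiv ℝ (familyCoord f) q ∘L ContinuousLinearMap.inr ℝ (ℝ × ℝ) (Fin ρ → ℝ))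
      (Function.update q.2 b (q.2 b)) := by
    rw [Function.update_eq_self]
    exact hasFDerivAt_familyCoord_param hU hf hq
  have h1 : HasDerivAt (fun s => Function.update q.2 b s) (Pi.single b (1 : ℝ)) (q.2 b) :=
    hasDerivAt_update q.2 b (q.2 b)
  have h2 : HasDerivAt (fun s => familyCoord f (q.1, Function.update q.2 b s))
      (fderiv ℝ (familyCoord f) q (0, Pi.single b 1)) (q.2 b) :=
    h.comp_hasDerivAt (q.2 b) h1
  exact (hasDerivAt_pi.1 h2 a).deriv

theorem paramDet_eq (hU : IsOpen U)
    (hf : ContDiffOn ℝ ∞ (fun q : (ℝ × ℝ) × (Fin ρ → ℝ) => f q.1 q.2) U)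
    {q : (ℝ × ℝ) × (Fin ρ → ℝ)} (hq : q ∈ U) :
    paramDet f q.1 q.2 =
      Matrix.det (Matrix.of fun a b => fderiv ℝ (familyCoord f) q (0, Pi.single b 1) a) := by
  rw [paramDet]
  congr 2
  funext a b
  exact paramDet_entry hU hf hq a b

theorem continuousOn_paramDet (hU : IsOpen U)
    (hf : ContDiffOn ℝ ∞ (fun q : (ℝ × ℝ) × (Fin ρ → ℝ) => f q.1 q.2) U) :
    ContinuousOn (fun q : (ℝ × ℝ) × (Fin ρ → ℝ) => paramDet f q.1 q.2) U := by
  refine ContinuousOn.congr (f := fun q => Matrix.det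
    (Matrix.of fun a b => fderiv ℝ (familyCoord f) q (0, Pi.single b 1) a)) ?_
    fun q hq => paramDet_eq hU hf hq
  refine (continuous_id.matrix_det).comp_continuousOn
    (continuousOn_pi.2 fun a => continuousOn_pi.2 fun b => ?_)
  exact (continuous_apply a).comp_continuousOn (contDiffOn_fderiv_apply hU
    (contDiffOn_familyCoord hU hf) (contDiffOn_const (c := (0, Pi.single b 1)))).continuousOn

theorem paramDet_ne_zero_iff (hU : IsOpen U)
    (hf : ContDiffOn ℝ ∞ (fun q : (ℝ × ℝ) × (Fin ρ → ℝ) => f q.1 q.2) U)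
    {q : (ℝ × ℝ) × (Fin ρ → ℝ)} (hq : q ∈ U) :
    paramDet f q.1 q.2 ≠ 0 ↔
      Function.Injective (fderiv ℝ (fun y => familyCoord f (q.1, y)) q.2) := by
  have hd := (hasFDerivAt_familyCoord_param hU hf hq).fderiv
  set A : (Fin ρ → ℝ) →ₗ[ℝ] (Fin ρ → ℝ) :=
    (fderiv ℝ (fun y => familyCoord f (q.1, y)) q.2).toLinearMap with hA
  have hdet : paramDet f q.1 q.2 = LinearMap.det A := by
    rw [paramDet_eq hU hf hq, ← LinearMap.det_toMatrix']
    congr 1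
    ext a b
    rw [LinearMap.toMatrix'_apply, hA, hd]
    simp [Pi.single]
  rw [hdet, ← isUnit_iff_ne_zero, ← LinearMap.isUnit_iff_isUnit_det, LinearMap.isUnit_iff_ker_eq_bot,
    LinearMap.ker_eq_bot]
  rfl

/-- The parameters of a nondegenerate family are essential. -/
theorem essentialOn_of_paramDet_ne_zero (hU : IsOpen U)
    (hf : ContDiffOn ℝ ∞ (fun q : (ℝ × ℝ) × (Fin ρ → ℝ) => f q.1 q.2) U)
    (hdet : ∀ q ∈ U, paramDet f q.1 q.2 ≠ 0) : EssentialOn f U := by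
  rintro U' hU'U hU' ⟨q, hq⟩ σ hσ ⟨ζ, V, g, hζ, hV, hg, hfg⟩
  have hinj := (paramDet_ne_zero_iff hU hf (hU'U hq)).1 (hdet q (hU'U hq))
  have himg : IsOpen (Prod.snd '' U') := isOpenMap_snd _ hU'
  have hζd := (differentiableAt_of_contDiffOn himg hζ ⟨q, hq, rfl⟩).hasFDerivAt
  -- A reduction of f passes to its x-derivatives, so the map y ↦ (f_0, …, f_{ρ-1}) factors through
  -- ζ; an injective derivative would then force ρ ≤ σ.
  let w : Fin ρ → (ℝ × ℝ) × (Fin σ → ℝ) → ℝ := fun a z => (dX^[(a : ℕ)] fun p => g (p, z.2)) z.1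
  have hw : ContDiffOn ℝ ∞ (fun z a => w a z) V := contDiffOn_pi.2 fun a =>
    contDiffOn_dX_iterate_family (f := fun p z => g (p, z)) hV hg a
  have heq : ∀ y ∈ {y | (q.1, y) ∈ U'}, familyCoord f (q.1, y) = fun a => w a (q.1, ζ y) := by
    intro y hy
    funext a
    exact dX_iterate_congr (isOpen_slice hU' y) (fun p hp => (hfg _ hp).2) a hy
  have hslice : IsOpen {y | (q.1, y) ∈ U'} := hU'.preimage (by fun_prop)
  have hwd := (differentiableAt_of_contDiffOn hV hw (hfg q hq).1).hasFDerivAt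
  have hcomp : HasFDerivAt (fun y => familyCoord f (q.1, y)) _ q.2 :=
    (HasFDerivAt.comp (f := fun y => (q.1, ζ y)) q.2 hwd
      ((hasFDerivAt_const q.1 q.2).prodMk hζd)).congr_of_eventuallyEq (by
        filter_upwards [hslice.mem_nhds hq] with y hy using heq y hy)
  rw [hcomp.fderiv] at hinj
  have hζinj : Function.Injective (fderiv ℝ ζ q.2 : (Fin ρ → ℝ) →ₗ[ℝ] (Fin σ → ℝ)) := by
    intro y y' hyy
    refine hinj ?_
    have : fderiv ℝ ζ q.2 y = fderiv ℝ ζ q.2 y' := hyy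
    simp [this]
  have := LinearMap.finrank_le_finrank_of_injective hζinj
  simp at this
  omega

end Families

end EvolCondSym

end

noncomputable section

namespace EvolCondSym

/-! ### The system in local coordinates -/

section ChartSystem

variable {ρ : ℕ} {𝓔 : EvolutionEquation} {Q : ReducedOperator ρ} {θ : ChartSpace ρ → ℝ}
  {N : Set (ChartSpace ρ)} {z : ChartSpace ρ}

theorem IsChart.mono (h : IsChart 𝓔 Q θ N) {N' : Set (ChartSpace ρ)} (hN' : IsOpen N')
    (hN : N' ⊆ N) : IsChart 𝓔 Q θ N' :=
  ⟨hN', h.smooth.mono hN, fun z hz => h.op z (hN hz), fun z hz => h.eq z (hN hz)⟩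

theorem IsChart.contDiffOn_chartRhs (h : IsChart 𝓔 Q θ N) : ContDiffOn ℝ ∞ (chartRhs 𝓔 θ) N := by
  refine 𝓔.smooth.comp (contDiffOn_fst.prodMk
    (contDiffOn_pi.2 fun k => contDiffOn_xCoord h.isOpen h.smooth k)) fun z hz => ?_
  have := h.eq z hz
  rw [EvolutionEquation.jets, Set.mem_preimage, 𝓔.toXJet_lift] at this
  exact this

theorem IsChart.contDiffOn_tCoord (h : IsChart 𝓔 Q θ N) (k : ℕ) :
    ContDiffOn ℝ ∞ (tCoord 𝓔 θ k) N :=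
  contDiffOn_lieX_iterate h.isOpen h.smooth h.contDiffOn_chartRhs k

theorem IsChart.mem_consequences (h : IsChart 𝓔 Q θ N) (hz : z ∈ N) :
    𝓔.lift (xLift θ z) ∈ consequences 𝓔 Q := by
  have hQ : 𝓔.lift (xLift θ z) ∈ Q.jets := by
    rw [ReducedOperator.jets, Set.mem_preimage, toXJet_lift_xLift h.isOpen hz]
    exact (h.op z hz).1
  have hQ' : 𝓔.liftAux 0 (xLift θ z) ∈ Q.jets := by
    rw [ReducedOperator.jets, Set.mem_preimage, toXJet_liftAux_xLift h.isOpen hz]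
    exact (h.op z hz).1
  refine ⟨⟨h.eq z hz, hQ⟩, 𝓔.totalD_E_lift (h.eq z hz), fun k => ?_⟩
  rw [← iterate_totalX_char_liftAux h.isOpen h.smooth h.op k z hz]
  exact (Q.smoothJetFun_char.iterate_totalX Q.isOpen_jets k).eq_of_agree hQ hQ' rfl
    fun α hα => (𝓔.liftAux_of_le hα.1.le _).symm

/-- Differentiating H along `xField` in the chart is the same as taking D_x on the lifted jets, so
u_{1,k} = D_x^k H is `tCoord`. -/
theorem IsChart.lift_apply_one (h : IsChart 𝓔 Q θ N) (hz : z ∈ N) (k : ℕ) :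
    (𝓔.lift (xLift θ z)).2 (1, k) = tCoord 𝓔 θ k z := by
  have hmem : ∀ z ∈ N, 𝓔.liftAux 0 (xLift θ z) ∈ 𝓔.jets := fun z hz =>
    𝓔.liftAux_mem_jets (h.eq z hz) 0
  have h1 := 𝓔.smoothJetFun_rhs.iterate_lieX_comp_xLift 𝓔.isOpen_jets h.isOpen h.smooth hmem k hz
  have h2 : (fun z => 𝓔.rhs (𝓔.liftAux 0 (xLift θ z))) = chartRhs 𝓔 θ := by
    funext z
    rw [EvolutionEquation.rhs, 𝓔.toXJet_liftAux]
    rfl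
  rw [h2] at h1
  rw [𝓔.lift_succ (h.eq z hz) 0 k, tCoord, h1]
  exact (𝓔.smoothJetFun_rhs.iterate_totalX 𝓔.isOpen_jets k).eq_of_agree (h.eq z hz) (hmem z hz) rfl
    fun α hα => (𝓔.liftAux_of_le hα.1.le _).symm

theorem IsChart.continuousOn_lift (h : IsChart 𝓔 Q θ N) :
    ContinuousOn (fun z => 𝓔.lift (xLift θ z)) N :=
  𝓔.continuousOn_lift.comp (continuousOn_fst.prodMk (continuousOn_pi.2 fun k =>
    (contDiffOn_xCoord h.isOpen h.smooth k).continuousOn)) h.eq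

/-- If `D_t η = 0` on `𝓜`, then the vector field `tField` maps each of the coordinates
`u_0, …, u_ρ` to the value prescribed by the evolution equation. -/
theorem IsChart.fderiv_graphCoord_tField (h : IsChart 𝓔 Q θ N) (hz : z ∈ N)
    (hT : totalT Q.char (𝓔.lift (xLift θ z)) = 0) (k : Fin (ρ + 1)) :
    fderiv ℝ (fun z => graphCoord θ z k) z (tField 𝓔 θ z) = tCoord 𝓔 θ k z := by
  have hcast : ∀ k : Fin ρ, fderiv ℝ (fun z => graphCoord θ z k.castSucc) z (tField 𝓔 θ z) =
      tCoord 𝓔 θ k z := by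
    intro k
    simp only [graphCoord_castSucc]
    rw [fderiv_coord]
    rfl
  induction k using Fin.lastCases with
  | cast k => exact hcast k
  | last =>
    set j := 𝓔.lift (xLift θ z) with hj_def
    have hj : j ∈ consequences 𝓔 Q := h.mem_consequences hz
    have hrep : Represents Q.jets Q.char (fun k : Fin (ρ + 1) => ((0, (k : ℕ)) : ℕ × ℕ)) Q.η Q.dom :=
      ⟨Q.isOpen_dom, by
        intro inst
        rw [Subsingleton.elim inst (Fin.fintype (ρ + 1))]
        exact Q.smooth, fun _ hj => hj, fun _ _ => rfl⟩
    have hco : jetCoords (fun k : Fin (ρ + 1) => ((0, (k : ℕ)) : ℕ × ℕ)) j = addLast (z, θ z) :=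
      toXJet_lift_xLift h.isOpen hz
    have h1 := hrep.totalT_eq Q.isOpen_jets hj.1.2
    have h2 := hrep.partialU_eq Q.isOpen_jets hj.1.2 (0, ρ)
    rw [hT, hco] at h1
    rw [hco] at h2
    have hG : HasFDerivAt Q.η (fderiv ℝ Q.η (addLast (z, θ z))) (addLast (z, θ z)) :=
      (differentiableAt_of_contDiffOn Q.isOpen_dom Q.smooth (h.op z hz).1).hasFDerivAt
    have hg : ∀ k, HasFDerivAt (fun z => graphCoord θ z k)
        (fderiv ℝ (fun z => graphCoord θ z k) z) z := fun k =>
      (differentiableAt_of_contDiffOn h.isOpen (contDiffOn_graphCoord h.smooth k) hz).hasFDerivAt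
    have hadd : HasFDerivAt (fun z => addLast (z, θ z)) _ z :=
      (hasFDerivAt_fst (𝕜 := ℝ) (p := z)).prodMk (hasFDerivAt_pi.2 hg)
    -- The identity η(z, θ(z)) = 0 is differentiated along `tField`. Compared with D_t η = 0, the
    -- direction differs only in the u_ρ entry, and that difference d is multiplied by ∂η/∂u_ρ ≠ 0.
    have h3 := ((hG.comp z hadd).congr_of_eventuallyEq (f₁ := fun _ => (0 : ℝ)) (by
      filter_upwards [h.isOpen.mem_nhds hz] with z' hz' using (h.op z' hz').2.symm)).unique
      (hasFDerivAt_const (0 : ℝ) z)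
    have h4 := congrArg (fun L => L (tField 𝓔 θ z)) h3
    simp only [ContinuousLinearMap.comp_apply, zero_apply] at h4
    set d := fderiv ℝ (fun z => graphCoord θ z (Fin.last ρ)) z (tField 𝓔 θ z) -
      tCoord 𝓔 θ (Fin.last ρ : Fin (ρ + 1)) z with hd
    have h5 : d * partialU (0, ρ) Q.char j = 0 := by
      have h6 := congrArg₂ (· - ·) h4 h1.symm
      simp only [← map_sub, sub_zero] at h6
      rw [h2, ← smul_eq_mul, ← map_smul]
      refine Eq.trans (congrArg _ ?_) h6
      apply Prod.ext
      · simp [tField]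
      · funext k
        have : (𝓔.lift (xLift θ z)).2 (0 + 1, (k : ℕ)) = tCoord 𝓔 θ k z := h.lift_apply_one hz k
        simp only [Prod.snd_sub, Pi.sub_apply, ContinuousLinearMap.prod_apply,
          ContinuousLinearMap.pi_apply, hj_def, this, Prod.smul_mk, Pi.smul_apply, smul_eq_mul]
        induction k using Fin.lastCases with
        | last => simp [hd]
        | cast k =>
          rw [hcast k]
          have : (k : ℕ) ≠ ρ := k.2.ne
          simp [this]
    exact sub_eq_zero.1 ((mul_eq_zero.1 h5).resolve_right (Q.partialU_char_ne_zero hj.1.2 (hj.2.2 0)))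

/-- The differential form whose integral surfaces are the solutions in local coordinates. -/
def connectionForm (𝓔 : EvolutionEquation) (θ : ChartSpace ρ → ℝ) (z : ChartSpace ρ) :
    ℝ × ℝ →L[ℝ] Fin ρ → ℝ :=
  (ContinuousLinearMap.fst ℝ ℝ ℝ).smulRight (tField 𝓔 θ z).2 +
    (ContinuousLinearMap.snd ℝ ℝ ℝ).smulRight (xField θ z).2

theorem prodMk_connectionForm (w : ℝ × ℝ) :
    (w, connectionForm 𝓔 θ z w) = w.1 • tField 𝓔 θ z + w.2 • xField θ z := by
  refine Prod.ext (Prod.ext ?_ ?_) (funext fun k => ?_) <;> simp [connectionForm, tField, xField]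

theorem IsChart.contDiffOn_tField (h : IsChart 𝓔 Q θ N) : ContDiffOn ℝ ∞ (tField 𝓔 θ) N :=
  contDiffOn_const.prodMk (contDiffOn_pi.2 fun k => h.contDiffOn_tCoord k)

theorem IsChart.contDiffOn_connectionForm (h : IsChart 𝓔 Q θ N) :
    ContDiffOn ℝ ∞ (connectionForm 𝓔 θ) N := by
  have h1 := contDiff_snd.comp_contDiffOn h.contDiffOn_tField
  have h2 := contDiff_snd.comp_contDiffOn (contDiffOn_xField h.smooth)
  exact ((ContinuousLinearMap.smulRightL ℝ (ℝ × ℝ) (Fin ρ → ℝ)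
      (ContinuousLinearMap.fst ℝ ℝ ℝ)).contDiff.comp_contDiffOn h1).add
    ((ContinuousLinearMap.smulRightL ℝ (ℝ × ℝ) (Fin ρ → ℝ)
      (ContinuousLinearMap.snd ℝ ℝ ℝ)).contDiff.comp_contDiffOn h2)

/-- The condition expresses that the two vector fields commute: `xField` applied to `tCoord` k and
`tField` applied to u_{k+1} both give `tCoord` (k + 1). The case k + 1 = ρ of the latter is where
D_t η = 0 enters. -/
theorem IsChart.compatible (h : IsChart 𝓔 Q θ N) (hz : z ∈ N)
    (hT : totalT Q.char (𝓔.lift (xLift θ z)) = 0) (w₁ w₂ : ℝ × ℝ) :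
    fderiv ℝ (connectionForm 𝓔 θ) z (w₁, connectionForm 𝓔 θ z w₁) w₂ =
      fderiv ℝ (connectionForm 𝓔 θ) z (w₂, connectionForm 𝓔 θ z w₂) w₁ := by
  have hd : HasFDerivAt (connectionForm 𝓔 θ) (fderiv ℝ (connectionForm 𝓔 θ) z) z :=
    (differentiableAt_of_contDiffOn h.isOpen h.contDiffOn_connectionForm hz).hasFDerivAt
  have key : ∀ (v : ChartSpace ρ) (w : ℝ × ℝ) (k : Fin ρ),
      fderiv ℝ (connectionForm 𝓔 θ) z v w k = w.1 * fderiv ℝ (tCoord 𝓔 θ k) z v +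
        w.2 * fderiv ℝ (fun z => graphCoord θ z k.succ) z v := by
    intro v w k
    have h1 : HasFDerivAt (fun z => connectionForm 𝓔 θ z w k) _ z :=
      hasFDerivAt_pi'.1 (hd.clm_apply (hasFDerivAt_const w z)) k
    have h2 := (differentiableAt_of_contDiffOn h.isOpen (h.contDiffOn_tCoord k) hz).hasFDerivAt
    have h3 := (differentiableAt_of_contDiffOn h.isOpen
      (contDiffOn_graphCoord h.smooth k.succ) hz).hasFDerivAt
    have h4 : HasFDerivAt (fun z => connectionForm 𝓔 θ z w k) _ z :=
      (h2.const_mul w.1).add (h3.const_mul w.2)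
    have h5 := congrArg (fun L => L v) (h1.unique h4)
    simpa using h5
  have hX : ∀ k : Fin ρ, fderiv ℝ (tCoord 𝓔 θ k) z (xField θ z) = tCoord 𝓔 θ (k + 1) z := fun k => by
    rw [tCoord_succ]
    rfl
  have hTf : ∀ k : Fin ρ, fderiv ℝ (fun z => graphCoord θ z k.succ) z (tField 𝓔 θ z) =
      tCoord 𝓔 θ (k + 1) z := fun k => h.fderiv_graphCoord_tField hz hT k.succ
  funext k
  rw [key, key, prodMk_connectionForm, prodMk_connectionForm]
  simp only [map_add, map_smul, smul_eq_mul, hX, hTf]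
  ring

end ChartSystem

/-- Local solutions of a compatible total differential equation. -/
theorem exists_solution_of_compatible_on {P F : Type} [NormedAddCommGroup P] [NormedSpace ℝ P]
    [FiniteDimensional ℝ P] [NormedAddCommGroup F] [NormedSpace ℝ F] [FiniteDimensional ℝ F]
    {C : P × F → P →L[ℝ] F} {N : Set (P × F)} (hN : IsOpen N) (hC : ContDiffOn ℝ ∞ C N)
    {p₀ : P} {y₀ : F} (h₀ : (p₀, y₀) ∈ N)
    (hcomp : ∀ z ∈ N, ∀ w₁ w₂, fderiv ℝ C z (w₁, C z w₁) w₂ = fderiv ℝ C z (w₂, C z w₂) w₁) :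
    ∃ (A : Set (P × F)) (v : P × F → F), IsOpen A ∧ (p₀, y₀) ∈ A ∧ ContDiffOn ℝ ∞ v A ∧
      (∀ y, (p₀, y) ∈ A → v (p₀, y) = y) ∧
      ∀ a ∈ A, (a.1, v a) ∈ N ∧ HasFDerivAt (fun p => v (p, a.2)) (C (a.1, v a)) a.1 := by
  have : CompleteSpace P := FiniteDimensional.complete ℝ P
  have : CompleteSpace F := FiniteDimensional.complete ℝ F
  -- The existence theorem wants a globally smooth right-hand side and base point 0: C is cut off
  -- near the point, and τ translates p₀ to 0.
  obtain ⟨g, hg, hgC⟩ := exists_contDiff_eventuallyEq hN h₀ hC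
  obtain ⟨O₀, hO₀, hO₀o, h₀O⟩ := mem_nhds_iff.1 (hgC.and (hN.mem_nhds h₀))
  let τ : P × F → P × F := fun z => (p₀ + z.1, z.2)
  have hτ : ContDiff ℝ ∞ τ := by fun_prop
  have hτd : ∀ z, HasFDerivAt τ (ContinuousLinearMap.id ℝ (P × F)) z := fun z =>
    (((hasFDerivAt_fst (𝕜 := ℝ) (p := z)).const_add p₀).prodMk hasFDerivAt_snd)
  have hgfd : ∀ z, fderiv ℝ (g ∘ τ) z = fderiv ℝ g (τ z) := fun z =>
    (((hg.differentiable (by simp)) (τ z)).hasFDerivAt.comp z (hτd z)).fderiv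
  obtain ⟨M, v, hM, hM₀, hv, hv₀, hvC⟩ := exists_solution_of_compatible (hg.comp hτ)
    (hO₀o.preimage hτ.continuous) (y₀ := y₀) (by simpa [τ] using h₀O) (by
      intro z hz w₁ w₂
      have h1 : fderiv ℝ g (τ z) = fderiv ℝ C (τ z) :=
        fderiv_congr_of_eqOn hO₀o (fun z hz => (hO₀ hz).1) hz
      have h2 : g (τ z) = C (τ z) := (hO₀ hz).1
      simp only [hgfd, h1, Function.comp_apply, h2]
      exact hcomp _ (hO₀ hz).2 w₁ w₂)
  let τ' : P × F → P × F := fun z => (z.1 - p₀, z.2)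
  have hτ' : ContDiff ℝ ∞ τ' := by fun_prop
  refine ⟨τ' ⁻¹' M, v ∘ τ', hM.preimage hτ'.continuous, by simpa [τ'] using hM₀,
    hv.comp hτ'.contDiffOn fun _ h => h, fun y hy => ?_, fun a ha => ?_⟩
  · simp only [Set.mem_preimage, τ', sub_self] at hy
    simpa [τ'] using hv₀ y hy
  · obtain ⟨h1, h2⟩ := hvC _ ha
    have h3 : τ ((τ' a).1, v (τ' a)) = (a.1, v (τ' a)) := by simp [τ, τ']
    rw [Set.mem_preimage, h3] at h1
    refine ⟨(hO₀ h1).2, ?_⟩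
    have h4 : g (a.1, v (τ' a)) = C (a.1, v (τ' a)) := (hO₀ h1).1
    rw [Function.comp_apply (f := g), h3, h4] at h2
    have h5 := HasFDerivAt.comp (f := fun p => p - p₀) a.1 h2 ((hasFDerivAt_id a.1).sub_const p₀)
    simpa [Function.comp_def] using h5

end EvolCondSym

end

noncomputable section

namespace EvolCondSym

/-! ### From conditional invariance to families of solutions -/

section IntegralSurfaces

variable {ρ : ℕ} {𝓔 : EvolutionEquation} {Q : ReducedOperator ρ} {θ g : ChartSpace ρ → ℝ}
  {N : Set (ChartSpace ρ)} {A : Set (ℝ × ℝ)} {V : ℝ × ℝ → Fin ρ → ℝ} {p : ℝ × ℝ}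

theorem hasFDerivAt_comp_integral (hN : IsOpen N) (hg : ContDiffOn ℝ ∞ g N)
    (hp : (p, V p) ∈ N ∧ HasFDerivAt V (connectionForm 𝓔 θ (p, V p)) p) :
    HasFDerivAt (fun p => g (p, V p)) (fderiv ℝ g (p, V p) ∘L
      (ContinuousLinearMap.id ℝ (ℝ × ℝ)).prod (connectionForm 𝓔 θ (p, V p))) p :=
  HasFDerivAt.comp (f := fun p => (p, V p)) p (differentiableAt_of_contDiffOn hN hg hp.1).hasFDerivAt
    ((hasFDerivAt_id p).prodMk hp.2)

theorem dT_comp_integral (hN : IsOpen N) (hg : ContDiffOn ℝ ∞ g N)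
    (hp : (p, V p) ∈ N ∧ HasFDerivAt V (connectionForm 𝓔 θ (p, V p)) p) :
    dT (fun p => g (p, V p)) p = fderiv ℝ g (p, V p) (tField 𝓔 θ (p, V p)) := by
  have h := hasFDerivAt_comp_integral hN hg hp
  rw [dT_eq_fderiv h.differentiableAt, h.fderiv, ContinuousLinearMap.comp_apply,
    ContinuousLinearMap.prod_apply, ContinuousLinearMap.id_apply, prodMk_connectionForm]
  simp

theorem dX_comp_integral (hN : IsOpen N) (hg : ContDiffOn ℝ ∞ g N)
    (hp : (p, V p) ∈ N ∧ HasFDerivAt V (connectionForm 𝓔 θ (p, V p)) p) :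
    dX (fun p => g (p, V p)) p = lieX θ g (p, V p) := by
  have h := hasFDerivAt_comp_integral hN hg hp
  rw [dX_eq_fderiv h.differentiableAt, h.fderiv, ContinuousLinearMap.comp_apply,
    ContinuousLinearMap.prod_apply, ContinuousLinearMap.id_apply, prodMk_connectionForm]
  simp [lieX]

theorem dX_iterate_comp_integral (hN : IsOpen N) (hθ : ContDiffOn ℝ ∞ θ N)
    (hg : ContDiffOn ℝ ∞ g N) (hA : IsOpen A)
    (hV : ∀ p ∈ A, (p, V p) ∈ N ∧ HasFDerivAt V (connectionForm 𝓔 θ (p, V p)) p) (k : ℕ) :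
    Set.EqOn (dX^[k] fun p => g (p, V p)) (fun p => (lieX θ)^[k] g (p, V p)) A := by
  induction k with
  | zero => exact fun _ _ => rfl
  | succ k ih =>
    intro p hp
    rw [Function.iterate_succ_apply', Function.iterate_succ_apply', dX_congr hA ih hp]
    exact dX_comp_integral hN (contDiffOn_lieX_iterate hN hθ hg k) (hV p hp)

theorem toXJet_jetOf_integral (h : IsChart 𝓔 Q θ N) (hA : IsOpen A)
    (hV : ∀ p ∈ A, (p, V p) ∈ N ∧ HasFDerivAt V (connectionForm 𝓔 θ (p, V p)) p) (hp : p ∈ A)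
    (n : ℕ) : toXJet n (jetOf (fun p => xCoord θ 0 (p, V p)) p) =
      toXJet n (𝓔.lift (xLift θ (p, V p))) := by
  rw [𝓔.toXJet_lift]
  exact Prod.ext rfl (funext fun k => dX_iterate_comp_integral h.isOpen h.smooth
    (contDiffOn_xCoord h.isOpen h.smooth 0) hA hV k hp)

theorem IsChart.isInvariantSolutionOn_integral (h : IsChart 𝓔 Q θ N)
    (hT : ∀ z ∈ N, totalT Q.char (𝓔.lift (xLift θ z)) = 0) (hA : IsOpen A)
    (hV : ∀ p ∈ A, (p, V p) ∈ N ∧ HasFDerivAt V (connectionForm 𝓔 θ (p, V p)) p) :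
    IsInvariantSolutionOn 𝓔 Q (fun p => xCoord θ 0 (p, V p)) A := by
  intro p hp
  have hc := h.mem_consequences (hV p hp).1
  have hX := toXJet_jetOf_integral h hA hV hp
  refine ⟨⟨?_, ?_⟩, ?_, ?_⟩
  · rw [hX]
    exact hc.1.1
  · rw [hX]
    exact hc.1.2
  · have h1 : dT (fun p => xCoord θ 0 (p, V p)) p = tCoord 𝓔 θ 0 (p, V p) := by
      rw [dT_comp_integral h.isOpen (contDiffOn_xCoord h.isOpen h.smooth 0) (hV p hp)]
      -- For ρ = 0 the index 0 is the last one, so D_t η = 0 matters already for u_t = H.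
      exact h.fderiv_graphCoord_tField (hV p hp).1 (hT _ (hV p hp).1) 0
    rw [EvolutionEquation.E, hX, 𝓔.toXJet_lift, sub_eq_zero]
    exact h1
  · rw [ReducedOperator.char, hX]
    exact hc.2.2 0

/-- Both jets lie in 𝓜 and have the same x-derivatives, so they coincide without any computation of
higher t-derivatives. -/
theorem IsChart.jetOf_integral (h : IsChart 𝓔 Q θ N)
    (hT : ∀ z ∈ N, totalT Q.char (𝓔.lift (xLift θ z)) = 0) (hA : IsOpen A)
    (hV : ∀ p ∈ A, (p, V p) ∈ N ∧ HasFDerivAt V (connectionForm 𝓔 θ (p, V p)) p)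
    (hVs : ContDiffOn ℝ ∞ V A) (hp : p ∈ A) :
    jetOf (fun p => xCoord θ 0 (p, V p)) p = 𝓔.lift (xLift θ (p, V p)) := by
  have hu : ContDiffOn ℝ ∞ (fun p => xCoord θ 0 (p, V p)) A :=
    (contDiffOn_xCoord h.isOpen h.smooth 0).comp (contDiffOn_id.prodMk hVs) fun p hp => (hV p hp).1
  refine eq_of_mem_consequences (h.mem_consequences (hV p hp).1)
    ((h.isInvariantSolutionOn_integral hT hA hV).mem_consequences hA hu hp) rfl fun k _ => ?_
  exact congrFun (congrArg Prod.snd (toXJet_jetOf_integral h hA hV hp k)) (Fin.last k)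

theorem IsChart.lift_toChart {j : Jet} (hj : j ∈ consequences 𝓔 Q)
    (hx : ∀ k, xCoord θ k (toChart ρ j) = j.2 (0, k)) : 𝓔.lift (xLift θ (toChart ρ j)) = j := by
  have : xLift θ (toChart ρ j) = (j.1, fun k => j.2 (0, k)) := Prod.ext rfl (funext hx)
  rw [this, ← 𝓔.eq_lift hj.1.1 hj.2.1]

/-- If the equation is conditionally invariant over `W`, then a nondegenerate family of invariant
solutions passes through each jet of `𝓜 ∩ W`. -/
theorem exists_isSolutionFamily {j : Jet} (hj : j ∈ consequences 𝓔 Q) {W : Set Jet} (hW : IsOpen W)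
    (hjW : j ∈ W) (hinv : CondInvariantOn 𝓔 Q W) :
    ∃ f U, IsSolutionFamily 𝓔 Q W f U ∧
      ∃ q ∈ U, jetOf (fun p => f p q.2) q.1 = j ∧ paramDet f q.1 q.2 ≠ 0 := by
  obtain ⟨θ, N₀, -, h₀, hjN₀, hx, -⟩ := exists_isChart hj
  have hlift := IsChart.lift_toChart hj hx
  -- Cutting the chart down to lifts in W makes D_t η = 0 available on all of it and keeps the jets
  -- of the solutions in W.
  set N := N₀ ∩ (fun z => 𝓔.lift (xLift θ z)) ⁻¹' W with hN_def
  have h : IsChart 𝓔 Q θ N :=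
    h₀.mono (h₀.continuousOn_lift.isOpen_inter_preimage h₀.isOpen hW) Set.inter_subset_left
  have hjN : toChart ρ j ∈ N := ⟨hjN₀, by simpa [hlift] using hjW⟩
  have hT : ∀ z ∈ N, totalT Q.char (𝓔.lift (xLift θ z)) = 0 := fun z hz => by
    have hc := h.mem_consequences hz
    rw [← prolong_E_eq (𝓔 := 𝓔) hc.2.2]
    exact hinv _ ⟨hc, hz.2⟩
  obtain ⟨A, v, hA, hjA, hv, hv₀, hvC⟩ := exists_solution_of_compatible_on (p₀ := (toChart ρ j).1)
    (y₀ := (toChart ρ j).2) h.isOpen h.contDiffOn_connectionForm hjN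
    fun z hz => h.compatible hz (hT z hz)
  let f : ℝ × ℝ → (Fin ρ → ℝ) → ℝ := fun p y => xCoord θ 0 (p, v (p, y))
  have hf : ContDiffOn ℝ ∞ (fun q : (ℝ × ℝ) × (Fin ρ → ℝ) => f q.1 q.2) A :=
    (contDiffOn_xCoord h.isOpen h.smooth 0).comp (contDiffOn_fst.prodMk hv) fun q hq => (hvC q hq).1
  have hslice : ∀ y, IsOpen {p | (p, y) ∈ A} := isOpen_slice hA
  have hvs : ∀ y, ContDiffOn ℝ ∞ (fun p => v (p, y)) {p | (p, y) ∈ A} := fun y =>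
    ContDiffOn.comp (f := fun p : ℝ × ℝ => (p, y)) hv (ContDiff.contDiffOn (by fun_prop))
      fun _ h => h
  have hV : ∀ y, ∀ p ∈ {p | (p, y) ∈ A}, (p, v (p, y)) ∈ N ∧
      HasFDerivAt (fun p => v (p, y)) (connectionForm 𝓔 θ (p, v (p, y))) p :=
    fun y p hp => hvC (p, y) hp
  have hjet : ∀ q ∈ A, jetOf (fun p => f p q.2) q.1 = 𝓔.lift (xLift θ (q.1, v q)) := fun q hq =>
    h.jetOf_integral (V := fun p => v (p, q.2)) hT (hslice q.2) (hV q.2) (hvs q.2) hq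
  have hcoord : ∀ q ∈ A, familyCoord f q = v q := fun q hq => by
    funext k
    exact (dX_iterate_comp_integral (V := fun p => v (p, q.2)) h.isOpen h.smooth
      (contDiffOn_xCoord h.isOpen h.smooth 0) (hslice q.2) (hV q.2) k hq).trans
      (xCoord_eq_coord h.isOpen k (hvC q hq).1)
  -- At the base point the parameters are themselves the values of f_0, …, f_{ρ-1}, so the
  -- derivative is the identity.
  have hdet : paramDet f (toChart ρ j).1 (toChart ρ j).2 ≠ 0 := by
    refine (paramDet_ne_zero_iff hA hf hjA).2 ?_
    have hopen : IsOpen {y | ((toChart ρ j).1, y) ∈ A} := hA.preimage (by fun_prop)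
    have h1 : HasFDerivAt (fun y => familyCoord f ((toChart ρ j).1, y))
        (ContinuousLinearMap.id ℝ _) (toChart ρ j).2 :=
      (hasFDerivAt_id _).congr_of_eventuallyEq (by
        filter_upwards [hopen.mem_nhds hjA] with y hy
        exact (hcoord _ hy).trans (hv₀ y hy))
    rw [h1.fderiv]
    exact Function.injective_id
  let U : Set ((ℝ × ℝ) × (Fin ρ → ℝ)) := A ∩ {q | paramDet f q.1 q.2 ≠ 0}
  have hU : IsOpen U := (continuousOn_paramDet hA hf).isOpen_inter_preimage hA isOpen_ne
  have hfU := hf.mono (Set.inter_subset_left : U ⊆ A)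
  refine ⟨f, U, ⟨hU, ⟨_, hjA, hdet⟩, hfU, fun y p hp => ?_, fun q hq => ?_,
    essentialOn_of_paramDet_ne_zero hU hfU fun q hq => hq.2⟩, toChart ρ j, ⟨hjA, hdet⟩, ?_, hdet⟩
  · exact h.isInvariantSolutionOn_integral (V := fun p => v (p, y)) hT (hslice y) (hV y) p hp.1
  · rw [hjet q hq.1]
    exact (hvC q hq.1).1.2
  · rw [hjet _ hjA]
    refine Eq.trans ?_ hlift
    congr 2
    exact Prod.ext rfl (hv₀ _ hjA)

end IntegralSurfaces

end EvolCondSym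

end

noncomputable section

namespace EvolCondSym

/-! ### From families of solutions to conditional invariance -/

section FromFamilies

variable {ρ : ℕ} {𝓔 : EvolutionEquation} {Q : ReducedOperator ρ} {W : Set Jet}
  {f : (ℝ × ℝ) → (Fin ρ → ℝ) → ℝ} {U : Set ((ℝ × ℝ) × (Fin ρ → ℝ))} {q : (ℝ × ℝ) × (Fin ρ → ℝ)}

theorem IsSolutionFamily.jet_mem_consequences (h : IsSolutionFamily 𝓔 Q W f U) (hq : q ∈ U) :
    jetOf (fun p => f p q.2) q.1 ∈ consequences 𝓔 Q :=
  (h.solution q.2).mem_consequences (isOpen_slice h.isOpen q.2) (contDiffOn_slice h.smooth q.2) hq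

theorem IsSolutionFamily.prolong_eq_zero (h : IsSolutionFamily 𝓔 Q W f U) (hq : q ∈ U) :
    Q.prolong 𝓔.r 𝓔.E (jetOf (fun p => f p q.2) q.1) = 0 :=
  (h.solution q.2).prolong_eq_zero (isOpen_slice h.isOpen q.2) (contDiffOn_slice h.smooth q.2) hq

theorem toChart_jetOf (f : (ℝ × ℝ) → (Fin ρ → ℝ) → ℝ) (q : (ℝ × ℝ) × (Fin ρ → ℝ)) :
    toChart ρ (jetOf (fun p => f p q.2) q.1) = (q.1, familyCoord f q) := rfl

theorem eq_of_toChart_eq {j j' : Jet} (hj : j ∈ consequences 𝓔 Q) (hj' : j' ∈ consequences 𝓔 Q)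
    (h : toChart ρ j' = toChart ρ j) (hρ : j'.2 (0, ρ) = j.2 (0, ρ)) : j' = j := by
  refine eq_of_mem_consequences hj hj' (congrArg Prod.fst h :) fun k hk => ?_
  rcases hk.lt_or_eq with hlt | rfl
  · exact congrFun (congrArg Prod.snd h) (⟨k, hlt⟩ : Fin ρ)
  · exact hρ

/-- A family of solutions that is nondegenerate at a point passes through all jets of `𝓜` near the
corresponding jet. -/
theorem IsSolutionFamily.exists_condInvariantOn (h : IsSolutionFamily 𝓔 Q W f U) (hq : q ∈ U)
    (hdet : paramDet f q.1 q.2 ≠ 0) :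
    ∃ W', IsOpen W' ∧ jetOf (fun p => f p q.2) q.1 ∈ W' ∧ CondInvariantOn 𝓔 Q W' := by
  set j := jetOf (fun p => f p q.2) q.1 with hj_def
  have hj : j ∈ consequences 𝓔 Q := h.jet_mem_consequences hq
  obtain ⟨θ, -, O, -, -, -, hO, hjO, huniq⟩ := exists_isChart hj
  have hlast : ∀ j' ∈ consequences 𝓔 Q, (toChart ρ j', j'.2 (0, ρ)) ∈ O →
      j'.2 (0, ρ) = θ (toChart ρ j') := fun j' hj' hO' => huniq _ hO' (by
    rw [addLast_toChart_self]
    exact hj'.2.2 0)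
  let J : (ℝ × ℝ) × (Fin ρ → ℝ) → Jet := fun q => jetOf (fun p => f p q.2) q.1
  have hc : Continuous fun j : Jet => (toChart ρ j, j.2 (0, ρ)) :=
    continuous_toChart.prodMk (by fun_prop)
  -- On O the equation η = 0 is equivalent to u_ρ = θ, so members of the family with jets over O are
  -- told apart by chart coordinates alone.
  let U₁ : Set ((ℝ × ℝ) × (Fin ρ → ℝ)) := U ∩ J ⁻¹' ((fun j => (toChart ρ j, j.2 (0, ρ))) ⁻¹' O)
  have hU₁ : IsOpen U₁ :=
    (continuousOn_jetOf_family h.isOpen h.smooth).isOpen_inter_preimage h.isOpen (hO.preimage hc)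
  let Ψ : (ℝ × ℝ) × (Fin ρ → ℝ) → ChartSpace ρ := fun q => (q.1, familyCoord f q)
  have hΨ : ContDiffOn ℝ ∞ Ψ U := contDiffOn_fst.prodMk (contDiffOn_familyCoord h.isOpen h.smooth)
  have hsurj : (fderiv ℝ Ψ q).range = ⊤ := by
    have hinj := (paramDet_ne_zero_iff h.isOpen h.smooth hq).1 hdet
    rw [(hasFDerivAt_familyCoord_param h.isOpen h.smooth hq).fderiv] at hinj
    have hsur := (LinearMap.injective_iff_surjective (f := (fderiv ℝ (familyCoord f) q ∘L
      ContinuousLinearMap.inr ℝ (ℝ × ℝ) (Fin ρ → ℝ)).toLinearMap)).1 hinj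
    have hfd : HasFDerivAt Ψ _ q := (hasFDerivAt_fst (𝕜 := ℝ) (p := q)).prodMk
      (differentiableAt_of_contDiffOn h.isOpen (contDiffOn_familyCoord h.isOpen h.smooth)
        hq).hasFDerivAt
    rw [hfd.fderiv, LinearMap.range_eq_top]
    rintro ⟨w, y⟩
    obtain ⟨y', hy'⟩ := hsur (y - fderiv ℝ (familyCoord f) q (w, 0))
    refine ⟨(w, y'), Prod.ext rfl ?_⟩
    have h1 : fderiv ℝ (familyCoord f) q (0, y') = y - fderiv ℝ (familyCoord f) q (w, 0) := hy'
    have h2 : ((w, y') : (ℝ × ℝ) × (Fin ρ → ℝ)) = (w, 0) + (0, y') := by simp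
    show fderiv ℝ (familyCoord f) q (w, y') = y
    rw [h2, map_add, h1]
    abel
  -- Open mapping from surjectivity of the derivative: the family reaches every chart point near
  -- that of j.
  have himg : Ψ '' U₁ ∈ 𝓝 (Ψ q) := by
    have hst := (hΨ.contDiffAt (h.isOpen.mem_nhds hq)).hasStrictFDerivAt (by simp)
    rw [← hst.map_nhds_eq_of_surj hsurj]
    exact image_mem_map (hU₁.mem_nhds ⟨hq, hjO⟩)
  refine ⟨toChart ρ ⁻¹' interior (Ψ '' U₁) ∩ (fun j => (toChart ρ j, j.2 (0, ρ))) ⁻¹' O,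
    (isOpen_interior.preimage continuous_toChart).inter (hO.preimage hc),
    ⟨mem_interior_iff_mem_nhds.2 himg, hjO⟩, ?_⟩
  rintro j' ⟨hj', hj'Ψ, hj'O⟩
  obtain ⟨q', ⟨hq'U, hq'O⟩, hq'⟩ := interior_subset hj'Ψ
  -- Both jets lie in 𝓜 and over O and share chart coordinates; hence they share u_ρ = θ and are
  -- equal.
  have hJ : J q' = j' := by
    refine eq_of_toChart_eq hj' (h.jet_mem_consequences hq'U) hq' ?_
    rw [hlast _ (h.jet_mem_consequences hq'U) hq'O, hlast _ hj' hj'O]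
    exact congrArg θ hq'
  rw [← hJ]
  exact h.prolong_eq_zero hq'U

/-- The functions `f_0, …, f_{ρ-1}` of a family of solutions satisfy the total differential equation
given by `connectionForm`. -/
theorem IsSolutionFamily.jetOf_eq_lift (h : IsSolutionFamily 𝓔 Q W f U)
    {θ : ChartSpace ρ → ℝ} {N : Set (ChartSpace ρ)} (hch : IsChart 𝓔 Q θ N) (hq : q ∈ U)
    (hqN : (q.1, familyCoord f q) ∈ N)
    (hθ : (dX^[ρ] fun p => f p q.2) q.1 = θ (q.1, familyCoord f q)) :
    jetOf (fun p => f p q.2) q.1 = 𝓔.lift (xLift θ (q.1, familyCoord f q)) := by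
  refine eq_of_toChart_eq (hch.mem_consequences hqN) (h.jet_mem_consequences hq) ?_ ?_
  · refine Prod.ext rfl (funext fun k => ?_)
    exact Eq.trans (b := familyCoord f q k) rfl ((𝓔.lift_x (xLift θ (q.1, familyCoord f q)) k).trans (
      xCoord_eq_coord hch.isOpen k hqN)).symm
  · refine hθ.trans ?_
    rw [𝓔.lift_x]
    exact (xCoord_eq_last hch.isOpen hqN).symm

/-- The t- and x-derivatives of f_k are the coordinates (1, k) and (0, k + 1) of the jet, which the
chart determines. Conditional invariance is not needed, so the lemma applies to arbitrary families.
-/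
theorem IsSolutionFamily.hasFDerivAt_familyCoord (h : IsSolutionFamily 𝓔 Q W f U)
    {θ : ChartSpace ρ → ℝ} {N : Set (ChartSpace ρ)} (hch : IsChart 𝓔 Q θ N) (hq : q ∈ U)
    (hqN : (q.1, familyCoord f q) ∈ N)
    (hθ : (dX^[ρ] fun p => f p q.2) q.1 = θ (q.1, familyCoord f q)) :
    HasFDerivAt (fun p => familyCoord f (p, q.2))
      (connectionForm 𝓔 θ (q.1, familyCoord f q)) q.1 := by
  have hjet := h.jetOf_eq_lift hch hq hqN hθ
  have hA := isOpen_slice h.isOpen q.2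
  have hu := contDiffOn_slice h.smooth q.2
  refine hasFDerivAt_pi'.2 fun k => ?_
  have hd : DifferentiableAt ℝ (dX^[(k : ℕ)] fun p => f p q.2) q.1 :=
    differentiableAt_of_contDiffOn hA (contDiffOn_dX_iterate hA hu k) hq
  have hT : dT (dX^[(k : ℕ)] fun p => f p q.2) q.1 = tCoord 𝓔 θ k (q.1, familyCoord f q) := by
    rw [← hch.lift_apply_one hqN, ← hjet]
    rfl
  have hX : dX (dX^[(k : ℕ)] fun p => f p q.2) q.1 =
      graphCoord θ (q.1, familyCoord f q) k.succ := by
    refine Eq.trans ?_ (xCoord_eq_graphCoord hch.isOpen k.succ hqN)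
    refine Eq.trans ?_ (𝓔.lift_x (xLift θ (q.1, familyCoord f q)) k.succ)
    rw [← hjet, Fin.val_succ]
    exact (congrFun (Function.iterate_succ_apply' dX k fun p => f p q.2) q.1).symm
  refine hd.hasFDerivAt.congr_fderiv (ContinuousLinearMap.ext fun w => ?_)
  have hw : w = w.1 • ((1, 0) : ℝ × ℝ) + w.2 • ((0, 1) : ℝ × ℝ) := by
    ext <;> simp
  conv_lhs => rw [hw, map_add, map_smul, map_smul, ← dT_eq_fderiv hd, ← dX_eq_fderiv hd, hT, hX]
  simp [connectionForm, tField, xField]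

/-- If the parameters of a family of solutions are essential, then the family is nondegenerate at
some point. -/
theorem IsSolutionFamily.exists_paramDet_ne_zero (h : IsSolutionFamily 𝓔 Q W f U) :
    ∃ q ∈ U, paramDet f q.1 q.2 ≠ 0 := by
  by_contra! hdet
  obtain ⟨q₁, hq₁⟩ := h.nonempty
  have hj := h.jet_mem_consequences hq₁
  obtain ⟨θ, N, O, hch, hN₁, -, hO, hO₁, huniq⟩ := exists_isChart hj
  rw [toChart_jetOf] at hN₁
  -- A Lipschitz bound near the chart point is what uniqueness requires.
  obtain ⟨K, S, hS, hlip⟩ := ((hch.contDiffOn_connectionForm.contDiffAt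
    (hch.isOpen.mem_nhds hN₁)).of_le (m := 1) (by simp)).exists_lipschitzOnWith
  let J : (ℝ × ℝ) × (Fin ρ → ℝ) → Jet := fun q => jetOf (fun p => f p q.2) q.1
  have hJ : ContinuousAt J q₁ :=
    (continuousOn_jetOf_family h.isOpen h.smooth).continuousAt (h.isOpen.mem_nhds hq₁)
  have hc : Continuous fun j : Jet => (toChart ρ j, j.2 (0, ρ)) :=
    continuous_toChart.prodMk (by fun_prop)
  have hnhds : {q | q ∈ U ∧ (q.1, familyCoord f q) ∈ N ∩ S ∧
      ((q.1, familyCoord f q), (dX^[ρ] fun p => f p q.2) q.1) ∈ O} ∈ 𝓝 q₁ := by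
    have h1 := hJ.eventually (continuous_toChart.continuousAt.eventually
      (inter_mem (hch.isOpen.mem_nhds hN₁) hS))
    have h2 := hJ.eventually (hc.continuousAt.eventually (hO.mem_nhds hO₁))
    filter_upwards [h.isOpen.mem_nhds hq₁, h1, h2] with q hq hq1 hq2 using ⟨hq, hq1, hq2⟩
  obtain ⟨ε, hε, hball⟩ := Metric.mem_nhds_iff.1 hnhds
  obtain ⟨p₁, y₁⟩ := q₁
  rw [← ball_prod_same] at hball
  have hmem : ∀ p ∈ Metric.ball p₁ ε, ∀ y ∈ Metric.ball y₁ ε,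
      (p, y) ∈ U ∧ (p, familyCoord f (p, y)) ∈ N ∧ (p, familyCoord f (p, y)) ∈ S ∧
      (dX^[ρ] fun p => f p y) p = θ (p, familyCoord f (p, y)) := by
    intro p hp y hy
    obtain ⟨h1, ⟨h2, h3⟩, h4⟩ := hball (Set.mk_mem_prod hp hy)
    refine ⟨h1, h2, h3, huniq _ h4 ?_⟩
    have h5 := addLast_toChart_self (ρ := ρ) (jetOf (fun p => f p y) p)
    have h6 := (h.jet_mem_consequences h1).2.2 0
    exact (congrArg Q.η h5).trans h6
  have hp₁ : p₁ ∈ Metric.ball p₁ ε := Metric.mem_ball_self hε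
  have hw : ContDiffOn ℝ ∞ (fun y => familyCoord f (p₁, y)) (Metric.ball y₁ ε) :=
    ContDiffOn.comp (f := fun y : Fin ρ → ℝ => (p₁, y)) (contDiffOn_familyCoord h.isOpen h.smooth)
      (ContDiff.contDiffOn (by fun_prop)) fun y hy => (hmem p₁ hp₁ y hy).1
  -- The initial data at p₁ have nowhere injective derivative in the parameters, so on O' the
  -- parameters y and s(ζ(y)) give equal data.
  obtain ⟨σ, hσ, ζ, s, O', T, hO', hO'ne, hO'sub, hT, hζ, hs, hζT, hsO, hfac⟩ :=
    exists_factorization_of_not_injective Metric.isOpen_ball (Metric.nonempty_ball.2 hε) hw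
      fun y hy hinj => (paramDet_ne_zero_iff h.isOpen h.smooth (hmem p₁ hp₁ y hy).1).2 hinj
        (hdet _ (hmem p₁ hp₁ y hy).1)
  have hσ' : σ < ρ := by simpa using hσ
  have hint : ∀ y ∈ Metric.ball y₁ ε, ∀ p ∈ Metric.ball p₁ ε, (p, familyCoord f (p, y)) ∈ S ∧
      HasFDerivAt (fun p => familyCoord f (p, y)) (connectionForm 𝓔 θ (p, familyCoord f (p, y))) p :=
    fun y hy p hp => by
      obtain ⟨h1, h2, h3, h4⟩ := hmem p hp y hy
      exact ⟨h3, h.hasFDerivAt_familyCoord hch h1 h2 h4⟩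
  have hval : ∀ y ∈ Metric.ball y₁ ε, ∀ p ∈ Metric.ball p₁ ε,
      f p y = xCoord θ 0 (p, familyCoord f (p, y)) := fun y hy p hp => by
    obtain ⟨h1, h2, h3, h4⟩ := hmem p hp y hy
    have h5 := congrFun (congrArg Prod.snd (h.jetOf_eq_lift hch h1 h2 h4)) (0, 0)
    exact h5.trans (𝓔.lift_x _ _)
  refine h.essential (Metric.ball p₁ ε ×ˢ O') (fun q hq => (hmem q.1 hq.1 q.2 (hO'sub hq.2)).1)
    (Metric.isOpen_ball.prod hO') ((Metric.nonempty_ball.2 hε).prod hO'ne) σ hσ'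
    -- The reduced family is f itself, evaluated at the representative parameter s(z).
    ⟨ζ, Metric.ball p₁ ε ×ˢ T, fun z => f z.1 (s z.2), ?_, Metric.isOpen_ball.prod hT, ?_, ?_⟩
  · refine hζ.mono ?_
    rintro _ ⟨q, hq, rfl⟩
    exact hq.2
  · exact ContDiffOn.comp (f := fun z : (ℝ × ℝ) × (Fin σ → ℝ) => (z.1, s z.2)) h.smooth
      (contDiffOn_fst.prodMk (hs.comp contDiffOn_snd fun z hz => hz.2))
      fun z hz => (hmem z.1 hz.1 _ (hsO hz.2)).1
  · rintro ⟨p, y⟩ ⟨hp, hy⟩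
    have hy' := hsO (hζT hy)
    refine ⟨⟨hp, hζT hy⟩, ?_⟩
    -- Equal data at p₁ propagate over the ball, so the solutions with parameters y and s(ζ(y))
    -- coincide there.
    have heq := eqOn_of_hasFDerivAt_of_lipschitzOnWith hlip
      ((convex_ball p₁ ε).starConvex hp₁) (hint y (hO'sub hy)) (hint _ hy') (hfac y hy).symm hp
    show f p y = f p (s (ζ y))
    rw [hval y (hO'sub hy) p hp, hval _ hy' p hp]
    exact congrArg (fun v => xCoord θ 0 (p, v)) heq

theorem IsSolutionFamily.mono {W' : Set Jet} (h : IsSolutionFamily 𝓔 Q W f U) (hW : W ⊆ W') :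
    IsSolutionFamily 𝓔 Q W' f U :=
  ⟨h.isOpen, h.nonempty, h.smooth, h.solution, fun q hq => hW (h.jets q hq), h.essential⟩

end FromFamilies

end EvolCondSym

end

/-! ### The three equivalences. -/

theorem mainTheorem5 {ρ : ℕ} (𝓔 : EvolCondSym.EvolutionEquation)
    (Q : EvolCondSym.ReducedOperator ρ) :
    -- conditional invariance over an open set of jets means that a `ρ`-parametric family
    -- of `Q`-invariant solutions passes through every point of `𝓜` there
    (∀ W : Set EvolCondSym.Jet, IsOpen W →
      (EvolCondSym.CondInvariantOn 𝓔 Q W ↔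
        ∀ j ∈ EvolCondSym.consequences 𝓔 Q ∩ W,
          ∃ f U, EvolCondSym.IsSolutionFamily 𝓔 Q W f U ∧
            ∃ q ∈ U, EvolCondSym.jetOf (fun p => f p q.2) q.1 = j)) ∧
    -- a single family exists over `W` if and only if conditional invariance holds near some point
    (∀ W : Set EvolCondSym.Jet, IsOpen W →
      ((∃ W' ⊆ W, IsOpen W' ∧ (EvolCondSym.consequences 𝓔 Q ∩ W').Nonempty ∧
          EvolCondSym.CondInvariantOn 𝓔 Q W') ↔
        ∃ f U, EvolCondSym.IsSolutionFamily 𝓔 Q W f U)) ∧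
    -- a single family that is nondegenerate at a point exists if and only if conditional
    -- invariance holds near that point
    (∀ j ∈ EvolCondSym.consequences 𝓔 Q,
      ((∃ W, IsOpen W ∧ j ∈ W ∧ EvolCondSym.CondInvariantOn 𝓔 Q W) ↔
        ∃ f U, EvolCondSym.IsSolutionFamily 𝓔 Q Set.univ f U ∧
          ∃ q ∈ U, EvolCondSym.jetOf (fun p => f p q.2) q.1 = j ∧
            EvolCondSym.paramDet f q.1 q.2 ≠ 0)) := by
  refine ⟨fun W hW => ⟨fun h j hj => ?_, fun h j hj => ?_⟩, fun W hW => ⟨?_, ?_⟩,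
    fun j hj => ⟨?_, ?_⟩⟩
  · obtain ⟨f, U, hf, q, hq, hqj, -⟩ := EvolCondSym.exists_isSolutionFamily hj.1 hW hj.2 h
    exact ⟨f, U, hf, q, hq, hqj⟩
  · obtain ⟨f, U, hf, q, hq, rfl⟩ := h j hj
    exact hf.prolong_eq_zero hq
  · rintro ⟨W', hW'W, hW', ⟨j, hj⟩, h⟩
    obtain ⟨f, U, hf, -⟩ := EvolCondSym.exists_isSolutionFamily hj.1 hW' hj.2 h
    exact ⟨f, U, hf.mono hW'W⟩
  · rintro ⟨f, U, hf⟩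
    obtain ⟨q, hq, hdet⟩ := hf.exists_paramDet_ne_zero
    obtain ⟨W', hW', hqW', h⟩ := hf.exists_condInvariantOn hq hdet
    exact ⟨W' ∩ W, Set.inter_subset_right, hW'.inter hW,
      ⟨_, hf.jet_mem_consequences hq, hqW', hf.jets q hq⟩, fun j hj => h j ⟨hj.1, hj.2.1⟩⟩
  · rintro ⟨W, hW, hjW, h⟩
    obtain ⟨f, U, hf, hq⟩ := EvolCondSym.exists_isSolutionFamily hj hW hjW h
    exact ⟨f, U, hf.mono (Set.subset_univ W), hq⟩
  · rintro ⟨f, U, hf, q, hq, rfl, hdet⟩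
    exact hf.exists_condInvariantOn hq hdet
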